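/- Fix a local dimension $d$ and a degeneracy $f$ (absolute constants). Consider an open chain of $n$ spins of local dimension $d$ with Hamiltonian $H=\sum_{i=1}^{n-1}H_i$, where $0\le H_i\le 1$ acts on the spins $i$ and $i+1$. Suppose that the ground space of $H$ (the eigenspace of its lowest eigenvalue $\epsilon_0$) has dimension exactly $f$, and let $\epsilon>0$ be the energy gap, i.e. the difference between the lowest eigenvalue of $H$ above $\epsilon_0$ and $\epsilon_0$. For a bipartite pure state with reduced density matrix $\rho_A$ put $R_\alpha=(1-\alpha)^{-1}\log\mathrm{tr}\,\rho_A^\alpha$ for $0<\alpha<1$ and $S=-\mathrm{tr}(\rho_A\log\rho_A)$. Write $\tilde O(x)$ for a bound of the form $C\,x\,\log^k(2+x)$, with $C$ and $k$ depending only on $d$ and $f$ (and in (b) also on $c$), but not on $n$, $H$, $\epsilon$, $\alpha$, the cut or the state. (a) For every (normalized) ground state, every $0<\alpha<1$ and every cut of the chain into two intervals, $R_\alpha\le\tilde O(\alpha^{-3}/\epsilon)$. (b) For every exponent $c\in\mathbb N$, every (normalized) ground state $\psi$ can be approximated by a normalized matrix product state $\phi$ (with open boundary conditions) with $|\langle\psi,\phi\rangle|>1-n^{-c}$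 and bond dimension at most $2^{\tilde O(\epsilon^{-1/4}\max\{\log n,\,\epsilon^{-1}\}^{3/4})}$. Thus the bond dimension is $2^{\tilde O(\epsilon^{-1/4}\log^{3/4}n)}$ whenever $\epsilon^{-1}=O(\log n)$, in particular for fixed $\epsilon$ as $n\to\infty$. (c) Consequently, if the ground state is unique ($f=1$), its von Neumann entanglement entropy across every cut satisfies $S\le\tilde O(\epsilon^{-1})$. -/

import Mathlib

open scoped Matrix ComplexOrder

noncomputable section

namespace SpinChain

/-- Basis configurations of a chain of `n` spins of local dimension `d`. -/
abbrev Config (n d : ℕ) : Type := Fin n → Fin d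

/-- The Hilbert space `(ℂ^d)^{⊗ n}`, in the computational basis. -/
abbrev Space (n d : ℕ) : Type := EuclideanSpace ℂ (Config n d)

/-- The operator `h` on `ℂ^d ⊗ ℂ^d`, acting on the spins `i` and `j` of the chain
and as the identity on all other spins. -/
def bondTerm {n d : ℕ} (i j : Fin n) (h : Matrix (Fin d × Fin d) (Fin d × Fin d) ℂ) :
    Matrix (Config n d) (Config n d) ℂ :=
  fun σ τ => if ∀ l, l ≠ i → l ≠ j → σ l = τ l then h (σ i, σ j) (τ i, τ j) else 0

/-- The nearest-neighbour Hamiltonian `∑ i, h i` on the open chain, where `h i` acts on the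
spins `i` and `i + 1`. -/
def hamiltonian {n d : ℕ} (h : Fin (n - 1) → Matrix (Fin d × Fin d) (Fin d × Fin d) ℂ) :
    Matrix (Config n d) (Config n d) ℂ :=
  ∑ i : Fin (n - 1), bondTerm ⟨i.1, by omega⟩ ⟨i.1 + 1, by omega⟩ (h i)

/-- The energy levels (real eigenvalues) of a Hamiltonian. -/
def energies {n d : ℕ} (H : Matrix (Config n d) (Config n d) ℂ) : Set ℝ :=
  {E | Module.End.HasEigenvalue (Matrix.toEuclideanLin H) (E : ℂ)}

/-- The eigenspace of `H` for the energy `E`. -/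
def energySpace {n d : ℕ} (H : Matrix (Config n d) (Config n d) ℂ) (E : ℝ) :
    Submodule ℂ (Space n d) :=
  Module.End.eigenspace (Matrix.toEuclideanLin H) (E : ℂ)

/-- `h` is a family of interactions `0 ≤ h i ≤ 1` whose Hamiltonian has ground-state energy `E₀`,
an exactly `f`-fold degenerate ground space, and energy gap `ε` (the difference between the lowest
energy above `E₀` and `E₀`). -/
structure IsGapped {n d : ℕ} (h : Fin (n - 1) → Matrix (Fin d × Fin d) (Fin d × Fin d) ℂ)
    (f : ℕ) (E₀ ε : ℝ) : Prop where
  nonneg : ∀ i, (h i).PosSemidef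
  le_one : ∀ i, (1 - h i).PosSemidef
  ground : IsLeast (energies (hamiltonian h)) E₀
  degeneracy : Module.finrank ℂ (energySpace (hamiltonian h) E₀) = f
  gap : IsLeast (energies (hamiltonian h) \ {E₀}) (E₀ + ε)

/-- `ψ` is a (normalized) ground state, `E₀` being the ground-state energy. -/
def IsGroundState {n d : ℕ} (h : Fin (n - 1) → Matrix (Fin d × Fin d) (Fin d × Fin d) ℂ)
    (E₀ : ℝ) (ψ : Space n d) : Prop :=
  ψ ∈ energySpace (hamiltonian h) E₀ ∧ ‖ψ‖ = 1

/-- The coefficients of `ψ`, as a matrix whose rows are the configurations of the first `k` spins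
and whose columns are the configurations of the remaining ones. -/
def cutMatrix {n d : ℕ} (k : ℕ) (ψ : Space n d) :
    Matrix ({i : Fin n // i.1 < k} → Fin d) ({i : Fin n // ¬ i.1 < k} → Fin d) ℂ :=
  fun a b => ψ ((Equiv.piEquivPiSubtypeProd (fun i : Fin n => i.1 < k) fun _ => Fin d).symm (a, b))

/-- The reduced density matrix of `ψ` on the first `k` spins: the partial trace of the projector
onto `ψ` over the remaining spins. -/
def reducedDensity {n d : ℕ} (k : ℕ) (ψ : Space n d) :
    Matrix ({i : Fin n // i.1 < k} → Fin d) ({i : Fin n // i.1 < k} → Fin d) ℂ :=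
  cutMatrix k ψ * (cutMatrix k ψ)ᴴ

theorem reducedDensity_isHermitian {n d : ℕ} (k : ℕ) (ψ : Space n d) :
    (reducedDensity k ψ).IsHermitian :=
  Matrix.isHermitian_mul_conjTranspose_self _

/-- The Rényi entropy `(1 - α)⁻¹ log tr ρ^α` of the reduced density matrix `ρ` of `ψ` on the first
`k` spins. -/
def renyiEntropy {n d : ℕ} (α : ℝ) (k : ℕ) (ψ : Space n d) : ℝ :=
  (1 - α)⁻¹ * Real.log (∑ a, (reducedDensity_isHermitian k ψ).eigenvalues a ^ α)

/-- The von Neumann entropy `- tr (ρ log ρ)` of the reduced density matrix `ρ` of `ψ` on the first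
`k` spins. -/
def vonNeumannEntropy {n d : ℕ} (k : ℕ) (ψ : Space n d) : ℝ :=
  ∑ a, Real.negMulLog ((reducedDensity_isHermitian k ψ).eigenvalues a)

/-- `φ` is a matrix product state (with open boundary conditions) of bond dimension `D`:
its amplitudes are `⟨l, A₁^{σ₁} ⋯ Aₙ^{σₙ} r⟩` with `D × D` matrices. Smaller bond dimensions
(on some bonds) are covered, by padding with zeros. -/
def IsMPS {n d : ℕ} (D : ℕ) (φ : Space n d) : Prop :=
  ∃ (A : Fin n → Fin d → Matrix (Fin D) (Fin D) ℂ) (l r : Fin D → ℂ),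
    ∀ σ : Config n d, φ σ = l ⬝ᵥ ((List.ofFn fun i => A i (σ i)).prod *ᵥ r)

/-- The bound `C x log(2 + x)^k`, an instance of `Õ(x) = O(x polylog x)`. -/
def softBound (C : ℝ) (k : ℕ) (x : ℝ) : ℝ := C * (x * Real.log (2 + x) ^ k)

end SpinChain

end

/-! The engine is an approximate ground space projector of low Schmidt rank across a given cut: an
operator `K` fixing an `f`-dimensional space `W` close to the ground space, up to stretching it,
while shrinking `Wᗮ` by `δ` and multiplying Schmidt ranks by at most `D`.

Existence of `K`. Keep a window of `s` bonds near the cut and truncate the energies of the two outer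
parts at height `t` above their minima. Nested commutators of nearest-neighbour terms grow only
factorially, so conjugating a boundary bond by an exponential of the outer Hamiltonian costs a
constant. An Agmon-type weight argument (`norm_upperProj_apply_le`) then shows that low eigenvectors
of the truncated Hamiltonian have only `exp (-t / 4)` of their norm above the truncation. A min-max
comparison (`IsWindow.exists_spectralSpace`) gives exactly `f` low eigenvalues, half of the gap, and
an eigenspace `W` close to the ground space. The truncated Hamiltonian has spectral width `u = s + 2
+ 2 * t`, so a Chebyshev polynomial of degree `s ^ 2` has `δ` about `exp (-s ^ 2 √(ε / u))`. Its
Schmidt rank is small because a word of length at most `s ^ 2` in the window bonds uses one of them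
at most `s` times; cutting at that bond (`rankBound_polyOp`) gives `D = exp (O(s log s))`.

Use of `K`. If product vectors have overlap `ν` with every vector of `W`, an Auerbach family lifts
each vector of `W` to a short combination of `f` product vectors. Applying `K` yields a vector of
Schmidt rank at most `D f` near the target, hence a product vector of larger overlap. As long as `D
δ ^ 2` is small, iterating this raises the overlap to `1 / (4 D f)`
(`hasProductOverlap_of_isGroundProjector`). One more application of `K` approximates ground states
with rank `D f`.

Parameters. With `x = 1 / min ε 1` and `s` about `t ^ (3/4) x ^ (1/4)`, every `t` above a
polylogarithmic multiple of `x` gives error `exp (-t / 32)` at rank `exp (Õ(t ^ (3/4) x ^ (1/4)))`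
(`exists_lowRank_approx`).

Conclusions. The approximations for a sequence of values of `t` control the tail of the spectrum of
the reduced density matrix, and Hölder's inequality on successive blocks bounds `tr ρ ^ α`;
requiring rank at most `exp (α t / 64)` forces `t` of order `x α ^ (-4)`, and `α t` gives `α ^ (-3)
/ ε`. The von Neumann entropy is at most the Rényi entropy of index `1 / 2`. For matrix product
states, take `t` also of order `log n` and project onto the approximating supports at all cuts in
turn. -/

noncomputable section

/-! ### Conjugating a bond by the exponential of its neighbours. -/

section ConjExp
variable {𝔸 : Type*} [NormedRing 𝔸] [NormedAlgebra ℂ 𝔸]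

theorem ContinuousLinearMap.mul_apply_eq {V : Type*} [NormedAddCommGroup V] [NormedSpace ℂ V]
    (f g : V →L[ℂ] V) (x : V) : (f * g) x = f (g x) := rfl

/-- The commutator with `a`. -/
def commutatorCLM (a : 𝔸) : 𝔸 →L[ℂ] 𝔸 :=
  ContinuousLinearMap.mul ℂ 𝔸 a - (ContinuousLinearMap.mul ℂ 𝔸).flip a

theorem commutatorCLM_apply (a x : 𝔸) : commutatorCLM a x = a * x - x * a := by
  simp [commutatorCLM]

theorem hasSum_exp_smul_pow {𝔹 : Type*} [NormedRing 𝔹] [NormedAlgebra ℂ 𝔹] [CompleteSpace 𝔹]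
    (a : 𝔹) : HasSum (fun n : ℕ => ((n.factorial : ℂ)⁻¹) • a ^ n) (NormedSpace.exp a) :=
  NormedSpace.exp_series_hasSum_exp' (𝕂 := ℂ) a

theorem exp_mulLeft_apply [CompleteSpace 𝔸] (a x : 𝔸) :
    NormedSpace.exp (ContinuousLinearMap.mul ℂ 𝔸 a) x = NormedSpace.exp a * x := by
  have h1 := (hasSum_exp_smul_pow (ContinuousLinearMap.mul ℂ 𝔸 a)).mapL
    (ContinuousLinearMap.apply ℂ 𝔸 x)
  have h2 := (hasSum_exp_smul_pow a).mul_right x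
  have : ∀ n : ℕ, ((ContinuousLinearMap.mul ℂ 𝔸 a) ^ n) x = a ^ n * x := by
    intro n
    induction n with
    | zero => simp
    | succ n ih => rw [pow_succ', pow_succ', ContinuousLinearMap.mul_apply_eq, ih]; simp [mul_assoc]
  refine HasSum.unique ?_ h2
  refine Eq.mp (congrArg (fun F => HasSum F _) (funext fun n => ?_)) h1
  rw [ContinuousLinearMap.apply_apply, smul_apply, this]
  simp

theorem exp_mulRight_apply [CompleteSpace 𝔸] (a x : 𝔸) :
    NormedSpace.exp ((ContinuousLinearMap.mul ℂ 𝔸).flip a) x = x * NormedSpace.exp a := by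
  have h1 := (hasSum_exp_smul_pow ((ContinuousLinearMap.mul ℂ 𝔸).flip a)).mapL
    (ContinuousLinearMap.apply ℂ 𝔸 x)
  have h2 := (hasSum_exp_smul_pow a).mul_left x
  have : ∀ n : ℕ, (((ContinuousLinearMap.mul ℂ 𝔸).flip a) ^ n) x = x * a ^ n := by
    intro n
    induction n with
    | zero => simp
    | succ n ih => rw [pow_succ', pow_succ, ContinuousLinearMap.mul_apply_eq, ih]; simp [mul_assoc]
  refine HasSum.unique ?_ h2
  refine Eq.mp (congrArg (fun F => HasSum F _) (funext fun n => ?_)) h1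
  rw [ContinuousLinearMap.apply_apply, smul_apply, this]
  simp

/-- Left and right multiplication commute, so the exponential of their difference is the product of
their exponentials. -/
theorem exp_commutatorCLM_apply [CompleteSpace 𝔸] (a x : 𝔸) :
    NormedSpace.exp (commutatorCLM a) x = NormedSpace.exp a * x * NormedSpace.exp (-a) := by
  let : NormedAlgebra ℚ (𝔸 →L[ℂ] 𝔸) := NormedAlgebra.restrictScalars ℚ ℂ _
  have hc : Commute (ContinuousLinearMap.mul ℂ 𝔸 a) ((ContinuousLinearMap.mul ℂ 𝔸).flip (-a)) := by
    ext x; simp [mul_assoc]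
  have : commutatorCLM a = ContinuousLinearMap.mul ℂ 𝔸 a + (ContinuousLinearMap.mul ℂ 𝔸).flip (-a) := by
    ext x; simp [commutatorCLM, sub_eq_add_neg]
  rw [this, NormedSpace.exp_add_of_commute hc, ContinuousLinearMap.mul_apply_eq, exp_mulRight_apply,
    exp_mulLeft_apply, mul_assoc]

/-- If the iterated commutators of `a` with `x` grow at most like `2 ^ n n!`, then conjugating `x`
by `exp (a / 4)` at most doubles its size. -/
theorem norm_exp_mul_mul_exp_neg_le [CompleteSpace 𝔸] (a x : 𝔸)
    (h : ∀ n : ℕ, ‖(commutatorCLM a ^ n) x‖ ≤ 2 ^ n * n.factorial) :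
    ‖NormedSpace.exp ((4⁻¹ : ℂ) • a) * x * NormedSpace.exp (-((4⁻¹ : ℂ) • a))‖ ≤ 2 := by
  have hs := (hasSum_exp_smul_pow (commutatorCLM ((4⁻¹ : ℂ) • a))).mapL
    (ContinuousLinearMap.apply ℂ 𝔸 x)
  rw [← exp_commutatorCLM_apply]
  have hsm : commutatorCLM ((4⁻¹ : ℂ) • a) = (4⁻¹ : ℂ) • commutatorCLM a := by
    ext x; simp [commutatorCLM_apply, smul_sub]
  -- The factor `4⁻¹` turns `2 ^ n n! / n!` into the terms of a geometric series of ratio `1 / 2`.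
  have hg : HasSum (fun n : ℕ => ((1 : ℝ) / 2) ^ n) 2 := hasSum_geometric_two
  have := tsum_of_norm_bounded hg (f := fun n : ℕ => ContinuousLinearMap.apply ℂ 𝔸 x
    (((n.factorial : ℂ)⁻¹) • commutatorCLM ((4⁻¹ : ℂ) • a) ^ n)) (fun n => by
      have hpow : ((4⁻¹ : ℂ) • commutatorCLM a) ^ n = (4⁻¹ : ℂ) ^ n • commutatorCLM a ^ n := by
        induction n with
        | zero => simp
        | succ n ih =>
          ext y
          simp only [pow_succ', ih, ContinuousLinearMap.mul_apply_eq, smul_apply,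
            map_smul, smul_smul]
          ring_nf
      rw [hsm, hpow]
      simp only [map_smul, ContinuousLinearMap.apply_apply, norm_smul, norm_inv, norm_pow]
      simp only [Complex.norm_natCast, Complex.norm_ofNat]
      have hf : (0 : ℝ) < n.factorial := by exact_mod_cast n.factorial_pos
      calc (n.factorial : ℝ)⁻¹ * ((4⁻¹ : ℝ) ^ n * ‖(commutatorCLM a ^ n) x‖)
          ≤ (n.factorial : ℝ)⁻¹ * ((4⁻¹ : ℝ) ^ n * (2 ^ n * n.factorial)) := by gcongr; exact h n
        _ = (1 / 2) ^ n := by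
          field_simp
          try (rw [← mul_pow]; norm_num))
  rw [hs.tsum_eq] at this
  exact this

/-- Iterated commutators of a one-dimensional nearest-neighbour sum with its next term. -/
theorem norm_commutatorCLM_pow_le (Z : ℕ → 𝔸) (hn : ∀ i, ‖Z i‖ ≤ 1)
    (hc : ∀ i j, i + 2 ≤ j → Commute (Z i) (Z j)) (m n : ℕ) :
    ‖(commutatorCLM (∑ i ∈ Finset.Ico 1 m, Z i) ^ n) (Z 0)‖ ≤ 2 ^ n * n.factorial := by
  have key : ∀ n : ℕ, (commutatorCLM (∑ i ∈ Finset.Ico 1 m, Z i) ^ n) (Z 0) ∈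
      Algebra.adjoin ℂ (Z '' Set.Iic n) ∧
      ‖(commutatorCLM (∑ i ∈ Finset.Ico 1 m, Z i) ^ n) (Z 0)‖ ≤ 2 ^ n * n.factorial := by
    intro n
    induction n with
    | zero => exact ⟨Algebra.subset_adjoin ⟨0, by simp, by simp⟩, by simpa using hn 0⟩
    | succ n ih =>
      obtain ⟨hm, hb⟩ := ih
      rw [pow_succ', ContinuousLinearMap.mul_apply_eq]
      set y := (commutatorCLM (∑ i ∈ Finset.Ico 1 m, Z i) ^ n) (Z 0) with hy
      -- The `n`-th commutator is supported on `Z 0, …, Z n`, so only `Z 1, …, Z (n + 1)` contribute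
      -- to the next one: `n + 1` commutators, each costing a factor `2`.
      have hcomm : ∀ j, n + 2 ≤ j → Z j * y - y * Z j = 0 := by
        intro j hj
        have : y ∈ Subalgebra.centralizer ℂ {Z j} := by
          refine Algebra.adjoin_le ?_ hm
          rintro _ ⟨i, hi, rfl⟩
          rw [SetLike.mem_coe, Subalgebra.mem_centralizer_iff]
          rintro _ rfl
          simp only [Set.mem_Iic] at hi
          exact (hc i j (by omega)).eq.symm
        rw [Subalgebra.mem_centralizer_iff] at this
        rw [this (Z j) rfl, sub_self]
      have hsum : commutatorCLM (∑ i ∈ Finset.Ico 1 m, Z i) y =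
          ∑ i ∈ (Finset.Ico 1 m).filter (· ≤ n + 1), (Z i * y - y * Z i) := by
        rw [commutatorCLM_apply, Finset.sum_mul, Finset.mul_sum, ← Finset.sum_sub_distrib,
          Finset.sum_filter]
        refine Finset.sum_congr rfl fun i _ => ?_
        split_ifs with h
        · rfl
        · exact hcomm i (by omega)
      rw [hsum]
      constructor
      · refine Subalgebra.sum_mem _ fun i hi => ?_
        have hZ : Z i ∈ Algebra.adjoin ℂ (Z '' Set.Iic (n + 1)) :=
          Algebra.subset_adjoin ⟨i, (Finset.mem_filter.1 hi).2, rfl⟩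
        have hy' : y ∈ Algebra.adjoin ℂ (Z '' Set.Iic (n + 1)) :=
          Algebra.adjoin_mono (Set.image_mono (Set.Iic_subset_Iic.2 (by omega))) hm
        exact Subalgebra.sub_mem _ (Subalgebra.mul_mem _ hZ hy') (Subalgebra.mul_mem _ hy' hZ)
      · calc ‖∑ i ∈ (Finset.Ico 1 m).filter (· ≤ n + 1), (Z i * y - y * Z i)‖
            ≤ ∑ i ∈ (Finset.Ico 1 m).filter (· ≤ n + 1), 2 * (2 ^ n * (n.factorial : ℝ)) := by
              refine norm_sum_le_of_le _ fun i _ => ?_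
              calc ‖Z i * y - y * Z i‖ ≤ ‖Z i‖ * ‖y‖ + ‖y‖ * ‖Z i‖ :=
                    (norm_sub_le _ _).trans (add_le_add (norm_mul_le _ _) (norm_mul_le _ _))
                _ ≤ 1 * ‖y‖ + ‖y‖ * 1 := by gcongr <;> exact hn i
                _ ≤ 2 * (2 ^ n * (n.factorial : ℝ)) := by linarith
          _ ≤ (n + 1 : ℕ) * (2 * (2 ^ n * (n.factorial : ℝ))) := by
              rw [Finset.sum_const, nsmul_eq_mul]
              gcongr
              calc _ ≤ (Finset.Icc 1 (n + 1)).card := Finset.card_le_card fun i hi => by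
                    simp at hi ⊢; omega
                _ = n + 1 := by simp
          _ = 2 ^ (n + 1) * ((n + 1).factorial : ℝ) := by
              rw [Nat.factorial_succ]; push_cast; ring
  exact (key n).2

end ConjExp
end

noncomputable section

/-! ### Quadratic forms and functional calculus in finite dimension. -/

section Hilbert
variable {E : Type*} [NormedAddCommGroup E] [InnerProductSpace ℂ E]

theorem re_inner_le_of_le {S T : E →L[ℂ] E} (h : S ≤ T) (x : E) :
    (inner ℂ x (S x)).re ≤ (inner ℂ x (T x)).re := by
  rw [ContinuousLinearMap.le_def] at h
  have := h.re_inner_nonneg_right x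
  simp only [sub_apply, inner_sub_right] at this
  simpa using this

theorem algebraMap_real_apply (c : ℝ) (x : E) :
    (algebraMap ℝ (E →L[ℂ] E) c) x = (c : ℂ) • x := by
  rw [Algebra.algebraMap_eq_smul_one, smul_apply, one_apply_eq_self]
  exact (Complex.coe_smul c x).symm

theorem re_inner_smul_self (c : ℝ) (x : E) : (inner ℂ x ((c : ℂ) • x)).re = c * ‖x‖ ^ 2 := by
  rw [inner_smul_right, inner_self_eq_norm_sq_to_K]
  simp [← Complex.ofReal_pow]

theorem mul_norm_sq_le_re_inner {T : E →L[ℂ] E} {c : ℝ} (h : algebraMap ℝ (E →L[ℂ] E) c ≤ T)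
    (x : E) : c * ‖x‖ ^ 2 ≤ (inner ℂ x (T x)).re := by
  have := re_inner_le_of_le h x
  rwa [algebraMap_real_apply, re_inner_smul_self] at this

theorem re_inner_le_mul_norm_sq {T : E →L[ℂ] E} {c : ℝ} (h : T ≤ algebraMap ℝ (E →L[ℂ] E) c)
    (x : E) : (inner ℂ x (T x)).re ≤ c * ‖x‖ ^ 2 := by
  have := re_inner_le_of_le h x
  rwa [algebraMap_real_apply, re_inner_smul_self] at this

end Hilbert

section FiniteCalculus
variable {E : Type*} [NormedAddCommGroup E] [InnerProductSpace ℂ E] [FiniteDimensional ℂ E]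

/-- On a finite spectrum every function is continuous, so the continuous functional calculus also
applies to the indicator functions that define spectral projections. -/
theorem finite_spectrum_real (T : E →L[ℂ] E) : (spectrum ℝ T).Finite := by
  have h : (spectrum ℂ T).Finite := by
    have := AlgEquiv.spectrum_eq (Module.End.toContinuousLinearMap (𝕜 := ℂ) E).symm T
    rw [← this]
    exact Module.End.finite_spectrum _
  rw [← spectrum.preimage_algebraMap (R := ℝ) ℂ]
  exact h.preimage (FaithfulSMul.algebraMap_injective ℝ ℂ).injOn

theorem continuousOn_spectrum_real (T : E →L[ℂ] E) (f : ℝ → ℝ) : ContinuousOn f (spectrum ℝ T) :=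
  (finite_spectrum_real T).continuousOn f

theorem cfc_mul_cfc (T : E →L[ℂ] E) (f g : ℝ → ℝ) :
    cfc f T * cfc g T = cfc (fun x => f x * g x) T :=
  (cfc_mul f g T (continuousOn_spectrum_real T f) (continuousOn_spectrum_real T g)).symm

theorem cfc_add_cfc (T : E →L[ℂ] E) (f g : ℝ → ℝ) :
    cfc f T + cfc g T = cfc (fun x => f x + g x) T :=
  (cfc_add T f g (continuousOn_spectrum_real T f) (continuousOn_spectrum_real T g)).symm

theorem cfc_le_cfc (T : E →L[ℂ] E) (f g : ℝ → ℝ) (h : ∀ x ∈ spectrum ℝ T, f x ≤ g x) :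
    cfc f T ≤ cfc g T :=
  cfc_mono h (continuousOn_spectrum_real T f) (continuousOn_spectrum_real T g)

theorem IsSelfAdjoint.inner_left_eq {T : E →L[ℂ] E} (h : IsSelfAdjoint T) (x y : E) :
    inner ℂ (T x) y = inner ℂ x (T y) := by
  conv_lhs => rw [← ContinuousLinearMap.adjoint_inner_right, ← ContinuousLinearMap.star_eq_adjoint,
    h.star_eq]

end FiniteCalculus

/-! ### Agmon estimate: decay of low eigenvectors above the truncation. -/

section Agmon
variable {E : Type*} [NormedAddCommGroup E] [InnerProductSpace ℂ E] [FiniteDimensional ℂ E]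

/-- The spectral projection of `T` onto the values above `c`. -/
def upperProj (T : E →L[ℂ] E) (c : ℝ) : E →L[ℂ] E := cfc (fun x : ℝ => if c < x then (1 : ℝ) else 0) T

/-- The spectral projection of `T` onto the values up to `c`. -/
def lowerProj (T : E →L[ℂ] E) (c : ℝ) : E →L[ℂ] E := cfc (fun x : ℝ => if c < x then (0 : ℝ) else 1) T

/-- The truncation of `T` from above at `c`. -/
def truncAt (T : E →L[ℂ] E) (c : ℝ) : E →L[ℂ] E := cfc (fun x : ℝ => min x c) T

theorem norm_upperProj_le (T : E →L[ℂ] E) (c : ℝ) : ‖upperProj T c‖ ≤ 1 :=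
  norm_cfc_le zero_le_one fun x _ => by split_ifs <;> simp

theorem norm_lowerProj_le (T : E →L[ℂ] E) (c : ℝ) : ‖lowerProj T c‖ ≤ 1 :=
  norm_cfc_le zero_le_one fun x _ => by split_ifs <;> simp

theorem cfc_exp_quarter {A : E →L[ℂ] E} (hA : IsSelfAdjoint A) (c : ℝ) :
    cfc (fun x : ℝ => Real.exp (c * x)) A = NormedSpace.exp ((c : ℂ) • A) := by
  have h1 : cfc (fun x : ℝ => Real.exp (c * x)) A = cfc Real.exp (cfc (fun x : ℝ => c * x) A) :=
    cfc_comp' Real.exp (fun x : ℝ => c * x) A (Real.continuous_exp.continuousOn)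
      (continuousOn_spectrum_real A _) hA
  have h2 : cfc (fun x : ℝ => c * x) A = (c : ℂ) • A := by
    rw [cfc_const_mul_id c A hA]; rfl
  rw [h1, h2, CFC.real_exp_eq_normedSpace_exp]

/-- The weight is a contraction times `exp (A / 4)`. Its inverse agrees with a multiple of `exp (-A
/ 4)` below `a + t` and equals `exp (-t / 4)` above. The lower part contributes the unweighted
conjugation, of norm at most `2`; the upper part contributes at most `1`, since the weight never
exceeds `exp (t / 4)`. -/
theorem norm_weight_conj_le {A h : E →L[ℂ] E} (hA : IsSelfAdjoint A) (hh : ‖h‖ ≤ 1)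
    (hconj : ‖NormedSpace.exp ((4⁻¹ : ℂ) • A) * h * NormedSpace.exp (-((4⁻¹ : ℂ) • A))‖ ≤ 2)
    (a t : ℝ) :
    ‖cfc (fun x : ℝ => Real.exp ((min x (a + t) - a) / 4)) A * h *
      cfc (fun x : ℝ => Real.exp (-((min x (a + t) - a) / 4))) A‖ ≤ 3 := by
  set w := cfc (fun x : ℝ => Real.exp ((min x (a + t) - a) / 4)) A with hw
  set F := cfc (fun x : ℝ => Real.exp ((min x (a + t) - x) / 4)) A with hF
  have e1 : NormedSpace.exp ((4⁻¹ : ℂ) • A) = cfc (fun x : ℝ => Real.exp (4⁻¹ * x)) A := by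
    rw [cfc_exp_quarter hA]; norm_num
  have e2 : NormedSpace.exp (-((4⁻¹ : ℂ) • A)) = cfc (fun x : ℝ => Real.exp (-4⁻¹ * x)) A := by
    rw [cfc_exp_quarter hA]; norm_num
  have hwF : w = (Real.exp (-a / 4)) • (F * NormedSpace.exp ((4⁻¹ : ℂ) • A)) := by
    rw [e1, hF, cfc_mul_cfc, ← cfc_smul _ _ _ (continuousOn_spectrum_real _ _), hw]
    congr 1; ext x
    simp only [smul_eq_mul]
    rw [← Real.exp_add, ← Real.exp_add]; congr 1; ring
  have hw' : cfc (fun x : ℝ => Real.exp (-((min x (a + t) - a) / 4))) A =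
      (Real.exp (a / 4)) • (NormedSpace.exp (-((4⁻¹ : ℂ) • A)) * lowerProj A (a + t)) +
      (Real.exp (-t / 4)) • upperProj A (a + t) := by
    rw [e2, lowerProj, upperProj, cfc_mul_cfc, ← cfc_smul _ _ _ (continuousOn_spectrum_real _ _),
      ← cfc_smul _ _ _ (continuousOn_spectrum_real _ _), cfc_add_cfc]
    congr 1; ext x
    simp only [smul_eq_mul]
    split_ifs with hx
    · rw [min_eq_right hx.le]; simp; ring_nf
    · rw [min_eq_left (not_lt.1 hx)]; simp only [mul_one, mul_zero, add_zero]
      rw [← Real.exp_add]; congr 1; ring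
  have hFn : ‖F‖ ≤ 1 := norm_cfc_le zero_le_one fun x _ => by
    rw [Real.norm_eq_abs, Real.abs_exp, Real.exp_le_one_iff]
    have := min_le_left x (a + t); linarith
  have hwn : ‖w‖ ≤ Real.exp (t / 4) := norm_cfc_le (Real.exp_pos _).le fun x _ => by
    rw [Real.norm_eq_abs, Real.abs_exp, Real.exp_le_exp]
    have := min_le_right x (a + t); linarith
  have hdecomp : w * h * cfc (fun x : ℝ => Real.exp (-((min x (a + t) - a) / 4))) A =
      F * (NormedSpace.exp ((4⁻¹ : ℂ) • A) * h * NormedSpace.exp (-((4⁻¹ : ℂ) • A))) *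
        lowerProj A (a + t) + (Real.exp (-t / 4)) • (w * h * upperProj A (a + t)) := by
    rw [hw', mul_add, mul_smul_comm, mul_smul_comm]
    congr 1
    conv_lhs => rw [hwF]
    rw [smul_mul_assoc, smul_mul_assoc, smul_smul, ← Real.exp_add]
    rw [show a / 4 + -a / 4 = 0 by ring, Real.exp_zero, one_smul]
    simp only [mul_assoc]
  rw [hdecomp]
  have n1 : ‖F * (NormedSpace.exp ((4⁻¹ : ℂ) • A) * h * NormedSpace.exp (-((4⁻¹ : ℂ) • A))) *
        lowerProj A (a + t)‖ ≤ 1 * 2 * 1 := by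
    refine (norm_mul_le _ _).trans (mul_le_mul ((norm_mul_le _ _).trans
      (mul_le_mul hFn hconj (norm_nonneg _) zero_le_one)) (norm_lowerProj_le _ _) (norm_nonneg _)
      (by norm_num))
  have n2 : ‖(Real.exp (-t / 4)) • (w * h * upperProj A (a + t))‖ ≤
      Real.exp (-t / 4) * (Real.exp (t / 4) * 1 * 1) := by
    rw [norm_smul, Real.norm_eq_abs, Real.abs_exp]
    gcongr
    refine (norm_mul_le _ _).trans (mul_le_mul ((norm_mul_le _ _).trans
      (mul_le_mul hwn hh (norm_nonneg _) (Real.exp_pos _).le)) (norm_upperProj_le _ _)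
      (norm_nonneg _) (by positivity))
  have e3 : Real.exp (-t / 4) * (Real.exp (t / 4) * 1 * 1) = 1 := by
    rw [mul_one, mul_one, ← Real.exp_add]; simp; ring
  linarith [norm_add_le (F * (NormedSpace.exp ((4⁻¹ : ℂ) • A) * h *
    NormedSpace.exp (-((4⁻¹ : ℂ) • A))) * lowerProj A (a + t))
    ((Real.exp (-t / 4)) • (w * h * upperProj A (a + t)))]

/-- Exponential decay of the high-energy part of a low-energy eigenvector of a truncated
Hamiltonian. -/
theorem norm_upperProj_apply_le {A h C : E →L[ℂ] E} (hA : IsSelfAdjoint A) (hAC : Commute A C)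
    {a c t e : ℝ} (ha : algebraMap ℝ (E →L[ℂ] E) a ≤ A) (hc : algebraMap ℝ (E →L[ℂ] E) c ≤ C)
    (hh : ‖h‖ ≤ 1)
    (hconj : ‖NormedSpace.exp ((4⁻¹ : ℂ) • A) * h * NormedSpace.exp (-((4⁻¹ : ℂ) • A))‖ ≤ 2)
    (ht : 0 ≤ t) {v : E} (hv : (truncAt A (a + t) + h + C) v = (e : ℂ) • v) (he : e ≤ a + c + 3) :
    ‖upperProj A (a + t) v‖ ≤ 16 * Real.exp (-t / 4) * ‖v‖ := by
  have hsp : ∀ x ∈ spectrum ℝ A, a ≤ x := (algebraMap_le_iff_le_spectrum (ha := hA)).1 ha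
  -- The weighted vector `w v` satisfies the eigenvalue equation with `h` replaced by `w h w⁻¹`, of
  -- norm at most `3`. Its truncated energy is therefore at most `a + 6`, although the weight
  -- favours high energies; this bounds its norm.
  set w := cfc (fun x : ℝ => Real.exp ((min x (a + t) - a) / 4)) A with hw
  set w' := cfc (fun x : ℝ => Real.exp (-((min x (a + t) - a) / 4))) A with hw'
  have hwsa : IsSelfAdjoint w := cfc_predicate _ _
  have hww : w' * w = 1 := by
    rw [hw, hw', cfc_mul_cfc, ← cfc_one ℝ A hA]
    congr 1; ext x; rw [← Real.exp_add]; simp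
  set u := w v with hu
  have h1 : truncAt A (a + t) u + C u + (w * h * w') u = (e : ℂ) • u := by
    have hc1 : truncAt A (a + t) * w = w * truncAt A (a + t) := (cfc_commute_cfc _ _ A).eq
    have hc2 : C * w = w * C := ((hAC.cfc_real _).eq).symm
    have q1 : truncAt A (a + t) u = w (truncAt A (a + t) v) := by
      rw [hu, ← ContinuousLinearMap.mul_apply_eq, hc1, ContinuousLinearMap.mul_apply_eq]
    have q2 : C u = w (C v) := by
      rw [hu, ← ContinuousLinearMap.mul_apply_eq, hc2, ContinuousLinearMap.mul_apply_eq]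
    have q3 : (w * h * w') u = w (h v) := by
      rw [hu, ← ContinuousLinearMap.mul_apply_eq, mul_assoc, hww, mul_one,
        ContinuousLinearMap.mul_apply_eq]
    rw [q1, q2, q3, hu, ← map_smul, ← hv]
    simp only [add_apply, map_add]; abel
  have h2 : (inner ℂ u (truncAt A (a + t) u)).re + (inner ℂ u (C u)).re +
      (inner ℂ u ((w * h * w') u)).re = e * ‖u‖ ^ 2 := by
    rw [← re_inner_smul_self, ← h1, inner_add_right, inner_add_right]; simp
  have h3 := mul_norm_sq_le_re_inner hc u
  have h4 : -(3 * ‖u‖ ^ 2) ≤ (inner ℂ u ((w * h * w') u)).re := by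
    have : |(inner ℂ u ((w * h * w') u)).re| ≤ 3 * ‖u‖ ^ 2 := by
      refine (Complex.abs_re_le_norm _).trans ((norm_inner_le_norm _ _).trans ?_)
      have := (ContinuousLinearMap.le_opNorm (w * h * w') u).trans
        (mul_le_mul_of_nonneg_right (norm_weight_conj_le hA hh hconj a t) (norm_nonneg _))
      nlinarith [norm_nonneg u]
    exact (abs_le.1 this).1
  have h5 : (inner ℂ u (truncAt A (a + t) u)).re ≤ (a + 6) * ‖u‖ ^ 2 := by
    nlinarith [sq_nonneg ‖u‖]
  -- Pointwise, with `y` the truncated energy above `a`, this is `exp (y / 2) * (7 - y) ≤ 7 * exp (7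
  -- / 2)`; the value `7` exceeds the energy bound `6` by one so that one copy of `w * w` is left
  -- over.
  have h6 : w * w ≤ w * truncAt A (a + t) * w - (a + 6) • (w * w) +
      algebraMap ℝ _ (7 * Real.exp (7 / 2)) := by
    have : w * truncAt A (a + t) * w - (a + 6) • (w * w) +
        algebraMap ℝ (E →L[ℂ] E) (7 * Real.exp (7 / 2)) =
        cfc (fun x : ℝ => Real.exp ((min x (a + t) - a) / 4) * min x (a + t) *
          Real.exp ((min x (a + t) - a) / 4) + -(a + 6) * (Real.exp ((min x (a + t) - a) / 4) *
          Real.exp ((min x (a + t) - a) / 4)) + 7 * Real.exp (7 / 2)) A := by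
      rw [← cfc_add_cfc, ← cfc_add_cfc, ← cfc_mul_cfc, ← cfc_mul_cfc, cfc_const _ _ hA,
        sub_eq_add_neg, cfc_const_mul _ _ _ (continuousOn_spectrum_real _ _), ← cfc_mul_cfc,
        neg_smul]
      rfl
    rw [this, hw, cfc_mul_cfc]
    refine cfc_le_cfc _ _ _ fun x hx => ?_
    have hax := hsp x hx
    set y := min x (a + t) - a with hy
    have hy0 : 0 ≤ y := by rw [hy, sub_nonneg]; exact le_min hax (by linarith)
    have hm : min x (a + t) = y + a := by rw [hy]; ring
    rw [hm]
    have hexp : Real.exp (y / 4) * Real.exp (y / 4) = Real.exp (y / 2) := by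
      rw [← Real.exp_add]; congr 1; ring
    have hkey : Real.exp (y / 2) * (7 - y) ≤ 7 * Real.exp (7 / 2) := by
      by_cases h7 : y ≤ 7
      · have : Real.exp (y / 2) ≤ Real.exp (7 / 2) := Real.exp_le_exp.2 (by linarith)
        nlinarith [Real.exp_pos (y / 2)]
      · nlinarith [Real.exp_pos (y / 2), Real.exp_pos (7 / 2)]
    nlinarith
  have h7 : ‖u‖ ^ 2 ≤ 7 * Real.exp (7 / 2) * ‖v‖ ^ 2 := by
    have := re_inner_le_of_le h6 v
    simp only [add_apply, sub_apply, inner_add_right, inner_sub_right, ContinuousLinearMap.mul_apply_eq,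
      smul_apply, algebraMap_real_apply] at this
    rw [← hwsa.inner_left_eq v (w v), ← hwsa.inner_left_eq v (truncAt A (a + t) (w v)),
      ← Complex.coe_smul, inner_smul_right, ← hwsa.inner_left_eq v (w v)] at this
    simp only [← hu] at this
    rw [Complex.add_re, Complex.sub_re, re_inner_smul_self, Complex.re_ofReal_mul,
      inner_self_eq_norm_sq_to_K] at this
    simp only [Complex.coe_algebraMap, ← Complex.ofReal_pow, Complex.ofReal_re] at this
    linarith
  -- Above the truncation the weight is the constant `exp (t / 4)`.
  have h8 : upperProj A (a + t) v = ((Real.exp (-t / 4) : ℝ) : ℂ) • upperProj A (a + t) u := by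
    have : upperProj A (a + t) = Real.exp (-t / 4) • (upperProj A (a + t) * w) := by
      rw [upperProj, hw, cfc_mul_cfc, ← cfc_smul _ _ _ (continuousOn_spectrum_real _ _)]
      congr 1; ext x
      split_ifs with hx
      · rw [min_eq_right hx.le, one_mul, smul_eq_mul, ← Real.exp_add]; ring_nf; simp
      · simp
    conv_lhs => rw [this]
    rw [smul_apply, ContinuousLinearMap.mul_apply_eq, ← hu, ← Complex.coe_smul]
  have h9 : ‖u‖ ≤ 16 * ‖v‖ := by
    refine le_of_sq_le_sq ?_ (by positivity) 
    have he : Real.exp (7 / 2) ≤ 35 := by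
      have := Real.exp_one_lt_d9
      have e4 : Real.exp (7 / 2) ^ 2 = Real.exp 1 ^ 7 := by
        rw [← Real.exp_nat_mul, ← Real.exp_nat_mul]; norm_num
      have e5 : Real.exp 1 ^ 7 ≤ 2.7182818286 ^ 7 := by gcongr
      nlinarith [Real.exp_pos (7 / 2)]
    nlinarith [sq_nonneg ‖v‖]
  rw [h8, norm_smul]
  have h10 : ‖upperProj A (a + t) u‖ ≤ ‖u‖ := by
    have := (ContinuousLinearMap.le_opNorm (upperProj A (a + t)) u).trans
      (mul_le_mul_of_nonneg_right (norm_upperProj_le A (a + t)) (norm_nonneg u))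
    simpa using this
  rw [Complex.norm_real, Real.norm_eq_abs, Real.abs_exp]
  calc Real.exp (-t / 4) * ‖upperProj A (a + t) u‖ ≤ Real.exp (-t / 4) * (16 * ‖v‖) := by
        gcongr; exact h10.trans h9
    _ = _ := by ring

end Agmon
end

noncomputable section

/-! ### Operators on one side of a cut, and Schmidt rank. -/

namespace SpinChain

/-- Operators on the chain. -/
abbrev Op (n d : ℕ) : Type := Space n d →L[ℂ] Space n d

/-- The configuration that agrees with `a` on the first `k` sites and with `σ` on the others. -/
def splice {n d : ℕ} (k : ℕ) (a σ : Config n d) : Config n d := fun i => if i.1 < k then a i else σ i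

/-- Precomposition of a wave function with a map of configurations. -/
def pullback {n d : ℕ} (g : Config n d → Config n d) : Op n d :=
  LinearMap.toContinuousLinearMap
    { toFun := fun ψ => WithLp.toLp 2 fun σ => ψ (g σ)
      map_add' := fun _ _ => rfl
      map_smul' := fun _ _ => rfl }

variable {n d : ℕ}

@[simp]
theorem pullback_apply (g : Config n d → Config n d) (ψ : Space n d) (σ : Config n d) :
    pullback g ψ σ = ψ (g σ) := rfl

/-- The operators acting on the first `k` sites. -/
def leftAlg (n d k : ℕ) : Subalgebra ℂ (Op n d) :=
  Subalgebra.centralizer ℂ (Set.range fun b : Config n d => pullback fun σ => splice k σ b)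

/-- The operators acting on the sites from `k` on. -/
def rightAlg (n d k : ℕ) : Subalgebra ℂ (Op n d) :=
  Subalgebra.centralizer ℂ (Set.range fun a : Config n d => pullback (splice k a))

theorem mem_leftAlg {k : ℕ} {A : Op n d} :
    A ∈ leftAlg n d k ↔ ∀ b ψ σ, A (pullback (fun τ => splice k τ b) ψ) σ = A ψ (splice k σ b) := by
  rw [leftAlg, Subalgebra.mem_centralizer_iff]
  constructor
  · intro h b ψ σ
    have := h _ ⟨b, rfl⟩
    have := congrArg (fun T : Op n d => T ψ σ) this
    exact this.symm
  · rintro h _ ⟨b, rfl⟩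
    ext ψ σ
    exact (h b ψ σ).symm

theorem mem_rightAlg {k : ℕ} {A : Op n d} :
    A ∈ rightAlg n d k ↔ ∀ a ψ, A (pullback (splice k a) ψ) = pullback (splice k a) (A ψ) := by
  rw [rightAlg, Subalgebra.mem_centralizer_iff]
  constructor
  · intro h b ψ
    exact (congrArg (fun T : Op n d => T ψ) (h _ ⟨b, rfl⟩)).symm
  · rintro h _ ⟨b, rfl⟩
    ext1 ψ
    exact (h b ψ).symm

/-- The algebra is a commutant, so it is closed under functional calculus; this keeps truncated
outer Hamiltonians on their side of the cut. -/
theorem cfc_mem_leftAlg {k : ℕ} {A : Op n d} (h : A ∈ leftAlg n d k)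
    (f : ℝ → ℝ) : cfc f A ∈ leftAlg n d k := by
  rw [leftAlg, Subalgebra.mem_centralizer_iff] at h ⊢
  intro g hg
  exact ((Commute.cfc_real (show Commute A g from (h g hg).symm) f).eq).symm

theorem cfc_mem_rightAlg {k : ℕ} {A : Op n d} (h : A ∈ rightAlg n d k)
    (f : ℝ → ℝ) : cfc f A ∈ rightAlg n d k := by
  rw [rightAlg, Subalgebra.mem_centralizer_iff] at h ⊢
  intro g hg
  exact ((Commute.cfc_real (show Commute A g from (h g hg).symm) f).eq).symm

theorem apply_eq_sum_single (A : Op n d) (ψ : Space n d) (σ : Config n d) :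
    A ψ σ = ∑ τ, A (EuclideanSpace.single τ 1) σ * ψ τ := by
  have h : ψ = ∑ τ, ψ τ • EuclideanSpace.single τ (1 : ℂ) := by
    ext ρ
    simp [Pi.single_apply]
  conv_lhs => rw [h]
  simp [mul_comm]

/-- An operator on the left recombines rows linearly. Both the commutation with operators on the
right and the monotonicity of the Schmidt rank follow from this formula. -/
theorem leftAlg_apply_splice {j k : ℕ} (hjk : j ≤ k) {A : Op n d} (hA : A ∈ leftAlg n d j)
    (a : Config n d) (ψ : Space n d) :
    pullback (splice k a) (A ψ) =
      ∑ τ, A (EuclideanSpace.single τ 1) a • pullback (splice k (splice j τ a)) ψ := by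
  rw [mem_leftAlg] at hA
  ext σ
  have h1 : splice j a (splice k a σ) = splice k a σ := by
    ext i; simp only [splice]; split_ifs <;> first | rfl | omega
  have h2 : ∀ τ, splice j τ (splice k a σ) = splice k (splice j τ a) σ := fun τ => by
    ext i; simp only [splice]; split_ifs <;> first | rfl | omega
  rw [pullback_apply, ← h1, ← hA, apply_eq_sum_single]
  simp [h2]

theorem commute_of_left_right {k : ℕ} {A B : Op n d} (hA : A ∈ leftAlg n d k)
    (hB : B ∈ rightAlg n d k) : Commute A B := by
  rw [mem_rightAlg] at hB
  ext ψ σ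
  have h1 : splice k σ σ = σ := by ext i; simp [splice]
  have e1 := congrArg (fun ξ : Space n d => ξ σ) (leftAlg_apply_splice le_rfl hA σ (B ψ))
  have e2 := congrArg (fun ξ : Space n d => B ξ σ) (leftAlg_apply_splice le_rfl hA σ ψ)
  simp only [hB, map_sum, map_smul] at e2
  rw [← e1] at e2
  simp only [pullback_apply, h1] at e2
  exact e2.symm

/-- The span of the rows of `ψ` at the cut `k`. -/
def rowSpace (k : ℕ) (ψ : Space n d) : Submodule ℂ (Space n d) :=
  Submodule.span ℂ (Set.range fun a => pullback (splice k a) ψ)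

/-- The Schmidt rank of `ψ` across the cut `k`. -/
def schmidtRank (k : ℕ) (ψ : Space n d) : ℕ := Module.finrank ℂ (rowSpace k ψ)

theorem pullback_mem_rowSpace (k : ℕ) (ψ : Space n d) (a : Config n d) :
    pullback (splice k a) ψ ∈ rowSpace k ψ := Submodule.subset_span ⟨a, rfl⟩

theorem rowSpace_leftAlg_le {j k : ℕ} (hjk : j ≤ k) {A : Op n d} (hA : A ∈ leftAlg n d j)
    (ψ : Space n d) : rowSpace k (A ψ) ≤ rowSpace k ψ := by
  rw [rowSpace, Submodule.span_le]
  rintro _ ⟨a, rfl⟩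
  simp only [leftAlg_apply_splice hjk hA]
  exact Submodule.sum_mem _ fun τ _ => Submodule.smul_mem _ _ (pullback_mem_rowSpace _ _ _)

theorem schmidtRank_leftAlg_le {j k : ℕ} (hjk : j ≤ k) {A : Op n d} (hA : A ∈ leftAlg n d j)
    (ψ : Space n d) : schmidtRank k (A ψ) ≤ schmidtRank k ψ :=
  Submodule.finrank_mono (rowSpace_leftAlg_le hjk hA ψ)

theorem schmidtRank_rightAlg_le {k : ℕ} {B : Op n d} (hB : B ∈ rightAlg n d k)
    (ψ : Space n d) : schmidtRank k (B ψ) ≤ schmidtRank k ψ := by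
  rw [mem_rightAlg] at hB
  refine (Submodule.finrank_mono (t := (rowSpace k ψ).map (B : Space n d →ₗ[ℂ] Space n d)) ?_).trans
    (Submodule.finrank_map_le _ _)
  rw [rowSpace, Submodule.span_le]
  rintro _ ⟨a, rfl⟩
  exact ⟨_, pullback_mem_rowSpace k ψ a, hB a ψ⟩

theorem schmidtRank_add_le (k : ℕ) (ψ φ : Space n d) :
    schmidtRank k (ψ + φ) ≤ schmidtRank k ψ + schmidtRank k φ := by
  refine (Submodule.finrank_mono (t := rowSpace k ψ ⊔ rowSpace k φ) ?_).trans
    (Submodule.finrank_add_le_finrank_add_finrank _ _)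
  rw [rowSpace, Submodule.span_le]
  rintro _ ⟨a, rfl⟩
  simp only [map_add]
  exact Submodule.add_mem_sup (pullback_mem_rowSpace k ψ a) (pullback_mem_rowSpace k φ a)

theorem schmidtRank_smul_le (k : ℕ) (c : ℂ) (ψ : Space n d) :
    schmidtRank k (c • ψ) ≤ schmidtRank k ψ := by
  refine Submodule.finrank_mono ?_
  rw [rowSpace, Submodule.span_le]
  rintro _ ⟨a, rfl⟩
  simp only [map_smul]
  exact Submodule.smul_mem _ _ (pullback_mem_rowSpace k ψ a)

theorem schmidtRank_zero (k : ℕ) : schmidtRank k (0 : Space n d) = 0 := by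
  have : rowSpace k (0 : Space n d) = ⊥ := by
    rw [rowSpace, Submodule.span_eq_bot]
    rintro _ ⟨a, rfl⟩
    simp
  rw [schmidtRank, this, finrank_bot]

theorem schmidtRank_sum_le {ι : Type*} (s : Finset ι) (k : ℕ) (ψ : ι → Space n d) :
    schmidtRank k (∑ i ∈ s, ψ i) ≤ ∑ i ∈ s, schmidtRank k (ψ i) :=
  Finset.le_sum_of_subadditive _ (schmidtRank_zero k).le (schmidtRank_add_le k) s ψ

/-- Precomposition maps bound the rank of a space generated from another one by `d` of them. -/
theorem finrank_le_of_le_iSup_map (V W : Submodule ℂ (Space n d))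
    (T : Fin d → Space n d →ₗ[ℂ] Space n d) (h : W ≤ ⨆ x, V.map (T x)) :
    Module.finrank ℂ W ≤ d * Module.finrank ℂ V := by
  refine (Submodule.finrank_mono h).trans ?_
  have : ∀ s : Finset (Fin d), Module.finrank ℂ (s.sup fun x => V.map (T x) : Submodule ℂ (Space n d))
      ≤ s.card * Module.finrank ℂ V := by
    intro s
    induction s using Finset.induction_on with
    | empty => simp
    | insert x s hx ih =>
      rw [Finset.sup_insert, Finset.card_insert_of_notMem hx]
      refine (Submodule.finrank_add_le_finrank_add_finrank _ _).trans ?_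
      have := Submodule.finrank_map_le (T x) V
      linarith
  have h2 := this Finset.univ
  rwa [Finset.sup_univ_eq_iSup, Finset.card_univ, Fintype.card_fin] at h2

/-- A row at the cut `k + 1` is a row at `k` with one more spin fixed, to one of `d` values. -/
theorem schmidtRank_succ_le (hd : 0 < d) (k : ℕ) (ψ : Space n d) :
    schmidtRank (k + 1) ψ ≤ d * schmidtRank k ψ := by
  by_cases hk : k < n
  · refine finrank_le_of_le_iSup_map _ _
      (fun x => (pullback fun σ => Function.update σ ⟨k, hk⟩ x : Op n d)) ?_
    rw [rowSpace, Submodule.span_le]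
    rintro _ ⟨a, rfl⟩
    refine Submodule.mem_iSup_of_mem (a ⟨k, hk⟩) ⟨_, pullback_mem_rowSpace k ψ a, ?_⟩
    ext σ
    simp only [ContinuousLinearMap.coe_coe, pullback_apply]
    refine congrArg (fun τ => ψ τ) (funext fun i => ?_)
    simp only [splice, Function.update_apply, Fin.ext_iff]
    by_cases h1 : i.1 < k
    · simp [h1, h1.trans (Nat.lt_succ_self k)]
    · by_cases h2 : i.1 = k
      · have : i = ⟨k, hk⟩ := Fin.ext h2
        subst this; simp
      · simp [h1, h2, show ¬ i.1 < k + 1 by omega]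
  · have : rowSpace (k + 1) ψ = rowSpace k ψ := by
      rw [rowSpace, rowSpace]
      congr 2
      ext a σ
      simp only [pullback_apply]
      refine congrArg (fun τ => ψ τ) (funext fun i => ?_)
      simp [splice, show i.1 < k by omega, show i.1 < k + 1 by omega]
    rw [schmidtRank, this]
    exact Nat.le_mul_of_pos_left _ hd

/-- A row at the cut `k` is glued from `d` rows at `k + 1`, one for each value of the spin between
the cuts. -/
theorem schmidtRank_le_succ (hd : 0 < d) (k : ℕ) (ψ : Space n d) :
    schmidtRank k ψ ≤ d * schmidtRank (k + 1) ψ := by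
  by_cases hk : k < n
  · refine finrank_le_of_le_iSup_map _ _
      (fun x => { toFun := fun ξ => WithLp.toLp 2 fun σ => if σ ⟨k, hk⟩ = x then ξ σ else 0
                  map_add' := fun ξ ζ => by ext σ; simp only [PiLp.add_apply]; split_ifs <;> simp
                  map_smul' := fun c ξ => by ext σ; simp }) ?_
    rw [rowSpace, Submodule.span_le]
    rintro _ ⟨a, rfl⟩
    have : pullback (splice k a) ψ = ∑ x : Fin d, WithLp.toLp 2 (fun σ : Config n d =>
        if σ ⟨k, hk⟩ = x then
          pullback (splice (k + 1) (Function.update a ⟨k, hk⟩ x)) ψ σ else 0) := by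
      ext σ
      simp only [pullback_apply, WithLp.ofLp_sum, Finset.sum_apply, Finset.sum_ite_eq,
        Finset.mem_univ, if_true]
      refine congrArg (fun τ => ψ τ) (funext fun i => ?_)
      simp only [splice, Function.update_apply, Fin.ext_iff]
      by_cases h1 : i.1 < k
      · simp [h1, h1.trans (Nat.lt_succ_self k), h1.ne]
      · by_cases h2 : i.1 = k
        · have : i = ⟨k, hk⟩ := Fin.ext h2
          subst this; simp
        · simp [h1, show ¬ i.1 < k + 1 by omega]
    simp only [this]
    refine Submodule.sum_mem _ fun x _ => Submodule.mem_iSup_of_mem x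
      ⟨_, pullback_mem_rowSpace (k + 1) ψ (Function.update a ⟨k, hk⟩ x), rfl⟩
  · have : rowSpace k ψ = rowSpace (k + 1) ψ := by
      rw [rowSpace, rowSpace]
      congr 2
      ext a σ
      simp only [pullback_apply]
      refine congrArg (fun τ => ψ τ) (funext fun i => ?_)
      simp [splice, show i.1 < k by omega, show i.1 < k + 1 by omega]
    rw [schmidtRank, this]
    exact Nat.le_mul_of_pos_left _ hd

theorem schmidtRank_add_right_le (hd : 0 < d) (k m : ℕ) (ψ : Space n d) :
    schmidtRank (k + m) ψ ≤ d ^ m * schmidtRank k ψ ∧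
    schmidtRank k ψ ≤ d ^ m * schmidtRank (k + m) ψ := by
  induction m with
  | zero => simp
  | succ m ih =>
    constructor
    · calc _ ≤ d * schmidtRank (k + m) ψ := schmidtRank_succ_le hd _ _
        _ ≤ d * (d ^ m * schmidtRank k ψ) := Nat.mul_le_mul_left _ ih.1
        _ = _ := by ring
    · calc _ ≤ d ^ m * schmidtRank (k + m) ψ := ih.2
        _ ≤ d ^ m * (d * schmidtRank (k + m + 1) ψ) :=
          Nat.mul_le_mul_left _ (schmidtRank_le_succ hd _ _)
        _ = _ := by rw [pow_succ, ← add_assoc]; ring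

theorem schmidtRank_le_of_dist (hd : 0 < d) {k k' m : ℕ} (h : k ≤ k' + m) (h' : k' ≤ k + m)
    (ψ : Space n d) : schmidtRank k ψ ≤ d ^ m * schmidtRank k' ψ := by
  rcases le_total k k' with hk | hk
  · obtain ⟨r, rfl⟩ := Nat.exists_eq_add_of_le hk
    exact (schmidtRank_add_right_le hd k r ψ).2.trans
      (Nat.mul_le_mul_right _ (Nat.pow_le_pow_right hd (by omega)))
  · obtain ⟨r, rfl⟩ := Nat.exists_eq_add_of_le hk
    exact (schmidtRank_add_right_le hd k' r ψ).1.trans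
      (Nat.mul_le_mul_right _ (Nat.pow_le_pow_right hd (by omega)))

/-- `K` multiplies Schmidt ranks across the cut `k` by at most `D`. -/
def RankBound (k D : ℕ) (K : Op n d) : Prop := ∀ ψ, schmidtRank k (K ψ) ≤ D * schmidtRank k ψ

namespace RankBound

theorem mono {k D D' : ℕ} {K : Op n d} (h : RankBound k D K) (hD : D ≤ D') : RankBound k D' K :=
  fun ψ => (h ψ).trans (Nat.mul_le_mul_right _ hD)

theorem of_left {k : ℕ} {A : Op n d} (h : A ∈ leftAlg n d k) : RankBound k 1 A :=
  fun ψ => by simpa using schmidtRank_leftAlg_le le_rfl h ψ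

theorem of_right {k : ℕ} {A : Op n d} (h : A ∈ rightAlg n d k) : RankBound k 1 A :=
  fun ψ => by simpa using schmidtRank_rightAlg_le h ψ

theorem mul {k D D' : ℕ} {K K' : Op n d} (h : RankBound k D K) (h' : RankBound k D' K') :
    RankBound k (D * D') (K * K') := fun ψ => by
  rw [mul_assoc]
  exact (h (K' ψ)).trans (Nat.mul_le_mul_left _ (h' ψ))

theorem smul {k D : ℕ} {K : Op n d} (h : RankBound k D K) (c : ℂ) : RankBound k D (c • K) :=
  fun ψ => (schmidtRank_smul_le k c (K ψ)).trans (h ψ)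

theorem sum {ι : Type*} {s : Finset ι} {k : ℕ} {D : ι → ℕ} {K : ι → Op n d}
    (h : ∀ i ∈ s, RankBound k (D i) (K i)) : RankBound k (∑ i ∈ s, D i) (∑ i ∈ s, K i) := fun ψ => by
  rw [sum_apply, Finset.sum_mul]
  exact (schmidtRank_sum_le s k _).trans (Finset.sum_le_sum fun i hi => h i hi ψ)

theorem sum_const {ι : Type*} {s : Finset ι} {k D : ℕ} {K : ι → Op n d}
    (h : ∀ i ∈ s, RankBound k D (K i)) : RankBound k (s.card * D) (∑ i ∈ s, K i) := by
  have := RankBound.sum h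
  rwa [Finset.sum_const, smul_eq_mul] at this

/-- The factor `d ^ m` is paid twice, for moving the cut on the input and on the output. -/
theorem move (hd : 0 < d) {k k' m D : ℕ} (h : k ≤ k' + m) (h' : k' ≤ k + m) {K : Op n d}
    (hK : RankBound k' D K) : RankBound k (d ^ (2 * m) * D) K := fun ψ => by
  calc schmidtRank k (K ψ) ≤ d ^ m * schmidtRank k' (K ψ) := schmidtRank_le_of_dist hd h h' _
    _ ≤ d ^ m * (D * (d ^ m * schmidtRank k ψ)) := by
      refine Nat.mul_le_mul_left _ ((hK ψ).trans (Nat.mul_le_mul_left _ ?_))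
      exact schmidtRank_le_of_dist hd h' h _
    _ = _ := by ring

end RankBound

end SpinChain
end

noncomputable section

/-! ### Schmidt rank of polynomials of a Hamiltonian. -/

section WordExpansion
variable {R : Type*} [Ring R]

/-- The part of `(z + x) ^ m` of degree `j` in `x`. -/
def segCoeff (z x : R) : ℕ → ℕ → R
  | 0, m => z ^ m
  | j + 1, m => ∑ q ∈ Finset.range m, z ^ q * x * segCoeff z x j (m - 1 - q)

theorem segCoeff_succ_zero (z x : R) (j : ℕ) : segCoeff z x (j + 1) 0 = 0 := by
  simp [segCoeff]

theorem segCoeff_succ_succ (z x : R) (j m : ℕ) :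
    segCoeff z x (j + 1) (m + 1) = z * segCoeff z x (j + 1) m + x * segCoeff z x j m := by
  rw [segCoeff, Finset.sum_range_succ', segCoeff, Finset.mul_sum]
  congr 1
  · refine Finset.sum_congr rfl fun q _ => ?_
    rw [show m + 1 - 1 - (q + 1) = m - 1 - q by omega, pow_succ']
    simp only [mul_assoc]
  · simp

theorem segCoeff_eq_zero (z x : R) {j m : ℕ} (h : m < j) : segCoeff z x j m = 0 := by
  induction m generalizing j with
  | zero => obtain ⟨j, rfl⟩ := Nat.exists_eq_succ_of_ne_zero h.ne'; exact segCoeff_succ_zero z x j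
  | succ m ih =>
    obtain ⟨j, rfl⟩ := Nat.exists_eq_succ_of_ne_zero (by omega : j ≠ 0)
    rw [segCoeff_succ_succ, ih (by omega), ih (by omega)]; simp

variable [Algebra ℂ R]

theorem add_smul_pow_eq_sum_segCoeff (z x : R) (t : ℂ) (m : ℕ) :
    (z + t • x) ^ m = ∑ j ∈ Finset.range (m + 1), t ^ j • segCoeff z x j m := by
  induction m with
  | zero => simp [segCoeff]
  | succ m ih =>
    rw [pow_succ', ih, add_mul, Finset.sum_range_succ' _ (m + 1)]
    simp only [segCoeff_succ_succ, smul_add, Finset.sum_add_distrib]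
    have h1 : ∑ j ∈ Finset.range (m + 1), t ^ (j + 1) • (z * segCoeff z x (j + 1) m) +
        t ^ 0 • segCoeff z x 0 (m + 1) =
        z * ∑ j ∈ Finset.range (m + 1), t ^ j • segCoeff z x j m := by
      have e : t ^ 0 • segCoeff z x 0 (m + 1) = t ^ 0 • (z * segCoeff z x 0 m) := by
        simp [segCoeff, pow_succ']
      rw [e, ← Finset.sum_range_succ' (fun j => t ^ j • (z * segCoeff z x j m)),
        Finset.sum_range_succ, segCoeff_eq_zero z x (Nat.lt_succ_self m), Finset.mul_sum]
      simp
    rw [← h1, smul_mul_assoc, Finset.mul_sum, Finset.smul_sum]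
    simp only [mul_smul_comm, smul_smul, ← pow_succ']
    abel

/-- The Vandermonde matrix of the nodes `0, …, l` is invertible. When `g` is an indicator, the
combination of rescaled operators keeps exactly the words in which a letter occurs a prescribed
number of times. -/
theorem exists_interpolation (l : ℕ) (g : ℕ → ℂ) :
    ∃ c : Fin (l + 1) → ℂ, ∀ q ≤ l, ∑ y, c y * (y.1 : ℂ) ^ q = g q := by
  let V : Matrix (Fin (l + 1)) (Fin (l + 1)) ℂ := Matrix.vandermonde fun y => (y.1 : ℂ)
  have hV : IsUnit V.det := by
    rw [isUnit_iff_ne_zero, Matrix.det_vandermonde_ne_zero_iff]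
    intro a b h
    exact Fin.ext (Nat.cast_injective (R := ℂ) h)
  refine ⟨(fun q : Fin (l + 1) => g q) ᵥ* V⁻¹, fun q hq => ?_⟩
  have h1 : ((fun q : Fin (l + 1) => g q) ᵥ* V⁻¹) ᵥ* V = fun q : Fin (l + 1) => g q := by
    rw [Matrix.vecMul_vecMul, Matrix.nonsing_inv_mul _ hV, Matrix.vecMul_one]
  have := congrFun h1 ⟨q, by omega⟩
  simpa [Matrix.vecMul, dotProduct, V, Matrix.vandermonde_apply] using this

theorem sum_smul_pow_eq_sum_words {ι : Type*} [Fintype ι] (X : ι → R) (y : ι → ℂ) (m : ℕ) :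
    (∑ i, y i • X i) ^ m =
      ∑ w : Fin m → ι, (∏ k, y (w k)) • (List.ofFn fun k => X (w k)).prod := by
  induction m with
  | zero => simp
  | succ m ih =>
    rw [pow_succ', ih, Finset.sum_mul_sum, ← (Fin.consEquiv fun _ => ι).sum_comp,
      Fintype.sum_prod_type]
    refine Finset.sum_congr rfl fun i _ => Finset.sum_congr rfl fun w _ => ?_
    simp only [Fin.consEquiv_apply, Fin.prod_univ_succ, Fin.cons_zero, Fin.cons_succ,
      List.ofFn_succ, List.prod_cons, smul_mul_smul_comm]

/-- The number of occurrences of a letter in a word. -/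
def letterCount {s m : ℕ} (w : Fin m → Option (Fin s)) (i : Fin s) : ℕ :=
  (Finset.univ.filter fun k => w k = some i).card

theorem sum_letterCount_le {s m : ℕ} (w : Fin m → Option (Fin s)) :
    ∑ i, letterCount w i ≤ m := by
  unfold letterCount
  rw [← Finset.card_biUnion]
  · exact (Finset.card_le_univ _).trans (by simp)
  · intro i _ j _ hij
    rw [Function.onFun, Finset.disjoint_left]
    intro k hk hk'
    simp only [Finset.mem_filter, Finset.mem_univ, true_and] at hk hk'
    exact hij (Option.some_injective _ (hk.symm.trans hk'))

theorem letterCount_le {s m : ℕ} (w : Fin m → Option (Fin s)) (i : Fin s) :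
    letterCount w i ≤ m := (Finset.card_le_univ _).trans (by simp)

theorem prod_word_eq_prod_pow {s m : ℕ} (w : Fin m → Option (Fin s)) (z : Fin s → ℂ) :
    ∏ k, (w k).elim 1 z = ∏ i, z i ^ letterCount w i := by
  have : ∀ k, (w k).elim 1 z = ∏ i, if w k = some i then z i else 1 := by
    intro k
    cases h : w k with
    | none => simp
    | some j => simp [Finset.prod_ite_eq]
  simp only [this]
  rw [Finset.prod_comm]
  refine Finset.prod_congr rfl fun i _ => ?_
  rw [Finset.prod_ite, Finset.prod_const_one, mul_one, Finset.prod_const]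
  rfl

theorem add_sum_smul_pow_eq_sum_words {s : ℕ} (B : R) (Y : Fin s → R) (z : Fin s → ℂ) (m : ℕ) :
    (B + ∑ i, z i • Y i) ^ m = ∑ w : Fin m → Option (Fin s),
      (∏ i, z i ^ letterCount w i) • (List.ofFn fun k => (w k).elim B Y).prod := by
  have := sum_smul_pow_eq_sum_words (fun o : Option (Fin s) => o.elim B Y)
    (fun o : Option (Fin s) => o.elim 1 z) m
  rw [Fintype.sum_option] at this
  simpa only [Option.elim_none, Option.elim_some, one_smul, prod_word_eq_prod_pow] using this

/-- Splitting the words of a power according to the first letter that occurs at most `r` times. -/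
theorem exists_pow_eq_sum_segCoeff {s l r m : ℕ} (hl : l < s * (r + 1)) (hm : m ≤ l) (B : R)
    (Y : Fin s → R) :
    ∃ c : Fin s → (Fin s → Fin (l + 1)) → ℂ, (B + ∑ i, Y i) ^ m =
      ∑ i, ∑ y : Fin s → Fin (l + 1), c i y • ∑ j ∈ Finset.range (r + 1),
        segCoeff (B + ∑ i' ∈ Finset.univ.erase i, ((y i').1 : ℂ) • Y i') (Y i) j m := by
  -- Filters on the number of occurrences of a letter: `c₀` keeps at most `r`, `c₁` keeps more than
  -- `r`, `c₂` keeps everything. The term `i` uses `c₁` for the letters before `i`, `c₀` for `i`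
  -- (through `segCoeff`) and `c₂` for the others.
  obtain ⟨c₀, hc₀⟩ := exists_interpolation l fun q => if q ≤ r then 1 else 0
  obtain ⟨c₁, hc₁⟩ := exists_interpolation l fun q => if q ≤ r then 0 else 1
  obtain ⟨c₂, hc₂⟩ := exists_interpolation l fun _ => 1
  let e : Fin s → Fin s → Fin (l + 1) → ℂ := fun i i' => if i' < i then c₁ else c₂
  refine ⟨fun i y => ∏ i', e i i' (y i'), ?_⟩
  have seg : ∀ z x : R, ∑ j ∈ Finset.range (r + 1), segCoeff z x j m =
      ∑ t, c₀ t • (z + (t.1 : ℂ) • x) ^ m := by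
    intro z x
    simp only [add_smul_pow_eq_sum_segCoeff, Finset.smul_sum, smul_smul]
    rw [Finset.sum_comm]
    simp only [← Finset.sum_smul]
    have h1 : ∀ j ∈ Finset.range (m + 1), (∑ t, c₀ t * (t.1 : ℂ) ^ j) • segCoeff z x j m =
        if j ∈ Finset.range (r + 1) then segCoeff z x j m else 0 := by
      intro j hj
      rw [Finset.mem_range] at hj
      rw [hc₀ j (by omega)]
      by_cases h : j ≤ r
      · simp [h]
      · simp [h]
    rw [Finset.sum_congr rfl h1, Finset.sum_ite_mem]
    refine (Finset.sum_subset Finset.inter_subset_right fun j hj hj' => ?_).symm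
    refine segCoeff_eq_zero z x ?_
    simp only [Finset.mem_inter, Finset.mem_range] at hj hj'
    omega
  have upd : ∀ (i : Fin s) (y : Fin s → Fin (l + 1)) (t : Fin (l + 1)),
      B + ∑ i' ∈ Finset.univ.erase i, ((y i').1 : ℂ) • Y i' + (t.1 : ℂ) • Y i =
      B + ∑ i', (if i' = i then (t.1 : ℂ) else (y i').1) • Y i' := by
    intro i y t
    rw [add_assoc, ← Finset.sum_erase_add _ _ (Finset.mem_univ i)]
    simp only [if_true]
    congr 2
    refine Finset.sum_congr rfl fun i' hi' => ?_
    rw [if_neg (Finset.ne_of_mem_erase hi')]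
  -- Every word has total coefficient `1`: only the term of its first rare letter survives the
  -- filters, and a rare letter exists by the pigeonhole principle, as `l < s * (r + 1)`.
  have one : ∀ w : Fin m → Option (Fin s), ∑ i, (∑ t, c₀ t * (t.1 : ℂ) ^ letterCount w i) *
      ∏ i', (∑ y, e i i' y * (if i' = i then 1 else (y.1 : ℂ) ^ letterCount w i')) = 1 := by
    intro w
    have hlc : ∀ i, letterCount w i ≤ l := fun i => (letterCount_le w i).trans hm
    have hex : ∃ i, letterCount w i ≤ r := by
      by_contra! hcon
      have h1 : ∑ _i : Fin s, (r + 1) ≤ ∑ i, letterCount w i :=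
        Finset.sum_le_sum fun i _ => hcon i
      have h2 := sum_letterCount_le w
      simp at h1
      omega
    have hval : ∀ i i', ∑ y, e i i' y * (if i' = i then 1 else (y.1 : ℂ) ^ letterCount w i') =
        if i' < i then (if letterCount w i' ≤ r then 0 else 1) else 1 := by
      intro i i'
      by_cases h1 : i' < i
      · simp only [e, h1, if_true, h1.ne, if_false]
        exact hc₁ _ (hlc i')
      · simp only [e, h1, if_false]
        by_cases h2 : i' = i
        · simpa [h2] using hc₂ 0 (Nat.zero_le _)
        · simpa [h2] using hc₂ _ (hlc i')
    simp only [hval, hc₀ _ (hlc _)]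
    classical
    let i₀ := (Finset.univ.filter fun i => letterCount w i ≤ r).min'
      (by obtain ⟨i, hi⟩ := hex; exact ⟨i, by simpa using hi⟩)
    have hi₀ : letterCount w i₀ ≤ r := by
      have := Finset.min'_mem (Finset.univ.filter fun i => letterCount w i ≤ r)
        (by obtain ⟨i, hi⟩ := hex; exact ⟨i, by simpa using hi⟩)
      simpa using this
    have hmin : ∀ i, letterCount w i ≤ r → i₀ ≤ i := fun i hi =>
      Finset.min'_le _ _ (by simpa using hi)
    rw [Finset.sum_eq_single i₀]
    · rw [if_pos hi₀, one_mul]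
      refine Finset.prod_eq_one fun i' _ => ?_
      split_ifs with h1 h2
      · exact absurd (hmin i' h2) (not_le.2 h1)
      · rfl
      · rfl
    · intro i _ hi
      by_cases h : letterCount w i ≤ r
      · rw [Finset.prod_eq_zero (Finset.mem_univ i₀), mul_zero]
        rw [if_pos (lt_of_le_of_ne (hmin i h) (Ne.symm hi)), if_pos hi₀]
      · rw [if_neg h, zero_mul]
    · simp
  have lhs := add_sum_smul_pow_eq_sum_words B Y (fun _ => 1) m
  simp only [one_smul, one_pow, Finset.prod_const_one] at lhs
  rw [lhs]
  simp only [seg, upd, add_sum_smul_pow_eq_sum_words, Finset.smul_sum, smul_smul]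
  have swap : ∀ (F : Fin s → (Fin s → Fin (l + 1)) → Fin (l + 1) → (Fin m → Option (Fin s)) → R),
      ∑ i, ∑ y, ∑ t, ∑ w, F i y t w = ∑ w, ∑ i, ∑ y, ∑ t, F i y t w := by
    intro F
    calc ∑ i, ∑ y, ∑ t, ∑ w, F i y t w = ∑ i, ∑ y, ∑ w, ∑ t, F i y t w :=
          Finset.sum_congr rfl fun i _ => Finset.sum_congr rfl fun y _ => Finset.sum_comm
      _ = ∑ i, ∑ w, ∑ y, ∑ t, F i y t w := Finset.sum_congr rfl fun i _ => Finset.sum_comm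
      _ = _ := Finset.sum_comm
  rw [swap]
  refine Finset.sum_congr rfl fun w _ => ?_
  simp only [← Finset.sum_smul]
  conv_lhs => rw [← one_smul ℂ (List.ofFn fun k => (w k).elim B Y).prod, ← one w]
  congr 1
  refine Finset.sum_congr rfl fun i _ => ?_
  rw [Finset.prod_univ_sum, Finset.mul_sum, Fintype.piFinset_univ]
  refine Finset.sum_congr rfl fun y _ => ?_
  rw [Finset.sum_mul]
  refine Finset.sum_congr rfl fun t _ => ?_
  rw [Finset.prod_mul_distrib]
  have : ∏ i', (if i' = i then (t.1 : ℂ) else ((y i').1 : ℂ)) ^ letterCount w i' =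
      (t.1 : ℂ) ^ letterCount w i * ∏ i', (if i' = i then 1 else ((y i').1 : ℂ) ^ letterCount w i') := by
    rw [← Finset.mul_prod_erase Finset.univ _ (Finset.mem_univ i), ← Finset.mul_prod_erase
      Finset.univ (fun i' => if i' = i then 1 else ((y i').1 : ℂ) ^ letterCount w i')
      (Finset.mem_univ i)]
    simp only [if_true, one_mul]
    congr 1
    refine Finset.prod_congr rfl fun i' hi' => ?_
    rw [if_neg (Finset.ne_of_mem_erase hi'), if_neg (Finset.ne_of_mem_erase hi')]
  rw [this]
  ring

end WordExpansion

namespace SpinChain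
variable {n d : ℕ}

/-- The two parts commute, so the binomial formula has `m + 1` terms, each a left operator times a
right one. -/
theorem RankBound.add_pow {k : ℕ} {A B : Op n d} (hA : A ∈ leftAlg n d k) (hB : B ∈ rightAlg n d k)
    (m : ℕ) : RankBound k (m + 1) ((A + B) ^ m) := by
  rw [(commute_of_left_right hA hB).add_pow]
  have := RankBound.sum_const (s := Finset.range (m + 1)) (k := k) (D := 1)
    (K := fun i => A ^ i * B ^ (m - i) * (m.choose i : Op n d)) fun i _ => by
      have h1 := (RankBound.of_left (Subalgebra.pow_mem _ hA i)).mul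
        ((RankBound.of_right (Subalgebra.pow_mem _ hB (m - i))).mul
        (RankBound.of_right (Subalgebra.natCast_mem (rightAlg n d k) (m.choose i))))
      rw [← mul_assoc] at h1
      exact h1
  simpa using this

/-- Each insertion of `X` costs a choice of position, a power of the decoupled part `A + B` and the
factor `e`. -/
theorem RankBound.segCoeff {k e : ℕ} {A B X : Op n d} (hA : A ∈ leftAlg n d k)
    (hB : B ∈ rightAlg n d k) (hX : RankBound k e X) {l : ℕ} (j m : ℕ) (hm : m ≤ l) :
    RankBound k ((l + 1) * ((l + 1) ^ 2 * e) ^ j) (segCoeff (A + B) X j m) := by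
  induction j generalizing m with
  | zero => exact (RankBound.add_pow hA hB m).mono (by simp; omega)
  | succ j ih =>
    have := RankBound.sum_const (s := Finset.range m)
      (K := fun q => (A + B) ^ q * X * _root_.segCoeff (A + B) X j (m - 1 - q)) fun q hq =>
      ((((RankBound.add_pow hA hB q).mono (D' := l + 1)
        (by have := Finset.mem_range.1 hq; omega)).mul hX).mul (ih (m - 1 - q) (by omega)))
    refine this.mono ?_
    rw [Finset.card_range]
    calc m * ((l + 1) * e * ((l + 1) * ((l + 1) ^ 2 * e) ^ j))
        ≤ (l + 1) * ((l + 1) * e * ((l + 1) * ((l + 1) ^ 2 * e) ^ j)) :=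
          Nat.mul_le_mul_right _ (by omega)
      _ = _ := by ring

/-- A real polynomial of an operator, given by its first coefficients. -/
def polyOp (p : Polynomial ℝ) (l : ℕ) (T : Op n d) : Op n d :=
  ∑ m ∈ Finset.range (l + 1), (p.coeff m : ℂ) • T ^ m

/-- Polynomials of a Hamiltonian with many weakly entangling bonds have low Schmidt rank. -/
theorem rankBound_polyOp (hd : 0 < d) {s l r k e : ℕ} (hl : l < s * (r + 1)) (p : Polynomial ℝ)
    {L R : Op n d} {Y : Fin s → Op n d} {κ : Fin s → ℕ}
    (hκ : ∀ i, k ≤ κ i + s) (hκ' : ∀ i, κ i ≤ k + s)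
    (hL : ∀ i, L ∈ leftAlg n d (κ i)) (hR : ∀ i, R ∈ rightAlg n d (κ i))
    (hYL : ∀ i i', i' < i → Y i' ∈ leftAlg n d (κ i))
    (hYR : ∀ i i', i < i' → Y i' ∈ rightAlg n d (κ i))
    (hY : ∀ i, RankBound (κ i) e (Y i)) :
    RankBound k ((l + 1) * (s * ((l + 1) ^ s * (d ^ (2 * s) * ((r + 1) *
      ((l + 1) * ((l + 1) ^ 2 * (e + 1)) ^ r)))))) (polyOp p l (L + ∑ i, Y i + R)) := by
  have hpow : ∀ m ≤ l, RankBound k (s * ((l + 1) ^ s * (d ^ (2 * s) * ((r + 1) *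
      ((l + 1) * ((l + 1) ^ 2 * (e + 1)) ^ r))))) ((L + ∑ i, Y i + R) ^ m) := by
    intro m hm
    obtain ⟨c, hc⟩ := exists_pow_eq_sum_segCoeff hl hm (L + R) Y
    rw [show L + ∑ i, Y i + R = L + R + ∑ i, Y i by abel, hc]
    have key : ∀ i (y : Fin s → Fin (l + 1)), RankBound k (d ^ (2 * s) * ((r + 1) *
        ((l + 1) * ((l + 1) ^ 2 * (e + 1)) ^ r))) (c i y • ∑ j ∈ Finset.range (r + 1),
        _root_.segCoeff (L + R + ∑ i' ∈ Finset.univ.erase i, ((y i').1 : ℂ) • Y i') (Y i) j m) := by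
      intro i y
      refine (RankBound.move hd (hκ i) (hκ' i) ?_).smul _
      -- Without the bond `i`, the Hamiltonian decouples at the cut `κ i`, whatever the scaling of
      -- the other bonds.
      have hsplit : L + R + ∑ i' ∈ Finset.univ.erase i, ((y i').1 : ℂ) • Y i' =
          (L + ∑ i' ∈ Finset.univ.filter (· < i), ((y i').1 : ℂ) • Y i') +
          (R + ∑ i' ∈ Finset.univ.filter (i < ·), ((y i').1 : ℂ) • Y i') := by
        have : (Finset.univ.erase i : Finset (Fin s)) =
            Finset.univ.filter (· < i) ∪ Finset.univ.filter (i < ·) := by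
          ext i'
          simp [lt_or_lt_iff_ne]
        rw [this, Finset.sum_union]
        · abel
        · rw [Finset.disjoint_left]
          intro i' h h'
          simp at h h'
          exact lt_asymm h h'
      rw [hsplit]
      have := RankBound.sum_const (s := Finset.range (r + 1)) (k := κ i)
        (D := (l + 1) * ((l + 1) ^ 2 * (e + 1)) ^ r) (K := fun j => _root_.segCoeff
          ((L + ∑ i' ∈ Finset.univ.filter (· < i), ((y i').1 : ℂ) • Y i') +
          (R + ∑ i' ∈ Finset.univ.filter (i < ·), ((y i').1 : ℂ) • Y i')) (Y i) j m) fun j hj => by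
        refine (RankBound.segCoeff (Subalgebra.add_mem _ (hL i) (Subalgebra.sum_mem _ fun i' hi' =>
          Subalgebra.smul_mem _ (hYL i i' (by simpa using hi')) _))
          (Subalgebra.add_mem _ (hR i) (Subalgebra.sum_mem _ fun i' hi' =>
          Subalgebra.smul_mem _ (hYR i i' (by simpa using hi')) _))
          ((hY i).mono (Nat.le_succ e)) j m hm).mono ?_
        refine Nat.mul_le_mul_left _ (Nat.pow_le_pow_right (by positivity) ?_)
        have := Finset.mem_range.1 hj
        omega
      simpa using this
    have h2 := RankBound.sum_const (s := (Finset.univ : Finset (Fin s))) fun i _ =>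
      RankBound.sum_const (s := (Finset.univ : Finset (Fin s → Fin (l + 1)))) fun y _ => key i y
    simpa using h2
  have := RankBound.sum_const (s := Finset.range (l + 1)) (K := fun m => (p.coeff m : ℂ) •
    (L + ∑ i, Y i + R) ^ m) fun m hm =>
    (hpow m (by have := Finset.mem_range.1 hm; omega)).smul (p.coeff m : ℂ)
  simpa [polyOp] using this

theorem polyOp_apply_eigenvector {p : Polynomial ℝ} {l : ℕ} (hp : p.natDegree ≤ l) {T : Op n d}
    {v : Space n d} {μ : ℝ} (hv : T v = (μ : ℂ) • v) :
    polyOp p l T v = ((p.eval μ : ℝ) : ℂ) • v := by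
  have hpow : ∀ m : ℕ, (T ^ m) v = ((μ ^ m : ℝ) : ℂ) • v := by
    intro m
    induction m with
    | zero => simp
    | succ m ih =>
      rw [pow_succ', ContinuousLinearMap.mul_apply_eq, ih, map_smul, hv, smul_smul]
      push_cast; ring_nf
  rw [Polynomial.eval_eq_sum_range' (Nat.lt_succ_of_le hp), polyOp]
  simp only [sum_apply, smul_apply, hpow, smul_smul, Complex.ofReal_sum, Complex.ofReal_mul,
    Finset.sum_smul]

end SpinChain
end

/-! ### Chebyshev polynomials as spectral filters. -/

noncomputable section

theorem Real.cosh_le_one_add_sq {x : ℝ} (hx : x ^ 2 ≤ 1) : Real.cosh x ≤ 1 + x ^ 2 := by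
  refine (Real.cosh_le_exp_half_sq x).trans ?_
  have h1 : 1 - x ^ 2 / 2 ≤ Real.exp (-(x ^ 2 / 2)) := by
    have := Real.add_one_le_exp (-(x ^ 2 / 2)); linarith
  have h2 : Real.exp (x ^ 2 / 2) * Real.exp (-(x ^ 2 / 2)) = 1 := by
    rw [← Real.exp_add]; simp
  nlinarith [Real.exp_pos (x ^ 2 / 2), sq_nonneg x, mul_nonneg (sq_nonneg x) (sub_nonneg.2 hx)]

theorem Polynomial.Chebyshev.T_real_le_of_one_le {x y : ℝ} (l : ℕ) (hx : 1 ≤ x) (hxy : x ≤ y) :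
    (Polynomial.Chebyshev.T ℝ l).eval x ≤ (Polynomial.Chebyshev.T ℝ l).eval y := by
  rw [← Real.cosh_arcosh hx, ← Real.cosh_arcosh (hx.trans hxy), Polynomial.Chebyshev.T_real_cosh,
    Polynomial.Chebyshev.T_real_cosh, Real.cosh_le_cosh, abs_mul, abs_mul]
  refine mul_le_mul_of_nonneg_left ?_ (abs_nonneg _)
  rw [← Real.cosh_le_cosh, Real.cosh_arcosh hx, Real.cosh_arcosh (hx.trans hxy)]
  exact hxy

/-- Since `cosh √γ ≤ 1 + γ`, monotonicity beyond `1` gives at least `cosh (l √γ)`. The square root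
is the quadratic gain over a power of the Hamiltonian. -/
theorem Polynomial.Chebyshev.exp_le_T_real {γ : ℝ} (l : ℕ) (h0 : 0 ≤ γ) (h1 : γ ≤ 1) :
    Real.exp (l * √γ) / 2 ≤ (Polynomial.Chebyshev.T ℝ l).eval (1 + γ) := by
  have hs : √γ ^ 2 = γ := Real.sq_sqrt h0
  have h2 : Real.cosh √γ ≤ 1 + γ := by
    have := Real.cosh_le_one_add_sq (x := √γ) (by rw [hs]; exact h1)
    rwa [hs] at this
  refine le_trans ?_ (T_real_le_of_one_le l (Real.one_le_cosh _) h2)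
  rw [T_real_cosh, Real.cosh_eq, Int.cast_natCast]
  linarith [Real.exp_pos (-(l * √γ))]

/-- The shifted Chebyshev polynomial separating a low level from the interval above a gap. -/
theorem exists_separating_polynomial (l : ℕ) {e η U : ℝ} (hη : 0 < η) (hU : 2 * η ≤ U) :
    ∃ p : Polynomial ℝ, p.natDegree ≤ l ∧ (∀ x ≤ e, 1 ≤ p.eval x) ∧
      ∀ x, e + η ≤ x → x ≤ e + U → |p.eval x| ≤ 2 * Real.exp (-(l * √(2 * η / U))) := by
  have hUpos : 0 < U := by linarith
  set γ := 2 * η / U with hγ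
  have hγ0 : 0 ≤ γ := by positivity
  have hγ1 : γ ≤ 1 := by rw [hγ, div_le_one hUpos]; exact hU
  set T := Polynomial.Chebyshev.T ℝ l with hT
  have hT0 := Polynomial.Chebyshev.exp_le_T_real l hγ0 hγ1
  have hpos : 0 < T.eval (1 + γ) := lt_of_lt_of_le (by positivity) hT0
  -- The affine map takes `e` to `1 + γ`, `e + η` to `1` and `e + U` to `γ - 1`, so the upper part
  -- of the spectrum lands in `[-1, 1]`, where the Chebyshev polynomial is bounded by `1`.
  set q : Polynomial ℝ := Polynomial.C (-2 / U) * Polynomial.X +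
    Polynomial.C ((2 * (e + η) + U) / U) with hq
  have hqe : ∀ x, q.eval x = 1 + γ + 2 * (e - x) / U := by
    intro x; simp [hq, hγ]; field_simp; ring
  have hpe : ∀ x, (Polynomial.C (T.eval (1 + γ))⁻¹ * T.comp q).eval x =
      T.eval (1 + γ + 2 * (e - x) / U) / T.eval (1 + γ) := by
    intro x
    rw [Polynomial.eval_mul, Polynomial.eval_C, Polynomial.eval_comp, hqe]; ring
  refine ⟨Polynomial.C (T.eval (1 + γ))⁻¹ * T.comp q, ?_, ?_, ?_⟩
  · refine (Polynomial.natDegree_C_mul_le _ _).trans (Polynomial.natDegree_comp_le.trans ?_)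
    have h1 : T.natDegree ≤ l := by
      rw [hT, Polynomial.Chebyshev.natDegree_T]; simp
    have h2 : q.natDegree ≤ 1 := Polynomial.natDegree_linear_le
    nlinarith
  · intro x hx
    rw [hpe, le_div_iff₀ hpos, one_mul]
    refine Polynomial.Chebyshev.T_real_le_of_one_le l (by linarith) ?_
    have : 0 ≤ 2 * (e - x) / U := div_nonneg (by linarith) hUpos.le
    linarith
  · intro x hx hx'
    rw [hpe, abs_div, abs_of_pos hpos, div_le_iff₀ hpos]
    have h1 : |T.eval (1 + γ + 2 * (e - x) / U)| ≤ 1 := by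
      refine Polynomial.Chebyshev.abs_eval_T_real_le_one l (abs_le.2 ⟨?_, ?_⟩)
      · have : 1 + γ + 2 * (e - x) / U + 1 = (2 * U + 2 * η + 2 * (e - x)) / U := by
          rw [hγ]; field_simp; ring
        have h3 : 0 ≤ (2 * U + 2 * η + 2 * (e - x)) / U := div_nonneg (by linarith) hUpos.le
        linarith
      · have : γ + 2 * (e - x) / U = (2 * η + 2 * (e - x)) / U := by
          rw [hγ]; ring
        have h3 : (2 * η + 2 * (e - x)) / U ≤ 0 := div_nonpos_of_nonpos_of_nonneg (by linarith) hUpos.le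
        linarith
    have h2 : Real.exp (-(l * √γ)) * Real.exp (l * √γ) = 1 := by rw [← Real.exp_add]; simp
    nlinarith [Real.exp_pos (-(l * √γ))]
end

noncomputable section

/-! ### Lifting a subspace to combinations of few prescribed vectors. -/

section Auerbach
variable {E : Type*} [NormedAddCommGroup E] [InnerProductSpace ℂ E] [FiniteDimensional ℂ E]

/-- A set of vectors separating a subspace contains a basis-like family whose determinant is within
a factor of two of the largest one. -/
theorem exists_near_maximal_family {f : ℕ} (V : Set (Fin f → ℂ)) (hb : ∀ v ∈ V, ∀ j, ‖v j‖ ≤ 1)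
    (hV : Submodule.span ℂ V = ⊤) :
    ∃ v : Fin f → Fin f → ℂ, (∀ i, v i ∈ V) ∧ ∀ u ∈ V, ∃ c : Fin f → ℂ,
      (∀ i, ‖c i‖ ≤ 2) ∧ u = ∑ i, c i • v i := by
  -- Half of the supremum is enough, so no compactness of `V` is required. Cramer's rule writes
  -- coefficients as quotients of determinants, which are then at most `2`.
  let S : Set ℝ := {r | ∃ v : Fin f → Fin f → ℂ, (∀ i, v i ∈ V) ∧ r = ‖(Matrix.of v).det‖}
  have hbdd : BddAbove S := by
    refine ⟨(Nat.factorial f : ℝ), ?_⟩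
    rintro _ ⟨v, hv, rfl⟩
    have := Matrix.det_le (A := Matrix.of v) (abv := IsAbsoluteValue.toAbsoluteValue (norm : ℂ → ℝ))
      (x := 1) fun i j => hb _ (hv i) j
    simpa using this
  have hpos : ∃ r ∈ S, 0 < r := by
    obtain ⟨b, hbV, hspan, hli⟩ := exists_linearIndependent ℂ V
    rw [hV] at hspan
    let B := Module.Basis.mk hli (by rw [Subtype.range_coe, hspan])
    have : Fintype b := FiniteDimensional.fintypeBasisIndex B
    have hcard : Fintype.card b = f := by
      rw [← Module.finrank_eq_card_basis B]; simp
    let e : Fin f ≃ b := (Fintype.equivFinOfCardEq hcard).symm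
    refine ⟨_, ⟨fun i => (e i : Fin f → ℂ), fun i => hbV (e i).2, rfl⟩, ?_⟩
    rw [norm_pos_iff]
    have hli' : LinearIndependent ℂ fun i => ((e i : b) : Fin f → ℂ) := hli.comp _ e.injective
    have := (Matrix.linearIndependent_rows_iff_isUnit
      (A := Matrix.of fun i => ((e i : b) : Fin f → ℂ))).1 hli'
    exact ((Matrix.isUnit_iff_isUnit_det _).1 this).ne_zero
  obtain ⟨r₀, hr₀, hr₀pos⟩ := hpos
  have hS : 0 < sSup S := hr₀pos.trans_le (le_csSup hbdd hr₀)
  obtain ⟨r, ⟨v, hv, rfl⟩, hr⟩ := exists_lt_of_lt_csSup ⟨r₀, hr₀⟩ (half_lt_self hS)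
  have hdet : (Matrix.of v).det ≠ 0 := by
    rw [← norm_pos_iff]; linarith
  refine ⟨v, hv, fun u hu => ⟨fun i => (Matrix.of v).det⁻¹ * ((Matrix.of v).updateRow i u).det,
    fun i => ?_, ?_⟩⟩
  · have h1 : ‖((Matrix.of v).updateRow i u).det‖ ≤ sSup S := by
      refine le_csSup hbdd ⟨Function.update v i u, fun i' => ?_, ?_⟩
      · by_cases h : i' = i
        · subst h; simpa using hu
        · simpa [h] using hv i'
      · rfl
    rw [norm_mul, norm_inv, inv_mul_le_iff₀ (norm_pos_iff.2 hdet)]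
    linarith
  · have h1 := Matrix.mulVec_cramer (Matrix.of v)ᵀ u
    rw [Matrix.det_transpose] at h1
    have h2 : u = (Matrix.of v).det⁻¹ • ((Matrix.of v)ᵀ *ᵥ (Matrix.of v)ᵀ.cramer u) := by
      rw [h1, smul_smul, inv_mul_cancel₀ hdet, one_smul]
    conv_lhs => rw [h2]
    ext j
    simp only [Pi.smul_apply, Matrix.mulVec, dotProduct, Matrix.transpose_apply, Matrix.of_apply,
      Matrix.cramer_transpose_apply, Finset.sum_apply, smul_eq_mul, Finset.mul_sum]
    exact Finset.sum_congr rfl fun i _ => by ring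

/-- Auerbach's lemma, for the functionals on `W` given by a set `Φ` of vectors. -/
theorem exists_auerbach_family (W : Submodule ℂ E) (Φ : Set E) (hΦ : ∀ φ ∈ Φ, ‖φ‖ ≤ 1)
    (hsep : ∀ w ∈ W, w ≠ 0 → ∃ φ ∈ Φ, inner ℂ φ w ≠ 0) :
    ∃ φ : Fin (Module.finrank ℂ W) → E, (∀ i, φ i ∈ Φ) ∧
      ∀ ξ ∈ Φ, ∀ w ∈ W, ‖inner ℂ ξ w‖ ≤ 2 * ∑ i, ‖inner ℂ (φ i) w‖ := by
  let b := stdOrthonormalBasis ℂ W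
  let row : E → Fin (Module.finrank ℂ W) → ℂ := fun φ j => inner ℂ φ (b j : E)
  have hrow : ∀ (φ : E) (w : W), inner ℂ φ (w : E) = ∑ j, row φ j * b.repr w j := by
    intro φ w
    conv_lhs => rw [← b.sum_repr w]
    simp [row, mul_comm]
  -- A functional vanishing on all rows is represented by a nonzero vector of `W` orthogonal to `Φ`,
  -- against `hsep`.
  have hspan : Submodule.span ℂ (row '' Φ) = ⊤ := by
    by_contra hne
    obtain ⟨g, hg, hgv⟩ := Submodule.exists_le_ker_of_lt_top _ (lt_top_iff_ne_top.2 hne)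
    let c : Fin (Module.finrank ℂ W) → ℂ := fun j => g (Pi.single j 1)
    have hgc : ∀ v, g v = ∑ j, v j * c j := by
      intro v
      conv_lhs => rw [pi_eq_sum_univ' v]
      simp only [map_sum, map_smul, smul_eq_mul, c, Pi.single]
    let w : W := b.repr.symm (WithLp.toLp 2 c)
    have hrep : ∀ j, b.repr w j = c j := fun j => by simp [w]
    have hw : w ≠ 0 := by
      intro h0
      refine hg ?_
      ext j
      have := hrep j
      rw [h0] at this
      simp only [map_zero, PiLp.zero_apply] at this
      simpa [c] using this.symm
    obtain ⟨φ, hφ, hne⟩ := hsep w w.2 (by simpa using hw)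
    apply hne
    have := hgv (Submodule.subset_span ⟨φ, hφ, rfl⟩)
    rw [LinearMap.mem_ker, hgc] at this
    rw [hrow]
    simpa only [hrep] using this
  obtain ⟨v, hv, hmax⟩ := exists_near_maximal_family (row '' Φ) (by
    rintro _ ⟨φ, hφ, rfl⟩ j
    refine (norm_inner_le_norm _ _).trans ?_
    have : ‖(b j : E)‖ = 1 := b.orthonormal.1 j
    rw [this, mul_one]
    exact hΦ φ hφ) hspan
  choose φ hφ hφv using hv
  refine ⟨φ, hφ, fun ξ hξ w hw => ?_⟩
  obtain ⟨c, hc, hcu⟩ := hmax _ ⟨ξ, hξ, rfl⟩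
  have : inner ℂ ξ w = ∑ i, c i * inner ℂ (φ i) w := by
    have h1 := hrow ξ ⟨w, hw⟩
    simp only [] at h1
    rw [h1, hcu]
    simp only [Finset.sum_apply, Pi.smul_apply, smul_eq_mul, Finset.sum_mul]
    rw [Finset.sum_comm]
    refine Finset.sum_congr rfl fun i _ => ?_
    have h2 := hrow (φ i) ⟨w, hw⟩
    simp only [] at h2
    rw [h2, Finset.mul_sum, hφv]
    exact Finset.sum_congr rfl fun j _ => by ring
  rw [this, Finset.mul_sum]
  refine (norm_sum_le _ _).trans (Finset.sum_le_sum fun i _ => ?_)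
  rw [norm_mul]
  exact mul_le_mul_of_nonneg_right (hc i) (norm_nonneg _)

/-- If every vector of `W` has a large overlap with some element of `Φ`, then every vector of `W` is
the projection of a short combination of `dim W` elements of `Φ`. -/
theorem exists_lift_of_overlap (W : Submodule ℂ E) (Φ : Set E) (hΦ : ∀ φ ∈ Φ, ‖φ‖ ≤ 1) {ν : ℝ}
    (hν : 0 < ν) (hov : ∀ w ∈ W, ∃ φ ∈ Φ, ν * ‖w‖ ^ 2 ≤ ‖inner ℂ φ w‖ ^ 2) {f : ℕ}
    (hf : Module.finrank ℂ W = f) (w : E) (hw : w ∈ W) :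
    ∃ (φ : Fin f → E) (c : Fin f → ℂ), (∀ i, φ i ∈ Φ) ∧ ∑ i, c i • φ i - w ∈ Wᗮ ∧
      ‖∑ i, c i • φ i‖ ^ 2 ≤ 4 * f ^ 2 / ν * ‖w‖ ^ 2 := by
  have hfam := exists_auerbach_family W Φ hΦ fun w hw hne => by
    obtain ⟨ξ, hξ, h⟩ := hov w hw
    refine ⟨ξ, hξ, fun h0 => ?_⟩
    rw [h0] at h
    have := norm_pos_iff.2 hne
    have : 0 < ν * ‖w‖ ^ 2 := by positivity
    simp at h; linarith
  rw [hf] at hfam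
  obtain ⟨φ, hφ, hmax⟩ := hfam
  -- The frame operator of the Auerbach family. Compressed to `W` it is bounded below by `ν / (4
  -- f)`, hence invertible there; applying `Q` to the preimage of `w` gives the required
  -- combination.
  let Q : E →ₗ[ℂ] E := ∑ i, ((innerSL ℂ (φ i)).toLinearMap).smulRight (φ i)
  have hQ : ∀ y, Q y = ∑ i, inner ℂ (φ i) y • φ i := fun y => by simp [Q]
  let a : E → ℝ := fun y => ∑ i, ‖inner ℂ (φ i) y‖ ^ 2
  have haQ : ∀ y, inner ℂ y (Q y) = (a y : ℂ) := by
    intro y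
    rw [hQ, inner_sum]
    simp only [a, inner_smul_right, Complex.ofReal_sum]
    refine Finset.sum_congr rfl fun i _ => ?_
    rw [← inner_conj_symm y (φ i), Complex.mul_conj, Complex.normSq_eq_norm_sq]
  have hlow : ∀ y ∈ W, ν * ‖y‖ ^ 2 ≤ 4 * f * a y := by
    intro y hy
    obtain ⟨ξ, hξ, h⟩ := hov y hy
    refine h.trans ?_
    have h1 := hmax ξ hξ y hy
    have h2 : (∑ i, ‖inner ℂ (φ i) y‖) ^ 2 ≤ f * a y := by
      have := sq_sum_le_card_mul_sum_sq (s := Finset.univ) (f := fun i => ‖inner ℂ (φ i) y‖)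
      simpa using this
    calc ‖inner ℂ ξ y‖ ^ 2 ≤ (2 * ∑ i, ‖inner ℂ (φ i) y‖) ^ 2 := by gcongr
      _ = 4 * (∑ i, ‖inner ℂ (φ i) y‖) ^ 2 := by ring
      _ ≤ 4 * (f * a y) := by gcongr
      _ = _ := by ring
  let T : W →ₗ[ℂ] W := (W.orthogonalProjectionOnto : E →ₗ[ℂ] W) ∘ₗ Q ∘ₗ W.subtype
  have hT : ∀ y : W, Q y - (T y : E) ∈ Wᗮ := fun y =>
    Submodule.sub_starProjection_mem_orthogonal (K := W) (Q y)
  have hinner : ∀ y : W, inner ℂ (y : E) (T y : E) = (a y : ℂ) := by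
    intro y
    have h1 : inner ℂ (y : E) (Q y - (T y : E)) = 0 :=
      Submodule.inner_right_of_mem_orthogonal y.2 (hT y)
    rw [inner_sub_right, haQ] at h1
    exact (sub_eq_zero.1 h1).symm
  have hinj : Function.Injective T := by
    rw [← LinearMap.ker_eq_bot, LinearMap.ker_eq_bot']
    intro y hy
    have h1 := hinner y
    rw [hy] at h1
    simp only [ZeroMemClass.coe_zero, inner_zero_right] at h1
    have h2 : a y = 0 := by exact_mod_cast h1.symm
    have h3 := hlow y y.2
    rw [h2, mul_zero] at h3
    have h4 : ‖(y : E)‖ = 0 := by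
      by_contra h
      have : 0 < ‖(y : E)‖ := lt_of_le_of_ne (norm_nonneg _) (Ne.symm h)
      have : 0 < ν * ‖(y : E)‖ ^ 2 := by positivity
      linarith
    simpa using h4
  obtain ⟨y, hy⟩ := LinearMap.injective_iff_surjective.1 hinj ⟨w, hw⟩
  have hTy : (T y : E) = w := congrArg Subtype.val hy
  refine ⟨φ, fun i => inner ℂ (φ i) (y : E), hφ, ?_, ?_⟩
  · rw [← hQ, ← hTy]; exact hT y
  · have ha0 : 0 ≤ a y := Finset.sum_nonneg fun i _ => by positivity
    have h1 : a y ≤ ‖(y : E)‖ * ‖w‖ := by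
      have := hinner y
      rw [hTy] at this
      have h2 := norm_inner_le_norm (𝕜 := ℂ) (y : E) w
      rw [this, Complex.norm_real, Real.norm_of_nonneg ha0] at h2
      exact h2
    have h2 : ν * a y ≤ 4 * f * ‖w‖ ^ 2 := by
      rcases ha0.eq_or_lt with h | h
      · rw [← h]; simp; positivity
      · have h3 : a y ^ 2 ≤ ‖(y : E)‖ ^ 2 * ‖w‖ ^ 2 := by
          rw [← mul_pow]; gcongr
        have h4 := hlow y y.2
        have h5 : ν * a y * a y ≤ 4 * f * ‖w‖ ^ 2 * a y := by
          nlinarith [sq_nonneg ‖w‖, mul_le_mul_of_nonneg_right h4 (sq_nonneg ‖w‖)]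
        exact le_of_mul_le_mul_right h5 h
    have h3 : ‖∑ i, inner ℂ (φ i) (y : E) • φ i‖ ≤ ∑ i, ‖inner ℂ (φ i) (y : E)‖ := by
      refine norm_sum_le_of_le _ fun i _ => ?_
      rw [norm_smul]
      exact mul_le_of_le_one_right (norm_nonneg _) (hΦ _ (hφ i))
    have h4 : (∑ i, ‖inner ℂ (φ i) (y : E)‖) ^ 2 ≤ f * a y := by
      have := sq_sum_le_card_mul_sum_sq (s := Finset.univ) (f := fun i => ‖inner ℂ (φ i) (y : E)‖)
      simpa using this
    calc ‖∑ i, inner ℂ (φ i) (y : E) • φ i‖ ^ 2 ≤ (∑ i, ‖inner ℂ (φ i) (y : E)‖) ^ 2 := by gcongr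
      _ ≤ f * a y := h4
      _ = f * (ν * a y) / ν := by field_simp
      _ ≤ f * (4 * f * ‖w‖ ^ 2) / ν := by gcongr
      _ = _ := by ring

end Auerbach
end

noncomputable section

/-! ### Schmidt decomposition and bootstrapping of product overlaps. -/

namespace SpinChain
variable {n d : ℕ}

theorem splice_splice_left (k : ℕ) (a b σ : Config n d) : splice k (splice k a b) σ = splice k a σ := by
  ext i; simp only [splice]; split_ifs <;> rfl

theorem splice_splice_right (k : ℕ) (a b σ : Config n d) : splice k a (splice k b σ) = splice k a σ := by
  ext i; simp only [splice]; split_ifs <;> rfl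

theorem splice_self (k : ℕ) (σ : Config n d) : splice k σ σ = σ := by
  ext i; simp [splice]

/-- Exchanging the right halves of two configurations is an involution of the pairs. -/
theorem sum_splice (k : ℕ) (H : Config n d → ℝ) :
    ∑ a, ∑ σ, H (splice k a σ) = Fintype.card (Config n d) * ∑ τ, H τ := by
  have hinv : ∀ p : Config n d × Config n d,
      (splice k (splice k p.1 p.2) (splice k p.2 p.1), splice k (splice k p.2 p.1) (splice k p.1 p.2))
        = p := by
    intro p
    rw [splice_splice_left, splice_splice_right, splice_splice_left, splice_splice_right,
      splice_self, splice_self]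
  let e : Config n d × Config n d ≃ Config n d × Config n d :=
    { toFun := fun p => (splice k p.1 p.2, splice k p.2 p.1)
      invFun := fun p => (splice k p.1 p.2, splice k p.2 p.1)
      left_inv := hinv
      right_inv := hinv }
  have h1 := e.sum_comp fun p => H p.1
  rw [Fintype.sum_prod_type, Fintype.sum_prod_type] at h1
  rw [show ∑ a, ∑ σ, H (splice k a σ) = ∑ x, ∑ y, H (e (x, y)).1 from rfl, h1]
  simp only [Finset.sum_const, Finset.card_univ, nsmul_eq_mul, Finset.mul_sum]

theorem schmidtRank_le_one {k : ℕ} {φ : Space n d} (v : Space n d)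
    (h : ∀ a, ∃ c : ℂ, pullback (splice k a) φ = c • v) : schmidtRank k φ ≤ 1 := by
  refine (Submodule.finrank_mono (t := Submodule.span ℂ {v}) ?_).trans
    ((finrank_span_le_card ({v} : Set (Space n d))).trans (by simp))
  rw [rowSpace, Submodule.span_le]
  rintro _ ⟨a, rfl⟩
  obtain ⟨c, hc⟩ := h a
  simp only [hc]
  exact Submodule.smul_mem _ _ (Submodule.mem_span_singleton_self v)

theorem schmidtRank_single (k : ℕ) (σ : Config n d) :
    schmidtRank k (EuclideanSpace.single σ (1 : ℂ)) ≤ 1 := by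
  refine schmidtRank_le_one (pullback (splice k σ) (EuclideanSpace.single σ (1 : ℂ))) fun a => ?_
  by_cases h : ∀ i : Fin n, i.1 < k → a i = σ i
  · refine ⟨1, ?_⟩
    rw [one_smul]
    have : splice k a = splice k σ := by
      ext τ i; simp only [splice]; split_ifs with hi
      · rw [h i hi]
      · rfl
    rw [this]
  · refine ⟨0, ?_⟩
    rw [zero_smul]
    push Not at h
    obtain ⟨i, hi, hne⟩ := h
    ext τ
    rw [pullback_apply]
    have : splice k a τ ≠ σ := fun h0 => hne (by rw [← h0]; simp [splice, hi])
    simp [this]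

/-- The Schmidt decomposition. -/
theorem exists_schmidt_decomposition (k : ℕ) (x : Space n d) :
    ∃ φ : Fin (schmidtRank k x) → Space n d, (∀ i, schmidtRank k (φ i) ≤ 1) ∧ x = ∑ i, φ i ∧
      ∑ i, ‖φ i‖ ^ 2 = ‖x‖ ^ 2 := by
  let e : OrthonormalBasis (Fin (schmidtRank k x)) ℂ (rowSpace k x) :=
    stdOrthonormalBasis ℂ (rowSpace k x)
  let r : Config n d → rowSpace k x := fun a => ⟨pullback (splice k a) x, pullback_mem_rowSpace k x a⟩
  have hr : ∀ a b, r (splice k a b) = r a := by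
    intro a b
    ext1; ext σ
    simp [r, splice_splice_left]
  have he : ∀ (i) (a σ : Config n d), (e i : Space n d) (splice k a σ) = (e i : Space n d) σ := by
    intro i a σ
    have : ∀ v ∈ rowSpace k x, ∀ (a σ : Config n d), v (splice k a σ) = v σ := by
      intro v hv
      induction hv using Submodule.span_induction with
      | mem v hv => obtain ⟨b, rfl⟩ := hv; intro a σ; simp [splice_splice_right]
      | zero => intro a σ; simp
      | add u v _ _ hu hv => intro a σ; simp [hu, hv]
      | smul c u _ hu => intro a σ; simp [hu]
    exact this _ (e i).2 a σ
  -- Expanding each row in an orthonormal basis of the row space separates the variables: the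
  -- coefficient depends only on the left spins (`hr`), the basis vector only on the right ones
  -- (`he`).
  let φ : Fin (schmidtRank k x) → Space n d := fun i =>
    WithLp.toLp 2 fun σ => inner ℂ (e i) (r σ) * (e i : Space n d) σ
  have hN : (0 : ℝ) < Fintype.card (Config n d) ∨ x = 0 := by
    rcases Nat.eq_zero_or_pos (Fintype.card (Config n d)) with h | h
    · right
      have := Fintype.card_eq_zero_iff.1 h
      ext σ; exact (this.false σ).elim
    · left; exact_mod_cast h
  refine ⟨φ, fun i => schmidtRank_le_one (e i : Space n d) fun a => ⟨inner ℂ (e i) (r a), ?_⟩, ?_, ?_⟩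
  · ext σ
    simp only [φ, pullback_apply, PiLp.smul_apply, smul_eq_mul, hr, he]
  · ext σ
    have h1 : (r σ : Space n d) σ = x σ := by simp [r, splice_self]
    rw [← h1]
    conv_lhs => rw [← e.sum_repr (r σ)]
    simp only [Submodule.coe_sum, Submodule.coe_smul, e.repr_apply_apply]
    simp [φ]
  · rcases hN with hN | rfl
    swap
    · have hφ0 : ∀ i, φ i = 0 := by
        intro i; ext σ
        have : r σ = 0 := by ext1; simp [r]
        simp [φ, this]
      simp [hφ0]
    have h1 : ∀ i, Fintype.card (Config n d) * ‖φ i‖ ^ 2 = ∑ a, ‖inner ℂ (e i) (r a)‖ ^ 2 := by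
      intro i
      rw [EuclideanSpace.norm_sq_eq, ← sum_splice k]
      refine Finset.sum_congr rfl fun a _ => ?_
      have : ∀ σ, ‖(φ i) (splice k a σ)‖ ^ 2 =
          ‖inner ℂ (e i) (r a)‖ ^ 2 * ‖(e i : Space n d) σ‖ ^ 2 := by
        intro σ
        simp only [φ, hr, he, norm_mul, mul_pow]
      simp only [this, ← Finset.mul_sum]
      rw [← EuclideanSpace.norm_sq_eq]
      have h2 : ‖(e i : Space n d)‖ = 1 := e.orthonormal.1 i
      rw [h2]; simp
    have h2 : ∑ a, ‖r a‖ ^ 2 = Fintype.card (Config n d) * ‖x‖ ^ 2 := by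
      rw [EuclideanSpace.norm_sq_eq, ← sum_splice k]
      refine Finset.sum_congr rfl fun a _ => ?_
      rw [Submodule.coe_norm, EuclideanSpace.norm_sq_eq]
      rfl
    have h3 : Fintype.card (Config n d) * ∑ i, ‖φ i‖ ^ 2 = Fintype.card (Config n d) * ‖x‖ ^ 2 := by
      rw [← h2, Finset.mul_sum]
      simp only [h1]
      rw [Finset.sum_comm]
      exact Finset.sum_congr rfl fun a _ => e.sum_sq_norm_inner_right (r a)
    exact mul_left_cancel₀ hN.ne' h3

/-- Some vector of Schmidt rank one has as large an overlap with `w` as the Schmidt rank of `x`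
allows. -/
theorem exists_product_overlap (k : ℕ) {D : ℕ} {x : Space n d} (hx : schmidtRank k x ≤ D)
    (w : Space n d) : ∃ φ : Space n d, schmidtRank k φ ≤ 1 ∧ ‖φ‖ ≤ 1 ∧
      ‖inner ℂ x w‖ ^ 2 ≤ D * ‖x‖ ^ 2 * ‖inner ℂ φ w‖ ^ 2 := by
  obtain ⟨φ, hφ, hsum, hnorm⟩ := exists_schmidt_decomposition k x
  let ψ : Fin (schmidtRank k x) → Space n d := fun i => ((‖φ i‖⁻¹ : ℝ) : ℂ) • φ i
  have hψ1 : ∀ i, ‖ψ i‖ ≤ 1 := by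
    intro i
    simp only [ψ, norm_smul, Complex.norm_real, norm_inv, norm_norm]
    exact inv_mul_le_one
  have hφψ : ∀ i, φ i = (‖φ i‖ : ℂ) • ψ i := by
    intro i
    by_cases h : ‖φ i‖ = 0
    · simp [norm_eq_zero.1 h]
    · simp only [ψ, smul_smul]
      rw [← Complex.ofReal_mul, mul_inv_cancel₀ h]; simp
  rcases Nat.eq_zero_or_pos (schmidtRank k x) with h0 | h0
  · refine ⟨0, by rw [schmidtRank_zero]; omega, by simp, ?_⟩
    have : x = 0 := by
      rw [hsum]
      have : IsEmpty (Fin (schmidtRank k x)) := by rw [h0]; infer_instance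
      exact Fintype.sum_empty _
    simp [this]
  · have : Nonempty (Fin (schmidtRank k x)) := ⟨⟨0, h0⟩⟩
    obtain ⟨i₀, hi₀⟩ := Finite.exists_max fun i => ‖inner ℂ (ψ i) w‖
    refine ⟨ψ i₀, (schmidtRank_smul_le k _ _).trans (hφ i₀), hψ1 i₀, ?_⟩
    have h1 : ‖inner ℂ x w‖ ≤ ∑ i, ‖φ i‖ * ‖inner ℂ (ψ i₀) w‖ := by
      conv_lhs => rw [hsum]
      rw [sum_inner]
      refine norm_sum_le_of_le _ fun i _ => ?_
      rw [hφψ i, inner_smul_left, norm_mul, ← hφψ i]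
      simp only [Complex.conj_ofReal, Complex.norm_real, norm_norm]
      exact mul_le_mul_of_nonneg_left (hi₀ i) (norm_nonneg _)
    rw [← Finset.sum_mul] at h1
    have h2 : (∑ i, ‖φ i‖) ^ 2 ≤ D * ‖x‖ ^ 2 := by
      have := sq_sum_le_card_mul_sum_sq (s := Finset.univ) (f := fun i => ‖φ i‖)
      rw [hnorm, Finset.card_univ, Fintype.card_fin] at this
      refine this.trans ?_
      gcongr
    calc ‖inner ℂ x w‖ ^ 2 ≤ ((∑ i, ‖φ i‖) * ‖inner ℂ (ψ i₀) w‖) ^ 2 := by gcongr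
      _ = (∑ i, ‖φ i‖) ^ 2 * ‖inner ℂ (ψ i₀) w‖ ^ 2 := by ring
      _ ≤ _ := by gcongr

/-- Every vector of `W` has overlap at least `ν` with some product vector across the cut `k`. -/
def HasProductOverlap (k : ℕ) (ν : ℝ) (W : Submodule ℂ (Space n d)) : Prop :=
  ∀ w ∈ W, ∃ φ : Space n d, schmidtRank k φ ≤ 1 ∧ ‖φ‖ ≤ 1 ∧ ν * ‖w‖ ^ 2 ≤ ‖inner ℂ φ w‖ ^ 2

theorem HasProductOverlap.mono {k : ℕ} {ν ν' : ℝ} {W : Submodule ℂ (Space n d)}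
    (h : HasProductOverlap k ν W) (hν : ν' ≤ ν) : HasProductOverlap k ν' W := fun w hw => by
  obtain ⟨φ, h1, h2, h3⟩ := h w hw
  exact ⟨φ, h1, h2, le_trans (by gcongr) h3⟩

/-- `K` does not shrink the vectors of `W`, and shrinks those orthogonal to it by `δ`. -/
structure IsGroundProjector (K : Op n d) (W : Submodule ℂ (Space n d)) (δ : ℝ) : Prop where
  exists_preimage : ∀ w ∈ W, ∃ w' ∈ W, K w' = w ∧ ‖w'‖ ≤ ‖w‖
  map_orthogonal : ∀ x ∈ Wᗮ, K x ∈ Wᗮ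
  norm_map_le : ∀ x ∈ Wᗮ, ‖K x‖ ≤ δ * ‖x‖

theorem norm_sub_le_of_mem_orthogonal {W : Submodule ℂ (Space n d)} {x w : Space n d} (hw : w ∈ W)
    (h : x - w ∈ Wᗮ) : ‖x‖ ^ 2 = ‖w‖ ^ 2 + ‖x - w‖ ^ 2 := by
  have h0 : inner ℂ w (x - w) = 0 := Submodule.inner_right_of_mem_orthogonal hw h
  have := norm_add_sq_eq_norm_sq_add_norm_sq_of_inner_eq_zero w (x - w) h0
  rw [add_sub_cancel] at this
  nlinarith

/-- Approximation of `W` by vectors of low Schmidt rank. -/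
theorem HasProductOverlap.exists_approx {k D f : ℕ} {ν δ : ℝ} {W : Submodule ℂ (Space n d)}
    (h : HasProductOverlap k ν W) (hν : 0 < ν) (hf : Module.finrank ℂ W = f) {K : Op n d}
    (hK : IsGroundProjector K W δ) (hD : RankBound k D K) {w : Space n d} (hw : w ∈ W) :
    ∃ x : Space n d, schmidtRank k x ≤ D * f ∧ x - w ∈ Wᗮ ∧
      ‖x - w‖ ^ 2 ≤ δ ^ 2 * (4 * f ^ 2 / ν) * ‖w‖ ^ 2 := by
  obtain ⟨w', hw', hKw, hnorm⟩ := hK.exists_preimage w hw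
  obtain ⟨φ, c, hφ, horth, hx⟩ := exists_lift_of_overlap W
    {φ : Space n d | schmidtRank k φ ≤ 1 ∧ ‖φ‖ ≤ 1} (fun φ h => h.2) hν (fun u hu => by
      obtain ⟨φ, h1, h2, h3⟩ := h u hu
      exact ⟨φ, ⟨h1, h2⟩, h3⟩) hf w' hw'
  set y := ∑ i, c i • φ i with hy
  have hKsub : K y - w = K (y - w') := by rw [map_sub, hKw]
  refine ⟨K y, ?_, ?_, ?_⟩
  · refine (hD y).trans (Nat.mul_le_mul_left _ ?_)
    refine (schmidtRank_sum_le _ k _).trans ?_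
    calc ∑ i, schmidtRank k (c i • φ i) ≤ ∑ _i : Fin f, 1 :=
          Finset.sum_le_sum fun i _ => (schmidtRank_smul_le k _ _).trans (hφ i).1
      _ = f := by simp
  · rw [hKsub]; exact hK.map_orthogonal _ horth
  · rw [hKsub]
    have h1 : ‖y - w'‖ ^ 2 ≤ ‖y‖ ^ 2 := by
      rw [norm_sub_le_of_mem_orthogonal hw' horth]; linarith [sq_nonneg ‖w'‖]
    calc ‖K (y - w')‖ ^ 2 ≤ (δ * ‖y - w'‖) ^ 2 := by
          gcongr; exact hK.norm_map_le _ horth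
      _ = δ ^ 2 * ‖y - w'‖ ^ 2 := by ring
      _ ≤ δ ^ 2 * (4 * f ^ 2 / ν * ‖w'‖ ^ 2) := by gcongr; exact h1.trans hx
      _ ≤ δ ^ 2 * (4 * f ^ 2 / ν * ‖w‖ ^ 2) := by gcongr
      _ = _ := by ring

/-- The approximation `x` of `w` satisfies `⟪x, w⟫ = ‖w‖ ^ 2`, has Schmidt rank at most `D f` and
squared norm at most `1 + 4 δ ^ 2 f ^ 2 / ν` times that of `w`. Hence one of its Schmidt vectors has
overlap at least `1 / (D f (1 + 4 δ ^ 2 f ^ 2 / ν))`. The hypotheses `hν'` and `hsmall` each use up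
half of what doubling allows. -/
theorem HasProductOverlap.double {k D f : ℕ} {ν δ : ℝ} {W : Submodule ℂ (Space n d)}
    (h : HasProductOverlap k ν W) (hν : 0 < ν) (hf : Module.finrank ℂ W = f) {K : Op n d}
    (hK : IsGroundProjector K W δ) (hD : RankBound k D K) (hDf : 0 < D * f)
    (hsmall : 16 * f ^ 3 * D * δ ^ 2 ≤ 1) (hν' : 4 * D * f * ν ≤ 1) :
    HasProductOverlap k (2 * ν) W := by
  intro w hw
  obtain ⟨x, hx, horth, hnorm⟩ := h.exists_approx hν hf hK hD hw
  obtain ⟨φ, hφ, hφ1, hov⟩ := exists_product_overlap k hx w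
  refine ⟨φ, hφ, hφ1, ?_⟩
  rcases eq_or_ne w 0 with rfl | hne
  · simp
  have hw0 : 0 < ‖w‖ ^ 2 := by have := norm_pos_iff.2 hne; positivity
  have h1 : inner ℂ x w = ((‖w‖ ^ 2 : ℝ) : ℂ) := by
    have h0 : inner ℂ (x - w) w = 0 := Submodule.inner_left_of_mem_orthogonal hw horth
    rw [inner_sub_left, sub_eq_zero] at h0
    rw [h0, inner_self_eq_norm_sq_to_K]; simp
  have hDf' : (0 : ℝ) < D * f := by exact_mod_cast hDf
  have hxn : ‖x‖ ^ 2 ≤ (1 + δ ^ 2 * (4 * f ^ 2 / ν)) * ‖w‖ ^ 2 := by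
    rw [norm_sub_le_of_mem_orthogonal hw horth]; linarith
  have h2 : 2 * ν * ((D * f : ℕ) * (1 + δ ^ 2 * (4 * f ^ 2 / ν))) ≤ 1 := by
    have : 2 * ν * ((D * f : ℕ) * (1 + δ ^ 2 * (4 * f ^ 2 / ν))) =
        2 * (D * f * ν) + 8 * f ^ 3 * D * δ ^ 2 := by
      push_cast; field_simp; ring
    rw [this]; linarith
  rw [h1, Complex.norm_real, Real.norm_of_nonneg hw0.le] at hov
  set O := ‖inner ℂ φ w‖ ^ 2 with hO
  have hO0 : 0 ≤ O := by positivity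
  have h3 : (‖w‖ ^ 2) ^ 2 ≤ (D * f : ℕ) * ((1 + δ ^ 2 * (4 * f ^ 2 / ν)) * ‖w‖ ^ 2) * O :=
    hov.trans (by gcongr)
  have h4 : ‖w‖ ^ 2 ≤ (D * f : ℕ) * (1 + δ ^ 2 * (4 * f ^ 2 / ν)) * O := by
    refine le_of_mul_le_mul_right ?_ hw0
    calc ‖w‖ ^ 2 * ‖w‖ ^ 2 = (‖w‖ ^ 2) ^ 2 := by ring
      _ ≤ _ := h3
      _ = _ := by ring
  calc 2 * ν * ‖w‖ ^ 2 ≤ 2 * ν * ((D * f : ℕ) * (1 + δ ^ 2 * (4 * f ^ 2 / ν)) * O) := by gcongr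
    _ = 2 * ν * ((D * f : ℕ) * (1 + δ ^ 2 * (4 * f ^ 2 / ν))) * O := by ring
    _ ≤ 1 * O := by gcongr
    _ = O := one_mul O

/-- The basis configuration of largest amplitude. This starting value depends on `n`, but the
doubling forgets it. -/
theorem hasProductOverlap_card_inv (k : ℕ) (W : Submodule ℂ (Space n d)) :
    HasProductOverlap k (Fintype.card (Config n d) : ℝ)⁻¹ W := by
  intro w _
  rcases isEmpty_or_nonempty (Config n d) with h | h
  · exact ⟨0, by rw [schmidtRank_zero]; omega, by simp, by simp⟩
  · obtain ⟨σ, hσ⟩ := Finite.exists_max fun σ => ‖w σ‖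
    refine ⟨EuclideanSpace.single σ 1, schmidtRank_single k σ, by simp, ?_⟩
    have hN : (0 : ℝ) < Fintype.card (Config n d) := by exact_mod_cast Fintype.card_pos
    rw [inv_mul_le_iff₀ hN, EuclideanSpace.norm_sq_eq, EuclideanSpace.inner_single_left]
    simp only [map_one, one_mul]
    calc ∑ τ, ‖w τ‖ ^ 2 ≤ ∑ _τ : Config n d, ‖w σ‖ ^ 2 := Finset.sum_le_sum fun τ _ => by
          gcongr; exact hσ τ
      _ = _ := by simp

/-- Bootstrapping: an approximate ground space projector of low Schmidt rank forces a large overlap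
with product vectors. -/
theorem hasProductOverlap_of_isGroundProjector {k D f : ℕ} {δ : ℝ} {W : Submodule ℂ (Space n d)}
    (hf : Module.finrank ℂ W = f) {K : Op n d} (hK : IsGroundProjector K W δ)
    (hD : RankBound k D K) (hDf : 0 < D * f) (hsmall : 16 * f ^ 3 * D * δ ^ 2 ≤ 1) :
    HasProductOverlap k (1 / (4 * D * f)) W := by
  rcases isEmpty_or_nonempty (Config n d) with hC | hC
  · intro w _
    have : w = 0 := by ext σ; exact hC.elim σ
    exact ⟨0, by rw [schmidtRank_zero]; omega, by simp, by simp [this]⟩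
  set ν₀ : ℝ := (Fintype.card (Config n d) : ℝ)⁻¹ with hν₀
  have hν₀pos : 0 < ν₀ := by
    have : (0 : ℝ) < Fintype.card (Config n d) := by exact_mod_cast Fintype.card_pos
    positivity
  have hDf' : (0 : ℝ) < D * f := by exact_mod_cast hDf
  set ν₁ : ℝ := 1 / (4 * D * f) with hν₁
  have hν₁pos : 0 < ν₁ := by rw [hν₁, mul_assoc]; positivity
  have key : ∀ m : ℕ, HasProductOverlap k (min (2 ^ m * ν₀) ν₁) W := by
    intro m
    induction m with
    | zero =>
      refine (hasProductOverlap_card_inv k W).mono ?_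
      simp [hν₀]
    | succ m ih =>
      refine (ih.double (lt_min (by positivity) hν₁pos) hf hK hD hDf hsmall ?_).mono ?_
      · have : min (2 ^ m * ν₀) ν₁ ≤ ν₁ := min_le_right _ _
        calc 4 * D * f * min (2 ^ m * ν₀) ν₁ ≤ 4 * D * f * ν₁ := by gcongr
          _ = 1 := by rw [hν₁, mul_assoc (4 : ℝ), mul_one_div, div_self (by positivity)]
      · rcases le_total (2 ^ m * ν₀) ν₁ with h | h
        · rw [min_eq_left h]
          refine (min_le_left _ _).trans (le_of_eq ?_)
          rw [pow_succ]; ring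
        · rw [min_eq_right h]
          refine (min_le_right _ _).trans (by linarith)
  obtain ⟨m, hm⟩ := pow_unbounded_of_one_lt (ν₁ / ν₀) (one_lt_two (α := ℝ))
  have := key m
  rwa [min_eq_right ((div_lt_iff₀ hν₀pos).1 hm).le] at this

end SpinChain
end

noncomputable section

/-! ### Eigenbases and dimension counting. -/

section Eigenbasis
variable {E : Type*} [NormedAddCommGroup E] [InnerProductSpace ℂ E]

/-- An orthonormal basis of eigenvectors, with real eigenvalues. -/
structure IsEigenbasis {N : ℕ} (T : E →L[ℂ] E) (b : OrthonormalBasis (Fin N) ℂ E) (μ : Fin N → ℝ) :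
    Prop where
  apply_eq : ∀ i, T (b i) = (μ i : ℂ) • b i

theorem exists_isEigenbasis [FiniteDimensional ℂ E] {T : E →L[ℂ] E} (hT : IsSelfAdjoint T) :
    ∃ (b : OrthonormalBasis (Fin (Module.finrank ℂ E)) ℂ E) (μ : Fin (Module.finrank ℂ E) → ℝ),
      IsEigenbasis T b μ := by
  have hs : (T : E →ₗ[ℂ] E).IsSymmetric := hT.isSymmetric
  exact ⟨hs.eigenvectorBasis rfl, hs.eigenvalues rfl, ⟨fun i => hs.apply_eigenvectorBasis rfl i⟩⟩

namespace IsEigenbasis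
variable {N : ℕ} {T : E →L[ℂ] E} {b : OrthonormalBasis (Fin N) ℂ E} {μ : Fin N → ℝ}

theorem repr_apply (h : IsEigenbasis T b μ) (x : E) (i : Fin N) :
    b.repr (T x) i = μ i * b.repr x i := by
  conv_lhs => rw [← b.sum_repr x]
  simp only [map_sum, map_smul, h.apply_eq, WithLp.ofLp_sum, Finset.sum_apply, PiLp.smul_apply,
    b.repr_self, smul_eq_mul]
  rw [Finset.sum_eq_single i]
  · simp; ring
  · intro j _ hj
    simp [hj]
  · simp

theorem norm_sq_eq (b : OrthonormalBasis (Fin N) ℂ E) (x : E) : ‖x‖ ^ 2 = ∑ i, ‖b.repr x i‖ ^ 2 := by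
  rw [← EuclideanSpace.norm_sq_eq, LinearIsometryEquiv.norm_map]

theorem re_inner_apply (h : IsEigenbasis T b μ) (x : E) :
    (inner ℂ x (T x)).re = ∑ i, μ i * ‖b.repr x i‖ ^ 2 := by
  rw [← b.repr.inner_map_map, PiLp.inner_apply, Complex.re_sum]
  refine Finset.sum_congr rfl fun i _ => ?_
  rw [h.repr_apply, RCLike.inner_apply, mul_assoc, Complex.mul_conj, Complex.normSq_eq_norm_sq,
    ← Complex.ofReal_mul, Complex.ofReal_re]

/-- The span of the basis vectors with indices in `S`. -/
def spanOf (b : OrthonormalBasis (Fin N) ℂ E) (S : Finset (Fin N)) : Submodule ℂ E :=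
  Submodule.span ℂ (b '' S)

theorem finrank_spanOf (b : OrthonormalBasis (Fin N) ℂ E) (S : Finset (Fin N)) :
    Module.finrank ℂ (spanOf b S) = S.card := by
  classical
  have hli : LinearIndependent ℂ (fun i : S => b i) :=
    b.orthonormal.linearIndependent.comp _ Subtype.val_injective
  have := finrank_span_eq_card hli
  rw [Fintype.card_coe] at this
  rw [← this, spanOf]
  have : (b '' S : Set E) = Set.range fun i : S => b i := by ext x; simp
  rw [this]

theorem repr_eq_zero_of_mem (b : OrthonormalBasis (Fin N) ℂ E) {S : Finset (Fin N)} {x : E}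
    (hx : x ∈ spanOf b S) {i : Fin N} (hi : i ∉ S) : b.repr x i = 0 := by
  induction hx using Submodule.span_induction with
  | mem x hx =>
    obtain ⟨j, hj, rfl⟩ := hx
    rw [b.repr_self, PiLp.single_apply, if_neg]
    rintro rfl; exact hi hj
  | zero => simp
  | add x y _ _ hx hy => simp [hx, hy]
  | smul c x _ hx => simp [hx]

theorem mem_spanOf (b : OrthonormalBasis (Fin N) ℂ E) {S : Finset (Fin N)} {x : E}
    (hx : ∀ i ∉ S, b.repr x i = 0) : x ∈ spanOf b S := by
  rw [← b.sum_repr x]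
  refine Submodule.sum_mem _ fun i _ => ?_
  by_cases hi : i ∈ S
  · exact Submodule.smul_mem _ _ (Submodule.subset_span ⟨i, hi, rfl⟩)
  · rw [hx i hi, zero_smul]; exact Submodule.zero_mem _

theorem mem_orthogonal_iff (b : OrthonormalBasis (Fin N) ℂ E) {S : Finset (Fin N)} {x : E} :
    x ∈ (spanOf b S)ᗮ ↔ ∀ i ∈ S, b.repr x i = 0 := by
  constructor
  · intro h i hi
    rw [b.repr_apply_apply]
    exact Submodule.inner_right_of_mem_orthogonal
      (show b i ∈ spanOf b S from Submodule.subset_span ⟨i, hi, rfl⟩) h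
  · intro h
    rw [Submodule.mem_orthogonal]
    intro u hu
    induction hu using Submodule.span_induction with
    | mem x hx => obtain ⟨j, hj, rfl⟩ := hx; rw [← b.repr_apply_apply]; exact h j hj
    | zero => simp
    | add x y _ _ hx hy => simp [inner_add_left, hx, hy]
    | smul c x _ hx => simp [inner_smul_left, hx]

end IsEigenbasis
end Eigenbasis

/-- The projection of `T` onto the smaller space `Z` has a kernel in `V`; this replaces the min-max
principle. -/
theorem Submodule.exists_ne_zero_mem_orthogonal {E : Type*} [NormedAddCommGroup E]
    [InnerProductSpace ℂ E] [FiniteDimensional ℂ E] {V Z : Submodule ℂ E} (T : E →ₗ[ℂ] E)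
    (h : Module.finrank ℂ Z < Module.finrank ℂ V) : ∃ v ∈ V, v ≠ 0 ∧ T v ∈ Zᗮ := by
  let g : V →ₗ[ℂ] Z := (Z.orthogonalProjectionOnto : E →ₗ[ℂ] Z) ∘ₗ T ∘ₗ V.subtype
  obtain ⟨v, hv, hne⟩ := Submodule.exists_mem_ne_zero_of_ne_bot (LinearMap.ker_ne_bot_of_finrank_lt (f := g) h)
  refine ⟨v, v.2, by simpa using hne, ?_⟩
  have : Z.orthogonalProjectionOnto (T v) = 0 := hv
  exact Submodule.orthogonalProjectionOnto_eq_zero_iff.1 this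

end

noncomputable section

/-! ### Truncating the energies outside a window. -/

section Truncation
variable {E : Type*} [NormedAddCommGroup E] [InnerProductSpace ℂ E] [FiniteDimensional ℂ E]

/-- A Hamiltonian `A + g + M + g' + B` whose outer parts `A`, `B` commute with everything except
their boundary terms `g`, `g'`. -/
structure IsWindow (A g M g' B : E →L[ℂ] E) (a m b s : ℝ) : Prop where
  selfAdjoint_left : IsSelfAdjoint A
  selfAdjoint_right : IsSelfAdjoint B
  commute_left_right : Commute A B
  commute_left_mid : Commute A M
  commute_left_bond : Commute A g'
  commute_right_mid : Commute B M
  commute_right_bond : Commute B g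
  le_left : algebraMap ℝ (E →L[ℂ] E) a ≤ A
  le_right : algebraMap ℝ (E →L[ℂ] E) b ≤ B
  le_mid : algebraMap ℝ (E →L[ℂ] E) m ≤ M
  mid_le : M ≤ algebraMap ℝ (E →L[ℂ] E) (m + s)
  bond_nonneg : 0 ≤ g
  bond_le : g ≤ 1
  bond_nonneg' : 0 ≤ g'
  bond_le' : g' ≤ 1
  conj_left : ‖NormedSpace.exp ((4⁻¹ : ℂ) • A) * g * NormedSpace.exp (-((4⁻¹ : ℂ) • A))‖ ≤ 2
  conj_right : ‖NormedSpace.exp ((4⁻¹ : ℂ) • B) * g' * NormedSpace.exp (-((4⁻¹ : ℂ) • B))‖ ≤ 2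

theorem truncAt_le {T : E →L[ℂ] E} (hT : IsSelfAdjoint T) (c : ℝ) : truncAt T c ≤ T := by
  conv_rhs => rw [← cfc_id ℝ T hT]
  exact cfc_le_cfc _ _ _ fun x _ => min_le_left _ _

theorem truncAt_le_algebraMap {T : E →L[ℂ] E} (hT : IsSelfAdjoint T) (c : ℝ) :
    truncAt T c ≤ algebraMap ℝ (E →L[ℂ] E) c := by
  rw [← cfc_const c T hT]
  exact cfc_le_cfc _ _ _ fun x _ => min_le_right _ _

theorem algebraMap_le_truncAt {T : E →L[ℂ] E} (hT : IsSelfAdjoint T) {a c : ℝ} (hac : a ≤ c)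
    (h : algebraMap ℝ (E →L[ℂ] E) a ≤ T) : algebraMap ℝ (E →L[ℂ] E) a ≤ truncAt T c := by
  have hsp : ∀ x ∈ spectrum ℝ T, a ≤ x := (algebraMap_le_iff_le_spectrum (ha := hT)).1 h
  rw [← cfc_const a T hT]
  exact cfc_le_cfc _ _ _ fun x hx => le_min (hsp x hx) hac

theorem lowerProj_add_upperProj {T : E →L[ℂ] E} (hT : IsSelfAdjoint T) (c : ℝ) :
    lowerProj T c + upperProj T c = 1 := by
  rw [lowerProj, upperProj, cfc_add_cfc, ← cfc_one ℝ T hT]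
  congr 1; ext x; split_ifs <;> simp

theorem mul_lowerProj {T : E →L[ℂ] E} (hT : IsSelfAdjoint T) (c : ℝ) :
    T * lowerProj T c = truncAt T c * lowerProj T c := by
  have e : cfc (fun x : ℝ => x) T = T := cfc_id' ℝ T hT
  calc T * lowerProj T c = cfc (fun x : ℝ => x) T * lowerProj T c := by rw [e]
    _ = _ := by
      rw [lowerProj, truncAt, cfc_mul_cfc, cfc_mul_cfc]
      congr 1; ext x
      split_ifs with h
      · simp
      · rw [min_eq_left (not_lt.1 h)]

namespace IsWindow
variable {A g M g' B : E →L[ℂ] E} {a m b s : ℝ}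

/-- The Hamiltonian with its outer parts truncated at `t` above their lowest energies. -/
def truncated (A g M g' B : E →L[ℂ] E) (a b t : ℝ) : E →L[ℂ] E :=
  truncAt A (a + t) + g + M + g' + truncAt B (b + t)

theorem symm (h : IsWindow A g M g' B a m b s) : IsWindow B g' M g A b m a s where
  selfAdjoint_left := h.selfAdjoint_right
  selfAdjoint_right := h.selfAdjoint_left
  commute_left_right := h.commute_left_right.symm
  commute_left_mid := h.commute_right_mid
  commute_left_bond := h.commute_right_bond
  commute_right_mid := h.commute_left_mid
  commute_right_bond := h.commute_left_bond
  le_left := h.le_right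
  le_right := h.le_left
  le_mid := h.le_mid
  mid_le := h.mid_le
  bond_nonneg := h.bond_nonneg'
  bond_le := h.bond_le'
  bond_nonneg' := h.bond_nonneg
  bond_le' := h.bond_le
  conj_left := h.conj_right
  conj_right := h.conj_left

theorem truncated_symm (A g M g' B : E →L[ℂ] E) (a b t : ℝ) :
    truncated B g' M g A b a t = truncated A g M g' B a b t := by
  unfold truncated; abel

theorem isSelfAdjoint_of_nonneg_sub {T : E →L[ℂ] E} {c : ℝ} (h : algebraMap ℝ (E →L[ℂ] E) c ≤ T) :
    IsSelfAdjoint T := by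
  have h1 : IsSelfAdjoint (T - algebraMap ℝ (E →L[ℂ] E) c) := IsSelfAdjoint.of_nonneg (sub_nonneg.2 h)
  have h2 := h1.add (IsSelfAdjoint.algebraMap (E →L[ℂ] E) (IsSelfAdjoint.all c))
  rwa [sub_add_cancel] at h2

theorem isSelfAdjoint_truncated (h : IsWindow A g M g' B a m b s) (t : ℝ) :
    IsSelfAdjoint (truncated A g M g' B a b t) := by
  have h1 : IsSelfAdjoint (truncAt A (a + t)) := cfc_predicate _ _
  have h2 : IsSelfAdjoint (truncAt B (b + t)) := cfc_predicate _ _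
  exact (((h1.add (IsSelfAdjoint.of_nonneg h.bond_nonneg)).add
    (isSelfAdjoint_of_nonneg_sub h.le_mid)).add (IsSelfAdjoint.of_nonneg h.bond_nonneg')).add h2

theorem truncated_le (h : IsWindow A g M g' B a m b s) (t : ℝ) :
    truncated A g M g' B a b t ≤ A + g + M + g' + B := by
  unfold truncated
  gcongr
  · exact truncAt_le h.selfAdjoint_left _
  · exact truncAt_le h.selfAdjoint_right _

theorem le_truncated (h : IsWindow A g M g' B a m b s) {t : ℝ} (ht : 0 ≤ t) :
    algebraMap ℝ (E →L[ℂ] E) (a + m + b) ≤ truncated A g M g' B a b t := by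
  have e : algebraMap ℝ (E →L[ℂ] E) (a + m + b) =
      algebraMap ℝ _ a + 0 + algebraMap ℝ _ m + 0 + algebraMap ℝ _ b := by
    simp [map_add]
  rw [e]
  exact add_le_add (add_le_add (add_le_add (add_le_add
    (algebraMap_le_truncAt h.selfAdjoint_left (by linarith) h.le_left) h.bond_nonneg) h.le_mid)
    h.bond_nonneg') (algebraMap_le_truncAt h.selfAdjoint_right (by linarith) h.le_right)

theorem truncated_le_algebraMap (h : IsWindow A g M g' B a m b s) (t : ℝ) :
    truncated A g M g' B a b t ≤ algebraMap ℝ (E →L[ℂ] E) (a + m + b + (s + 2 + 2 * t)) := by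
  have e : algebraMap ℝ (E →L[ℂ] E) (a + m + b + (s + 2 + 2 * t)) =
      algebraMap ℝ _ (a + t) + 1 + algebraMap ℝ _ (m + s) + 1 + algebraMap ℝ _ (b + t) := by
    rw [← map_one (algebraMap ℝ (E →L[ℂ] E)), ← map_add, ← map_add, ← map_add, ← map_add]
    congr 1; ring
  rw [e]
  exact add_le_add (add_le_add (add_le_add (add_le_add
    (truncAt_le_algebraMap h.selfAdjoint_left _) h.bond_le) h.mid_le)
    h.bond_le') (truncAt_le_algebraMap h.selfAdjoint_right _)

/-- The Agmon estimate with the left boundary bond as perturbation. Everything further right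
commutes with `A` and is at least `m + b`. -/
theorem norm_upperProj_left_le (h : IsWindow A g M g' B a m b s) {t e : ℝ} (ht : 0 ≤ t) {v : E}
    (hv : truncated A g M g' B a b t v = (e : ℂ) • v) (he : e ≤ a + m + b + 3) :
    ‖upperProj A (a + t) v‖ ≤ 16 * Real.exp (-t / 4) * ‖v‖ := by
  have hC : algebraMap ℝ (E →L[ℂ] E) (m + b) ≤ M + g' + truncAt B (b + t) := by
    have e : algebraMap ℝ (E →L[ℂ] E) (m + b) = algebraMap ℝ _ m + 0 + algebraMap ℝ _ b := by
      simp [map_add]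
    rw [e]
    exact add_le_add (add_le_add h.le_mid h.bond_nonneg')
      (algebraMap_le_truncAt h.selfAdjoint_right (by linarith) h.le_right)
  refine norm_upperProj_apply_le (C := M + g' + truncAt B (b + t)) (h := g) (c := m + b) (e := e)
    h.selfAdjoint_left ?_ h.le_left hC ((CStarAlgebra.norm_le_one_iff_of_nonneg g h.bond_nonneg).2
      h.bond_le) h.conj_left ht ?_ (by linarith)
  · exact (h.commute_left_mid.add_right h.commute_left_bond).add_right
      (h.commute_left_right.symm.cfc_real _).symm
  · rw [← hv]; unfold truncated; simp only [add_apply]; abel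

/-- The projection onto low energies of both outer parts. -/
def lowProj (A B : E →L[ℂ] E) (a b t : ℝ) : E →L[ℂ] E := lowerProj A (a + t) * lowerProj B (b + t)

theorem norm_lowProj_apply_le (A B : E →L[ℂ] E) (a b t : ℝ) (v : E) :
    ‖lowProj A B a b t v‖ ≤ ‖v‖ := by
  have h1 : ‖lowProj A B a b t‖ ≤ 1 := by
    refine (norm_mul_le _ _).trans ?_
    have := mul_le_mul (norm_lowerProj_le A (a + t)) (norm_lowerProj_le B (b + t)) (norm_nonneg _)
      zero_le_one
    simpa using this
  simpa using (ContinuousLinearMap.le_opNorm _ v).trans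
    (mul_le_mul_of_nonneg_right h1 (norm_nonneg v))

theorem norm_sub_lowProj_le (h : IsWindow A g M g' B a m b s) {t e : ℝ} (ht : 0 ≤ t) {v : E}
    (hv : truncated A g M g' B a b t v = (e : ℂ) • v) (he : e ≤ a + m + b + 3) :
    ‖v - lowProj A B a b t v‖ ≤ 32 * Real.exp (-t / 4) * ‖v‖ := by
  have h1 := h.norm_upperProj_left_le ht hv he
  have h2 := h.symm.norm_upperProj_left_le ht ((truncated_symm A g M g' B a b t).symm ▸ hv)
    (by linarith)
  have hA : ∀ x, x - lowerProj A (a + t) x = upperProj A (a + t) x := fun x => by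
    have := congrArg (fun T : E →L[ℂ] E => T x) (lowerProj_add_upperProj h.selfAdjoint_left (a + t))
    simp only [add_apply, one_apply_eq_self] at this
    exact sub_eq_of_eq_add' this.symm
  have hB : ∀ x, x - lowerProj B (b + t) x = upperProj B (b + t) x := fun x => by
    have := congrArg (fun T : E →L[ℂ] E => T x) (lowerProj_add_upperProj h.selfAdjoint_right (b + t))
    simp only [add_apply, one_apply_eq_self] at this
    exact sub_eq_of_eq_add' this.symm
  have e1 : v - lowProj A B a b t v =
      upperProj A (a + t) v + lowerProj A (a + t) (upperProj B (b + t) v) := by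
    rw [← hA, ← hB, map_sub, lowProj, ContinuousLinearMap.mul_apply_eq]; abel
  rw [e1]
  have h3 : ‖lowerProj A (a + t) (upperProj B (b + t) v)‖ ≤ ‖upperProj B (b + t) v‖ := by
    simpa using (ContinuousLinearMap.le_opNorm _ (upperProj B (b + t) v)).trans
      (mul_le_mul_of_nonneg_right (norm_lowerProj_le A (a + t)) (norm_nonneg _))
  calc _ ≤ 16 * Real.exp (-t / 4) * ‖v‖ + 16 * Real.exp (-t / 4) * ‖v‖ :=
        (norm_add_le _ _).trans (add_le_add h1 (h3.trans h2))
    _ = _ := by ring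

/-- Truncation changes nothing on vectors of low outer energy, so there the true Hamiltonian, whose
norm is not controlled, can be replaced by the truncated one. -/
theorem apply_lowProj (h : IsWindow A g M g' B a m b s) (t : ℝ) (v : E) :
    (A + g + M + g' + B) (lowProj A B a b t v) =
      truncated A g M g' B a b t (lowProj A B a b t v) := by
  have hc : lowerProj A (a + t) * lowerProj B (b + t) = lowerProj B (b + t) * lowerProj A (a + t) :=
    ((h.commute_left_right.cfc_real _).symm.cfc_real _).symm.eq
  have hA : A (lowProj A B a b t v) = truncAt A (a + t) (lowProj A B a b t v) := by
    rw [lowProj, ← ContinuousLinearMap.mul_apply_eq, ← ContinuousLinearMap.mul_apply_eq, ← mul_assoc,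
      mul_lowerProj h.selfAdjoint_left, mul_assoc]
  have hB : B (lowProj A B a b t v) = truncAt B (b + t) (lowProj A B a b t v) := by
    rw [lowProj, ← ContinuousLinearMap.mul_apply_eq, ← ContinuousLinearMap.mul_apply_eq, hc,
      ← mul_assoc, mul_lowerProj h.selfAdjoint_right, mul_assoc]
  unfold truncated
  simp only [add_apply, hA, hB]

/-- Projecting onto low energies changes the energy of a nearby vector little. -/
theorem energy_lowProj_le (h : IsWindow A g M g' B a m b s) {t τ : ℝ} (ht : 0 ≤ t) (hs : 0 ≤ s)
    {v : E} (hv : ‖v - lowProj A B a b t v‖ ≤ τ * ‖v‖) :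
    (inner ℂ (lowProj A B a b t v) ((A + g + M + g' + B) (lowProj A B a b t v))).re -
      (a + m + b) * ‖lowProj A B a b t v‖ ^ 2 ≤
    (inner ℂ v (truncated A g M g' B a b t v)).re - (a + m + b) * ‖v‖ ^ 2 +
      2 * (s + 2 + 2 * t) * τ * ‖v‖ ^ 2 := by
  rw [h.apply_lowProj]
  set H' := truncated A g M g' B a b t
  set P := lowProj A B a b t v
  set u := s + 2 + 2 * t
  -- Subtracting the common lower bound first leaves an operator between `0` and `u`, so errors
  -- scale with the window and not with the chain.
  set K := H' - algebraMap ℝ (E →L[ℂ] E) (a + m + b)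
  have hK0 : 0 ≤ K := sub_nonneg.2 (h.le_truncated ht)
  have hKu : K ≤ algebraMap ℝ (E →L[ℂ] E) u := by
    have := h.truncated_le_algebraMap t
    rw [map_add] at this
    exact sub_left_le_of_le_add this
  have hu : 0 ≤ u := by positivity
  have hKn : ‖K‖ ≤ u := (CStarAlgebra.norm_le_iff_le_algebraMap K hu hK0).2 hKu
  have hq : ∀ x, (inner ℂ x (K x)).re = (inner ℂ x (H' x)).re - (a + m + b) * ‖x‖ ^ 2 := by
    intro x
    simp only [K, sub_apply, inner_sub_right, Complex.sub_re, algebraMap_real_apply,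
      re_inner_smul_self]
  rw [← hq, ← hq]
  have hPn : ‖P‖ ≤ ‖v‖ := norm_lowProj_apply_le A B a b t v
  have h1 : inner ℂ P (K P) - inner ℂ v (K v) = inner ℂ (P - v) (K P) + inner ℂ v (K (P - v)) := by
    rw [map_sub, inner_sub_left, inner_sub_right]; ring
  have hop : ∀ x, ‖K x‖ ≤ u * ‖x‖ := fun x =>
    (K.le_opNorm x).trans (mul_le_mul_of_nonneg_right hKn (norm_nonneg x))
  have hv' : ‖P - v‖ ≤ τ * ‖v‖ := by rw [norm_sub_rev]; exact hv
  have h2 : ‖inner ℂ P (K P) - inner ℂ v (K v)‖ ≤ 2 * u * τ * ‖v‖ ^ 2 := by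
    rw [h1]
    refine (norm_add_le _ _).trans ?_
    have e1 : ‖inner ℂ (P - v) (K P)‖ ≤ (τ * ‖v‖) * (u * ‖v‖) :=
      (norm_inner_le_norm _ _).trans (mul_le_mul hv' ((hop P).trans (by gcongr)) (norm_nonneg _)
        ((norm_nonneg _).trans hv'))
    have e2 : ‖inner ℂ v (K (P - v))‖ ≤ ‖v‖ * (u * (τ * ‖v‖)) :=
      (norm_inner_le_norm _ _).trans (by gcongr; exact (hop _).trans (by gcongr))
    nlinarith
  have h3 := (Complex.re_le_norm _).trans h2
  rw [Complex.sub_re] at h3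
  linarith

end IsWindow
end Truncation
end

noncomputable section

/-! ### Low eigenspaces of the truncated Hamiltonian. -/

section LowSpace
variable {E : Type*} [NormedAddCommGroup E] [InnerProductSpace ℂ E]

/-- `Z` is an eigenspace for the eigenvalue `e`, the rest of the spectrum being at least `e + ε`. -/
structure IsGapSpace (H : E →L[ℂ] E) (Z : Submodule ℂ E) (e ε : ℝ) : Prop where
  selfAdjoint : ∀ x y, inner ℂ (H x) y = inner ℂ x (H y)
  apply_eq : ∀ z ∈ Z, H z = (e : ℂ) • z
  gap : ∀ x ∈ Zᗮ, (e + ε) * ‖x‖ ^ 2 ≤ (inner ℂ x (H x)).re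

/-- `W` is spanned by the eigenvectors with eigenvalue at most `e`, the other eigenvalues lying
between `lo` and `hi`. -/
def IsSpectralSpace (T : E →L[ℂ] E) (W : Submodule ℂ E) (e lo hi : ℝ) : Prop :=
  ∃ (N : ℕ) (b : OrthonormalBasis (Fin N) ℂ E) (μ : Fin N → ℝ) (S : Finset (Fin N)),
    IsEigenbasis T b μ ∧ W = IsEigenbasis.spanOf b S ∧ (∀ i ∈ S, μ i ≤ e) ∧
      ∀ i ∉ S, lo ≤ μ i ∧ μ i ≤ hi

theorem IsGapSpace.re_inner_add {H : E →L[ℂ] E} {Z : Submodule ℂ E} {e ε : ℝ}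
    (h : IsGapSpace H Z e ε) {z x : E} (hz : z ∈ Z) (hx : x ∈ Zᗮ) :
    e * ‖z + x‖ ^ 2 + ε * ‖x‖ ^ 2 ≤ (inner ℂ (z + x) (H (z + x))).re := by
  have h0 : inner ℂ z x = 0 := Submodule.inner_right_of_mem_orthogonal hz hx
  have h0' : inner ℂ x z = 0 := Submodule.inner_left_of_mem_orthogonal hz hx
  have h1 := norm_add_sq_eq_norm_sq_add_norm_sq_of_inner_eq_zero z x h0
  have h2 : inner ℂ z (H x) = 0 := by
    rw [← h.selfAdjoint, h.apply_eq z hz, inner_smul_left, h0, mul_zero]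
  have h3 : (inner ℂ (z + x) (H (z + x))).re = e * ‖z‖ ^ 2 + (inner ℂ x (H x)).re := by
    rw [map_add, inner_add_left, inner_add_right, inner_add_right, h2, h.apply_eq z hz,
      inner_smul_right x, h0', mul_zero, add_zero, zero_add, Complex.add_re, re_inner_smul_self]
  have h4 := h.gap x hx
  rw [h3, pow_two ‖z + x‖, h1]
  linarith

/-- Bounds on eigenvectors extend to their span by Cauchy–Schwarz on the coordinates, at the cost of
`√S.card`. -/
theorem IsEigenbasis.norm_sub_le_of_mem_spanOf {N : ℕ} (b : OrthonormalBasis (Fin N) ℂ E)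
    {S : Finset (Fin N)} {v : E} (hv : v ∈ IsEigenbasis.spanOf b S) (Q : E →L[ℂ] E) {κ : ℝ}
    (hκ : 0 ≤ κ) (hQ : ∀ i ∈ S, ‖Q (b i)‖ ≤ κ) : ‖Q v‖ ≤ √S.card * κ * ‖v‖ := by
  have h1 : Q v = ∑ i ∈ S, b.repr v i • Q (b i) := by
    conv_lhs => rw [← b.sum_repr v]
    rw [map_sum, ← Finset.sum_subset (Finset.subset_univ S)]
    · simp only [map_smul]
    · intro i _ hi
      rw [IsEigenbasis.repr_eq_zero_of_mem b hv hi, zero_smul, map_zero]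
  have h2 : (∑ i ∈ S, ‖b.repr v i‖ * 1) ≤ √(∑ i ∈ S, ‖b.repr v i‖ ^ 2) * √(∑ i ∈ S, (1 : ℝ) ^ 2) :=
    Real.sum_mul_le_sqrt_mul_sqrt _ _ _
  have h3 : √(∑ i ∈ S, ‖b.repr v i‖ ^ 2) ≤ ‖v‖ := by
    rw [← Real.sqrt_sq (norm_nonneg v)]
    apply Real.sqrt_le_sqrt
    rw [IsEigenbasis.norm_sq_eq b v]
    exact Finset.sum_le_sum_of_subset_of_nonneg (Finset.subset_univ S) fun _ _ _ => by positivity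
  have h4 : (∑ i ∈ S, ‖b.repr v i‖) ≤ ‖v‖ * √S.card := by
    simp only [mul_one, one_pow, Finset.sum_const, nsmul_eq_mul] at h2
    exact h2.trans (by gcongr)
  rw [h1]
  calc _ ≤ ∑ i ∈ S, ‖b.repr v i • Q (b i)‖ := norm_sum_le _ _
    _ ≤ ∑ i ∈ S, ‖b.repr v i‖ * κ := by
        refine Finset.sum_le_sum fun i hi => ?_
        rw [norm_smul]
        gcongr
        exact hQ i hi
    _ = (∑ i ∈ S, ‖b.repr v i‖) * κ := by rw [Finset.sum_mul]
    _ ≤ (‖v‖ * √S.card) * κ := by gcongr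
    _ = _ := by ring

variable [FiniteDimensional ℂ E]

namespace IsWindow
variable {A g M g' B : E →L[ℂ] E} {a m b s : ℝ}

set_option maxHeartbeats 1000000 in
-- Truncation only lowers energies, so at least `f` eigenvalues stay at or below `e`. Conversely,
-- projecting low eigenvectors to low outer energy turns them into trial states for the full
-- Hamiltonian with almost the same energy, so the gap of the latter forbids more than `f`
-- eigenvalues below `e + ε / 2`. The same energy comparisons bound the distance between the two
-- spaces.
theorem exists_spectralSpace (h : IsWindow A g M g' B a m b s) {Z : Submodule ℂ E} {e ε t τ u : ℝ}
    (hZ : IsGapSpace (A + g + M + g' + B) Z e ε) (he : a + m + b ≤ e) (he' : e ≤ a + m + b + 2)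
    (hε : 0 < ε) (hε1 : ε ≤ 1) (ht : 0 ≤ t) (hs : 0 ≤ s) (hu : u = s + 2 + 2 * t)
    (hτ : τ = √((Module.finrank ℂ Z : ℝ) + 1) * (32 * Real.exp (-t / 4)))
    (hsmall : 16 * u * τ ≤ ε) :
    ∃ W : Submodule ℂ E, Module.finrank ℂ W = Module.finrank ℂ Z ∧
      IsSpectralSpace (truncated A g M g' B a b t) W e (e + ε / 2) (a + m + b + u) ∧
      (∀ w ∈ W, ∃ z ∈ Z, ‖w - z‖ ≤ (τ + √(8 * u * τ / ε)) * ‖w‖) ∧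
      ∀ z ∈ Z, ∃ w ∈ W, ‖z - w‖ ≤ (τ + √(8 * u * τ / ε)) * ‖z‖ := by
  classical
  set f := Module.finrank ℂ Z with hf
  set H := A + g + M + g' + B with hH
  set H' := truncated A g M g' B a b t with hH'
  set P := lowProj A B a b t with hP
  have hu2 : 2 ≤ u := by rw [hu]; linarith
  have hτ0 : 0 ≤ τ := by rw [hτ]; positivity
  have hτs : τ ≤ ε / 32 := by nlinarith
  have hτ1 : τ ≤ 1 / 32 := by linarith
  obtain ⟨N, β, μ, hβ⟩ : ∃ (N : ℕ) (β : OrthonormalBasis (Fin N) ℂ E) (μ : Fin N → ℝ),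
    IsEigenbasis H' β μ := ⟨_, exists_isEigenbasis (h.isSelfAdjoint_truncated t)⟩
  -- low-energy vectors are nearly invariant under the projection
  have hnear : ∀ S : Finset (Fin N), S.card ≤ f + 1 → (∀ i ∈ S, μ i ≤ a + m + b + 3) →
      ∀ v ∈ IsEigenbasis.spanOf β S, ‖v - P v‖ ≤ τ * ‖v‖ := by
    intro S hS hμ v hv
    have := IsEigenbasis.norm_sub_le_of_mem_spanOf β hv (1 - P) (κ := 32 * Real.exp (-t / 4))
      (by positivity) (fun i hi => by
        have := h.norm_sub_lowProj_le ht (hβ.apply_eq i) (hμ i hi)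
        rw [β.norm_eq_one, mul_one] at this
        simpa [sub_apply] using this)
    rw [sub_apply, one_apply_eq_self] at this
    refine this.trans ?_
    rw [hτ]
    gcongr
    exact_mod_cast hS
  have henergy : ∀ v : E, ‖v - P v‖ ≤ τ * ‖v‖ →
      (inner ℂ (P v) (H (P v))).re - (a + m + b) * ‖P v‖ ^ 2 ≤
        (inner ℂ v (H' v)).re - (a + m + b) * ‖v‖ ^ 2 + 2 * u * τ * ‖v‖ ^ 2 := by
    intro v hv
    rw [hu]
    exact h.energy_lowProj_le ht hs hv
  have hnorm : ∀ v : E, ‖v - P v‖ ≤ τ * ‖v‖ → (1 - 2 * τ) * ‖v‖ ^ 2 ≤ ‖P v‖ ^ 2 := by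
    intro v hv
    have h1 : (1 - τ) * ‖v‖ ≤ ‖P v‖ := by
      have := norm_sub_norm_le v (P v)
      linarith
    have h2 : ((1 - τ) * ‖v‖) ^ 2 ≤ ‖P v‖ ^ 2 :=
      pow_le_pow_left₀ (mul_nonneg (by linarith) (norm_nonneg v)) h1 2
    have h3 : 0 ≤ τ ^ 2 * ‖v‖ ^ 2 := by positivity
    nlinarith
  have hle : ∀ v : E, (inner ℂ v (H' v)).re ≤ (inner ℂ v (H v)).re :=
    fun v => re_inner_le_of_le (h.truncated_le t) v
  have hPn : ∀ v : E, ‖P v‖ ^ 2 ≤ ‖v‖ ^ 2 := fun v =>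
    pow_le_pow_left₀ (norm_nonneg _) (norm_lowProj_apply_le A B a b t v) 2
  -- at most `f` low eigenvalues
  have hcard1 : (Finset.univ.filter fun i => μ i < e + ε / 2).card ≤ f := by
    by_contra hcon
    obtain ⟨S, hSsub, hScard⟩ := Finset.exists_subset_card_eq (Nat.succ_le_of_lt (not_le.1 hcon))
    have hSμ : ∀ i ∈ S, μ i < e + ε / 2 := fun i hi => (Finset.mem_filter.1 (hSsub hi)).2
    -- Among `f + 1` dimensions some `v` has `P v` orthogonal to the ground space, so its energy is
    -- at least `e + ε` per unit norm squared, too much for a nearly invariant vector of energy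
    -- below `e + ε / 2`.
    obtain ⟨v, hvV, hv0, hvZ⟩ := Submodule.exists_ne_zero_mem_orthogonal (V := IsEigenbasis.spanOf β S)
      (Z := Z) (P : E →ₗ[ℂ] E) (by rw [IsEigenbasis.finrank_spanOf, hScard]; exact Nat.lt_succ_self _)
    have hvP := hnear S hScard.le (fun i hi => by have := hSμ i hi; linarith) v hvV
    have h1 := henergy v hvP
    have h2 := hZ.gap (P v) hvZ
    have h3 := hnorm v hvP
    have h4 : (inner ℂ v (H' v)).re ≤ (e + ε / 2) * ‖v‖ ^ 2 := by
      rw [hβ.re_inner_apply, IsEigenbasis.norm_sq_eq β v, Finset.mul_sum]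
      refine Finset.sum_le_sum fun i _ => ?_
      by_cases hi : i ∈ S
      · have := (hSμ i hi).le; gcongr
      · rw [IsEigenbasis.repr_eq_zero_of_mem β hvV hi]; simp
    have hvpos : 0 < ‖v‖ ^ 2 := by have := norm_pos_iff.2 hv0; positivity
    have h5 : (e - (a + m + b) + ε) * ((1 - 2 * τ) * ‖v‖ ^ 2) ≤
        (e - (a + m + b) + ε) * ‖P v‖ ^ 2 := mul_le_mul_of_nonneg_left h3 (by linarith)
    have h6 : (e - (a + m + b) + ε) * (1 - 2 * τ) * ‖v‖ ^ 2 ≤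
        (e - (a + m + b) + ε / 2 + 2 * u * τ) * ‖v‖ ^ 2 := by nlinarith
    have h7 := le_of_mul_le_mul_right h6 hvpos
    nlinarith
  -- at least `f` eigenvalues below `e`
  set S₀ := Finset.univ.filter fun i => μ i ≤ e with hS₀
  have hcard2 : f ≤ S₀.card := by
    by_contra hcon
    obtain ⟨z, hzZ, hz0, hzS⟩ := Submodule.exists_ne_zero_mem_orthogonal (V := Z)
      (Z := IsEigenbasis.spanOf β S₀) LinearMap.id
      (by rw [IsEigenbasis.finrank_spanOf]; exact not_le.1 hcon)
    have h1 := (IsEigenbasis.mem_orthogonal_iff β).1 hzS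
    simp only [LinearMap.id_apply] at h1
    have h2 := hle z
    rw [hZ.apply_eq z hzZ, re_inner_smul_self, hβ.re_inner_apply, IsEigenbasis.norm_sq_eq β z,
      Finset.mul_sum, ← sub_nonpos, ← Finset.sum_sub_distrib] at h2
    have h3 : ∀ i, 0 ≤ μ i * ‖β.repr z i‖ ^ 2 - e * ‖β.repr z i‖ ^ 2 := by
      intro i
      by_cases hi : i ∈ S₀
      · rw [h1 i hi]; simp
      · have : e < μ i := by simpa [hS₀] using hi
        have : e * ‖β.repr z i‖ ^ 2 ≤ μ i * ‖β.repr z i‖ ^ 2 := by gcongr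
        linarith
    have h4 := (Finset.sum_eq_zero_iff_of_nonneg (fun i _ => h3 i)).1
      (le_antisymm h2 (Finset.sum_nonneg fun i _ => h3 i))
    apply hz0
    have h5 : ∀ i, β.repr z i = 0 := by
      intro i
      by_cases hi : i ∈ S₀
      · exact h1 i hi
      · have h6 : e < μ i := by simpa [hS₀] using hi
        have h7 := h4 i (Finset.mem_univ i)
        rw [← sub_mul] at h7
        rcases mul_eq_zero.1 h7 with h8 | h8
        · linarith
        · simpa using h8
    apply β.repr.injective
    ext i
    simp [h5 i]
  have hsub : S₀ ⊆ Finset.univ.filter fun i => μ i < e + ε / 2 := by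
    intro i hi
    simp only [hS₀, Finset.mem_filter, Finset.mem_univ, true_and] at hi ⊢
    linarith
  have hScard : S₀.card = f := le_antisymm ((Finset.card_le_card hsub).trans hcard1) hcard2
  have hSeq : S₀ = Finset.univ.filter fun i => μ i < e + ε / 2 :=
    Finset.eq_of_subset_of_card_le hsub (by rw [hScard]; exact hcard1)
  have hlo : ∀ i ∉ S₀, e + ε / 2 ≤ μ i := by
    intro i hi
    rw [hSeq] at hi
    simpa using hi
  have hμle : ∀ i, μ i ≤ a + m + b + u := by
    intro i
    have := re_inner_le_mul_norm_sq (h.truncated_le_algebraMap t) (β i)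
    rw [hβ.apply_eq i, re_inner_smul_self, β.norm_eq_one, ← hu] at this
    linarith
  have hSμ : ∀ i ∈ S₀, μ i ≤ e := fun i hi => (Finset.mem_filter.1 hi).2
  have hnear0 := hnear S₀ (by omega) (fun i hi => by have := hSμ i hi; linarith)
  -- Squared mass outside the target space is energy excess over gap. The excess is at most `4 τ + 2
  -- u τ ≤ 4 u τ`; the factor `8` serves the second direction, where only half of the gap is
  -- available.
  set q := 8 * u * τ / ε with hq
  have hq0 : 0 ≤ q := by positivity
  have hqε : q * ε = 8 * u * τ := by rw [hq]; field_simp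
  refine ⟨IsEigenbasis.spanOf β S₀, by rw [IsEigenbasis.finrank_spanOf, hScard],
    ⟨N, β, μ, S₀, hβ, rfl, hSμ, fun i hi => ⟨hlo i hi, hμle i⟩⟩, ?_, ?_⟩
  · intro w hw
    have hwP := hnear0 w hw
    obtain ⟨z, hz, x, hx, hzx⟩ := Submodule.exists_add_mem_mem_orthogonal (K := Z) (P w)
    refine ⟨z, hz, ?_⟩
    have h1 := henergy w hwP
    have h2 := hZ.re_inner_add hz hx
    rw [← hzx] at h2
    have h3 := hnorm w hwP
    have h4 : (inner ℂ w (H' w)).re ≤ e * ‖w‖ ^ 2 := by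
      rw [hβ.re_inner_apply, IsEigenbasis.norm_sq_eq β w, Finset.mul_sum]
      refine Finset.sum_le_sum fun i _ => ?_
      by_cases hi : i ∈ S₀
      · have := hSμ i hi; gcongr
      · rw [IsEigenbasis.repr_eq_zero_of_mem β hw hi]; simp
    have h5 : ε * ‖x‖ ^ 2 ≤ (e - (a + m + b)) * (‖w‖ ^ 2 - ‖P w‖ ^ 2) + 2 * u * τ * ‖w‖ ^ 2 := by
      nlinarith
    have h6 : (e - (a + m + b)) * (‖w‖ ^ 2 - ‖P w‖ ^ 2) ≤ 2 * (2 * τ * ‖w‖ ^ 2) := by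
      have := hPn w
      exact mul_le_mul (by linarith) (by linarith) (by linarith) (by norm_num)
    have h7 : ε * ‖x‖ ^ 2 ≤ ε * (q * ‖w‖ ^ 2) := by
      have : 4 * τ * ‖w‖ ^ 2 ≤ 2 * u * τ * ‖w‖ ^ 2 := by gcongr; linarith
      have h9 : ε * (q * ‖w‖ ^ 2) = 8 * u * τ * ‖w‖ ^ 2 := by rw [← hqε]; ring
      have : 0 ≤ u * τ * ‖w‖ ^ 2 := by positivity
      linarith
    have h8 : ‖x‖ ≤ √q * ‖w‖ := by
      refine (sq_le_sq₀ (by positivity) (by positivity)).1 ?_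
      rw [mul_pow, Real.sq_sqrt hq0]
      exact le_of_mul_le_mul_left h7 hε
    calc ‖w - z‖ = ‖(w - P w) + x‖ := by rw [hzx]; congr 1; abel
      _ ≤ τ * ‖w‖ + √q * ‖w‖ := (norm_add_le _ _).trans (add_le_add hwP h8)
      _ = _ := by ring
  · intro z hz
    obtain ⟨w, hw, y, hy, hwy⟩ := Submodule.exists_add_mem_mem_orthogonal
      (K := IsEigenbasis.spanOf β S₀) z
    refine ⟨w, hw, ?_⟩
    have hwP := hnear0 w hw
    obtain ⟨z', hz', x, hx, hzx⟩ := Submodule.exists_add_mem_mem_orthogonal (K := Z) (P w)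
    have h1 := henergy w hwP
    have h2 := hZ.re_inner_add hz' hx
    rw [← hzx] at h2
    have h3 := hnorm w hwP
    have hrw : ∀ i ∉ S₀, β.repr w i = 0 := fun i hi => IsEigenbasis.repr_eq_zero_of_mem β hw hi
    have hry := (IsEigenbasis.mem_orthogonal_iff β).1 hy
    have h4 : (inner ℂ z (H' z)).re = (inner ℂ w (H' w)).re + (inner ℂ y (H' y)).re := by
      rw [hβ.re_inner_apply, hβ.re_inner_apply, hβ.re_inner_apply, ← Finset.sum_add_distrib]
      refine Finset.sum_congr rfl fun i _ => ?_
      rw [hwy, map_add, PiLp.add_apply]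
      by_cases hi : i ∈ S₀
      · rw [hry i hi]; simp
      · rw [hrw i hi]; simp
    have h5 : (e + ε / 2) * ‖y‖ ^ 2 ≤ (inner ℂ y (H' y)).re := by
      rw [hβ.re_inner_apply, IsEigenbasis.norm_sq_eq β y, Finset.mul_sum]
      refine Finset.sum_le_sum fun i _ => ?_
      by_cases hi : i ∈ S₀
      · rw [hry i hi]; simp
      · have := hlo i hi; gcongr
    have h6 := hle z
    rw [hZ.apply_eq z hz, re_inner_smul_self, h4] at h6
    have h7 : ‖z‖ ^ 2 = ‖w‖ ^ 2 + ‖y‖ ^ 2 := by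
      have h0 : inner ℂ w y = 0 := Submodule.inner_right_of_mem_orthogonal hw hy
      have := norm_add_sq_eq_norm_sq_add_norm_sq_of_inner_eq_zero w y h0
      rw [hwy]; nlinarith
    have h8 : (e - (a + m + b)) * (‖w‖ ^ 2 - ‖P w‖ ^ 2) ≤ 2 * (2 * τ * ‖w‖ ^ 2) := by
      have := hPn w
      exact mul_le_mul (by linarith) (by linarith) (by linarith) (by norm_num)
    have h9 : 0 ≤ ε * ‖x‖ ^ 2 := by positivity
    have h10 : ε * ‖y‖ ^ 2 ≤ ε * (q * ‖z‖ ^ 2) := by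
      have e1 : ε / 2 * ‖y‖ ^ 2 ≤ 4 * τ * ‖w‖ ^ 2 + 2 * u * τ * ‖w‖ ^ 2 := by
        rw [h7] at h6
        linarith
      have e2 : 4 * τ * ‖w‖ ^ 2 ≤ 2 * u * τ * ‖w‖ ^ 2 := by gcongr; linarith
      have e3 : ε * (q * ‖z‖ ^ 2) = 8 * u * τ * ‖z‖ ^ 2 := by rw [← hqε]; ring
      have e4 : u * τ * ‖w‖ ^ 2 ≤ u * τ * ‖z‖ ^ 2 := by
        refine mul_le_mul_of_nonneg_left ?_ (by positivity)
        have : 0 ≤ ‖y‖ ^ 2 := by positivity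
        linarith
      linarith
    have h11 : ‖y‖ ≤ √q * ‖z‖ := by
      refine (sq_le_sq₀ (by positivity) (by positivity)).1 ?_
      rw [mul_pow, Real.sq_sqrt hq0]
      exact le_of_mul_le_mul_left h10 hε
    calc ‖z - w‖ = ‖y‖ := by rw [hwy]; congr 1; abel
      _ ≤ √q * ‖z‖ := h11
      _ ≤ _ := by gcongr; linarith

end IsWindow
end LowSpace

namespace SpinChain
variable {n d : ℕ}

/-- The low eigenvalues of `T` need not coincide, so the polynomial is only at least `1` on them.
That is why `IsGroundProjector` asks for short preimages instead of fixed vectors. -/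
theorem IsSpectralSpace.isGroundProjector {T : Op n d} {W : Submodule ℂ (Space n d)} {e lo hi δ : ℝ}
    (h : IsSpectralSpace T W e lo hi) {p : Polynomial ℝ} {l : ℕ} (hp : p.natDegree ≤ l)
    (hp1 : ∀ x ≤ e, 1 ≤ p.eval x) (hδ : 0 ≤ δ) (hpδ : ∀ x, lo ≤ x → x ≤ hi → |p.eval x| ≤ δ) :
    IsGroundProjector (polyOp p l T) W δ := by
  obtain ⟨N, β, μ, S, hβ, rfl, hS, hS'⟩ := h
  have hK : IsEigenbasis (polyOp p l T) β (fun i => p.eval (μ i)) :=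
    ⟨fun i => polyOp_apply_eigenvector hp (hβ.apply_eq i)⟩
  refine ⟨fun w hw => ?_, fun x hx => ?_, fun x hx => ?_⟩
  · have hr : ∀ i ∉ S, β.repr w i = 0 := fun i hi => IsEigenbasis.repr_eq_zero_of_mem β hw hi
    have hne : ∀ i ∈ S, ((p.eval (μ i) : ℝ) : ℂ) ≠ 0 := fun i hi => by
      have := hp1 _ (hS i hi)
      exact_mod_cast (by linarith : p.eval (μ i) ≠ 0)
    set w' := β.repr.symm (WithLp.toLp 2 fun i => ((p.eval (μ i) : ℝ) : ℂ)⁻¹ * β.repr w i)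
    have hw' : ∀ i, β.repr w' i = ((p.eval (μ i) : ℝ) : ℂ)⁻¹ * β.repr w i := by
      intro i; simp [w']
    refine ⟨w', IsEigenbasis.mem_spanOf β fun i hi => by rw [hw', hr i hi, mul_zero], ?_, ?_⟩
    · apply β.repr.injective
      ext i
      rw [hK.repr_apply, hw']
      by_cases hi : i ∈ S
      · rw [mul_inv_cancel_left₀ (hne i hi)]
      · rw [hr i hi]; simp
    · refine (sq_le_sq₀ (by positivity) (by positivity)).1 ?_
      rw [IsEigenbasis.norm_sq_eq β w', IsEigenbasis.norm_sq_eq β w]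
      refine Finset.sum_le_sum fun i _ => ?_
      rw [hw']
      by_cases hi : i ∈ S
      · have h1 := hp1 _ (hS i hi)
        have h2 : ‖((p.eval (μ i) : ℝ) : ℂ)⁻¹‖ ≤ 1 := by
          rw [norm_inv, Complex.norm_real]
          exact inv_le_one_of_one_le₀ (h1.trans (le_abs_self _))
        rw [norm_mul]
        exact pow_le_pow_left₀ (by positivity) (mul_le_of_le_one_left (norm_nonneg _) h2) 2
      · rw [hr i hi]; simp
  · rw [IsEigenbasis.mem_orthogonal_iff] at hx ⊢
    intro i hi
    rw [hK.repr_apply, hx i hi, mul_zero]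
  · rw [IsEigenbasis.mem_orthogonal_iff] at hx
    refine (sq_le_sq₀ (by positivity) (by positivity)).1 ?_
    rw [mul_pow, IsEigenbasis.norm_sq_eq β x, IsEigenbasis.norm_sq_eq β (polyOp p l T x),
      Finset.mul_sum]
    refine Finset.sum_le_sum fun i _ => ?_
    rw [hK.repr_apply]
    by_cases hi : i ∈ S
    · rw [hx i hi]; simp
    · rw [norm_mul, mul_pow, Complex.norm_real]
      gcongr
      exact hpδ _ (hS' i hi).1 (hS' i hi).2

end SpinChain
end

noncomputable section

/-! ### Bond operators and product eigenvectors. -/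

namespace SpinChain
variable {n d : ℕ}

/-- `bondTerm` as an operator. -/
def bondOp (i j : Fin n) (h : Matrix (Fin d × Fin d) (Fin d × Fin d) ℂ) : Op n d :=
  Matrix.toEuclideanCLM (n := Config n d) (𝕜 := ℂ) (bondTerm i j h)

/-- The configuration `σ` with the spins `i` and `j` replaced by `p`. -/
def replacePair (i j : Fin n) (σ : Config n d) (p : Fin d × Fin d) : Config n d :=
  Function.update (Function.update σ i p.1) j p.2

theorem bondOp_apply {i j : Fin n} (hij : i ≠ j) (h : Matrix (Fin d × Fin d) (Fin d × Fin d) ℂ)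
    (ψ : Space n d) (σ : Config n d) :
    bondOp i j h ψ σ = ∑ p, h (σ i, σ j) p * ψ (replacePair i j σ p) := by
  have h1 : bondOp i j h ψ σ = ∑ τ, bondTerm i j h σ τ * ψ τ := by
    rw [bondOp, Matrix.ofLp_toEuclideanCLM]; rfl
  rw [h1]
  have hinj : Set.InjOn (replacePair i j σ) (Finset.univ : Finset (Fin d × Fin d)) := by
    intro p _ q _ hpq
    have e1 := congrFun hpq i
    have e2 := congrFun hpq j
    simp only [replacePair, Function.update_self, Function.update_of_ne hij] at e1 e2
    exact Prod.ext e1 e2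
  rw [← Finset.sum_subset (Finset.subset_univ (Finset.univ.image (replacePair i j σ))),
    Finset.sum_image hinj]
  · refine Finset.sum_congr rfl fun p _ => ?_
    rw [bondTerm, if_pos]
    · simp [replacePair, Function.update_of_ne hij]
    · intro l hl hl'
      simp [replacePair, hl, hl']
  · intro τ _ hτ
    rw [bondTerm, if_neg, zero_mul]
    intro hall
    apply hτ
    refine Finset.mem_image.2 ⟨(τ i, τ j), Finset.mem_univ _, ?_⟩
    ext1 l
    by_cases hl : l = j
    · subst hl; simp [replacePair]
    · by_cases hl' : l = i
      · subst hl'; simp [replacePair, hl]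
      · simp [replacePair, hl, hl', hall l hl' hl]

theorem bondOp_mul {i j : Fin n} (hij : i ≠ j) (h h' : Matrix (Fin d × Fin d) (Fin d × Fin d) ℂ) :
    bondOp i j (h * h') = bondOp i j h * bondOp i j h' := by
  ext ψ σ
  rw [ContinuousLinearMap.mul_apply_eq, bondOp_apply hij, bondOp_apply hij]
  simp only [bondOp_apply hij, Matrix.mul_apply, Finset.sum_mul, Finset.mul_sum]
  rw [Finset.sum_comm]
  refine Finset.sum_congr rfl fun p _ => Finset.sum_congr rfl fun q _ => ?_
  have e1 : replacePair i j (replacePair i j σ p) q = replacePair i j σ q := by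
    ext1 l
    by_cases hl : l = j
    · subst hl; simp [replacePair]
    · by_cases hl' : l = i
      · subst hl'; simp [replacePair, hl]
      · simp [replacePair, hl, hl']
  rw [e1]
  simp [replacePair, Function.update_of_ne hij, mul_assoc]

theorem bondOp_conjTranspose (i j : Fin n) (h : Matrix (Fin d × Fin d) (Fin d × Fin d) ℂ) :
    bondOp i j hᴴ = star (bondOp i j h) := by
  rw [bondOp, bondOp, ← map_star]
  congr 1
  ext σ τ
  rw [Matrix.star_apply]
  simp only [bondTerm, eq_comm (a := σ _), Matrix.conjTranspose_apply]
  split_ifs <;> simp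

theorem bondOp_one {i j : Fin n} (hij : i ≠ j) : bondOp i j (1 : Matrix _ _ ℂ) = (1 : Op n d) := by
  ext ψ σ
  rw [bondOp_apply hij, Finset.sum_eq_single (σ i, σ j)]
  · simp [replacePair]
  · intro p _ hp
    rw [Matrix.one_apply_ne hp.symm, zero_mul]
  · simp

theorem bondOp_sub {i j : Fin n} (hij : i ≠ j)
    (h h' : Matrix (Fin d × Fin d) (Fin d × Fin d) ℂ) :
    bondOp i j (h - h') = bondOp i j h - bondOp i j h' := by
  ext ψ σ
  rw [sub_apply, PiLp.sub_apply, bondOp_apply hij, bondOp_apply hij, bondOp_apply hij]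
  simp [sub_mul]

open scoped MatrixOrder in
-- The embedding of a bond respects products and adjoints, so it preserves the form `star B * B`.
theorem bondOp_nonneg {i j : Fin n} (hij : i ≠ j) {h : Matrix (Fin d × Fin d) (Fin d × Fin d) ℂ}
    (hh : h.PosSemidef) : 0 ≤ bondOp i j h := by
  obtain ⟨B, rfl⟩ := CStarAlgebra.nonneg_iff_eq_star_mul_self.mp hh.nonneg
  rw [Matrix.star_eq_conjTranspose, bondOp_mul hij, bondOp_conjTranspose]
  exact star_mul_self_nonneg _

theorem bondOp_le_one {i j : Fin n} (hij : i ≠ j) {h : Matrix (Fin d × Fin d) (Fin d × Fin d) ℂ}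
    (hh : (1 - h).PosSemidef) : bondOp i j h ≤ 1 := by
  have := bondOp_nonneg hij hh
  rwa [bondOp_sub hij, bondOp_one hij, sub_nonneg] at this

theorem bondOp_mem_leftAlg {i j : Fin n} (hij : i ≠ j)
    (h : Matrix (Fin d × Fin d) (Fin d × Fin d) ℂ) {k : ℕ} (hi : i.1 < k) (hj : j.1 < k) :
    bondOp i j h ∈ leftAlg n d k := by
  rw [mem_leftAlg]
  intro b ψ σ
  rw [bondOp_apply hij, bondOp_apply hij]
  refine Finset.sum_congr rfl fun p _ => ?_
  have e1 : splice k (replacePair i j σ p) b = replacePair i j (splice k σ b) p := by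
    ext1 l
    by_cases hl : l = j
    · subst hl; simp [replacePair, splice, hj]
    · by_cases hl' : l = i
      · subst hl'; simp [replacePair, hl, splice, hi]
      · simp [replacePair, hl, hl', splice]
  rw [pullback_apply, e1]
  simp [splice, hi, hj]

theorem bondOp_mem_rightAlg {i j : Fin n} (hij : i ≠ j)
    (h : Matrix (Fin d × Fin d) (Fin d × Fin d) ℂ) {k : ℕ} (hi : k ≤ i.1) (hj : k ≤ j.1) :
    bondOp i j h ∈ rightAlg n d k := by
  rw [mem_rightAlg]
  intro a ψ
  ext σ
  rw [pullback_apply, bondOp_apply hij, bondOp_apply hij]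
  refine Finset.sum_congr rfl fun p _ => ?_
  have e1 : splice k a (replacePair i j σ p) = replacePair i j (splice k a σ) p := by
    ext1 l
    by_cases hl : l = j
    · subst hl; simp [replacePair, splice, hj.not_gt]
    · by_cases hl' : l = i
      · subst hl'; simp [replacePair, hl, splice, hi.not_gt]
      · simp [replacePair, hl, hl', splice]
  rw [pullback_apply, e1]
  simp [splice, hi.not_gt, hj.not_gt]

/-- A family of nearest-neighbour interactions between `0` and `1`, where `X i` acts on the sites `i`
and `i + 1`. -/
structure IsChain (X : ℕ → Op n d) : Prop where
  nonneg : ∀ i, 0 ≤ X i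
  le_one : ∀ i, X i ≤ 1
  mem_left : ∀ i k, i + 2 ≤ k → X i ∈ leftAlg n d k
  mem_right : ∀ i k, k ≤ i → X i ∈ rightAlg n d k
  eq_zero : ∀ i, n ≤ i + 1 → X i = 0

/-- The interactions of a Hamiltonian. -/
def bonds (h : Fin (n - 1) → Matrix (Fin d × Fin d) (Fin d × Fin d) ℂ) (i : ℕ) : Op n d :=
  if hi : i < n - 1 then bondOp ⟨i, by omega⟩ ⟨i + 1, by omega⟩ (h ⟨i, hi⟩) else 0

theorem isChain_bonds {h : Fin (n - 1) → Matrix (Fin d × Fin d) (Fin d × Fin d) ℂ}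
    (h0 : ∀ i, (h i).PosSemidef) (h1 : ∀ i, (1 - h i).PosSemidef) : IsChain (bonds h) where
  nonneg i := by
    unfold bonds; split_ifs with hi
    · exact bondOp_nonneg (by simp) (h0 _)
    · exact le_rfl
  le_one i := by
    unfold bonds; split_ifs with hi
    · exact bondOp_le_one (by simp) (h1 _)
    · exact zero_le_one
  mem_left i k hk := by
    unfold bonds; split_ifs with hi
    · exact bondOp_mem_leftAlg (by simp) _ (by simp; omega) (by simp; omega)
    · exact Subalgebra.zero_mem _
  mem_right i k hk := by
    unfold bonds; split_ifs with hi
    · exact bondOp_mem_rightAlg (by simp) _ (by simp; omega) (by simp; omega)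
    · exact Subalgebra.zero_mem _
  eq_zero i hi := by
    unfold bonds; rw [dif_neg (by omega)]

theorem toEuclideanCLM_hamiltonian (h : Fin (n - 1) → Matrix (Fin d × Fin d) (Fin d × Fin d) ℂ) :
    Matrix.toEuclideanCLM (n := Config n d) (𝕜 := ℂ) (hamiltonian h) =
      ∑ i ∈ Finset.range (n - 1), bonds h i := by
  rw [hamiltonian, map_sum, Finset.sum_range]
  refine Finset.sum_congr rfl fun i _ => ?_
  rw [bonds, dif_pos i.2]; rfl

/-- Bonds beyond the end vanish, so a window may overhang the chain on the right. -/
theorem IsChain.sum_range {X : ℕ → Op n d} (hX : IsChain X) {N : ℕ} (hN : n - 1 ≤ N) :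
    ∑ i ∈ Finset.range N, X i = ∑ i ∈ Finset.range (n - 1), X i := by
  symm
  refine Finset.sum_subset (Finset.range_subset_range.2 hN) fun i _ hi => hX.eq_zero i ?_
  simp at hi; omega

/-- Multiplication by a function of the configuration. -/
def diagOp (g : Config n d → ℂ) : Op n d :=
  LinearMap.toContinuousLinearMap
    { toFun := fun ψ => WithLp.toLp 2 fun σ => g σ * ψ σ
      map_add' := fun ψ φ => by ext σ; simp [mul_add]
      map_smul' := fun c ψ => by ext σ; simp [mul_left_comm] }

@[simp]
theorem diagOp_apply (g : Config n d → ℂ) (ψ : Space n d) (σ : Config n d) :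
    diagOp g ψ σ = g σ * ψ σ := rfl

theorem diagOp_mem_leftAlg {g : Config n d → ℂ} {k : ℕ} (hg : ∀ σ b, g (splice k σ b) = g σ) :
    diagOp g ∈ leftAlg n d k := by
  rw [mem_leftAlg]
  intro b ψ σ
  simp [hg]

theorem diagOp_mem_rightAlg {g : Config n d → ℂ} {k : ℕ} (hg : ∀ a σ, g (splice k a σ) = g σ) :
    diagOp g ∈ rightAlg n d k := by
  rw [mem_rightAlg]
  intro a ψ
  ext σ
  simp [hg]

theorem exists_apply_ne_zero {v : Space n d} (hv : v ≠ 0) : ∃ σ, v σ ≠ 0 := by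
  by_contra h
  push Not at h
  exact hv (by ext σ; exact h σ)

/-- Fixing the right spins of `v` and the left spins of `w` gives eigenvectors depending on one side
only; their pointwise product is the tensor product. Multiplication by either factor commutes with
the operator on the other side. -/
theorem exists_joint_eigenvector {k : ℕ} {A B : Op n d} (hA : A ∈ leftAlg n d k)
    (hB : B ∈ rightAlg n d k) {v w : Space n d} {α β : ℂ} (hv : v ≠ 0) (hw : w ≠ 0)
    (hAv : A v = α • v) (hBw : B w = β • w) : ∃ u : Space n d, u ≠ 0 ∧ A u = α • u ∧ B u = β • u := by
  obtain ⟨b, hb⟩ := exists_apply_ne_zero hv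
  obtain ⟨a, ha⟩ := exists_apply_ne_zero hw
  set v0 := pullback (fun τ => splice k τ b) v with hv0
  set w0 := pullback (splice k a) w with hw0
  have hAv0 : A v0 = α • v0 := by
    ext σ
    rw [hv0, (mem_leftAlg.1 hA), hAv]
    simp
  have hBw0 : B w0 = β • w0 := by
    rw [hw0, mem_rightAlg.1 hB, hBw, map_smul]
  have hDw : diagOp w0 ∈ rightAlg n d k := diagOp_mem_rightAlg fun a' σ => by
    simp only [hw0, pullback_apply]
    refine congrArg w.ofLp (funext fun i => ?_); simp only [splice]; split_ifs <;> rfl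
  have hDv : diagOp v0 ∈ leftAlg n d k := diagOp_mem_leftAlg fun σ b' => by
    simp only [hv0, pullback_apply]
    refine congrArg v.ofLp (funext fun i => ?_); simp only [splice]; split_ifs <;> rfl
  have e1 : diagOp v0 w0 = diagOp w0 v0 := by ext σ; simp [mul_comm]
  refine ⟨diagOp w0 v0, ?_, ?_, ?_⟩
  · intro h0
    have := congrArg (fun x : Space n d => x (splice k b a)) h0
    simp only [diagOp_apply, hv0, hw0, pullback_apply] at this
    have s1 : splice k (splice k b a) b = b := by ext i; simp only [splice]; split_ifs <;> rfl
    have s2 : splice k a (splice k b a) = a := by ext i; simp only [splice]; split_ifs <;> rfl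
    rw [s1, s2] at this
    exact (mul_ne_zero ha hb) this
  · rw [← ContinuousLinearMap.mul_apply_eq, (commute_of_left_right hA hDw).eq,
      ContinuousLinearMap.mul_apply_eq, hAv0, map_smul]
  · rw [← e1, ← ContinuousLinearMap.mul_apply_eq, ← (commute_of_left_right hDv hB).eq,
      ContinuousLinearMap.mul_apply_eq, hBw0, map_smul]

end SpinChain

section LowestEigenvalue
variable {E : Type*} [NormedAddCommGroup E] [InnerProductSpace ℂ E] [FiniteDimensional ℂ E]

theorem algebraMap_le_of_mul_norm_sq_le {T : E →L[ℂ] E} (hT : IsSelfAdjoint T) {c : ℝ}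
    (h : ∀ x, c * ‖x‖ ^ 2 ≤ (inner ℂ x (T x)).re) : algebraMap ℝ (E →L[ℂ] E) c ≤ T := by
  rw [ContinuousLinearMap.le_def, ContinuousLinearMap.isPositive_def']
  refine ⟨hT.sub (IsSelfAdjoint.algebraMap (E →L[ℂ] E) (IsSelfAdjoint.all c)), fun x => ?_⟩
  rw [ContinuousLinearMap.reApplyInnerSelf_apply, sub_apply, inner_sub_left, map_sub,
    algebraMap_real_apply, hT.inner_left_eq]
  have := h x
  have e : RCLike.re (inner ℂ ((c : ℂ) • x) x) = c * ‖x‖ ^ 2 := by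
    rw [inner_re_symm]; exact re_inner_smul_self c x
  rw [e]
  exact sub_nonneg.2 this

theorem exists_lowest_eigenvector [Nontrivial E] {T : E →L[ℂ] E} (hT : IsSelfAdjoint T) :
    ∃ (c : ℝ) (v : E), v ≠ 0 ∧ T v = (c : ℂ) • v ∧ algebraMap ℝ (E →L[ℂ] E) c ≤ T := by
  obtain ⟨b, μ, hb⟩ := exists_isEigenbasis hT
  have : NeZero (Module.finrank ℂ E) := ⟨Module.finrank_pos.ne'⟩
  obtain ⟨i, hi⟩ := Finite.exists_min μ
  refine ⟨μ i, b i, b.orthonormal.ne_zero i, hb.apply_eq i, algebraMap_le_of_mul_norm_sq_le hT fun x => ?_⟩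
  rw [hb.re_inner_apply, IsEigenbasis.norm_sq_eq b x, Finset.mul_sum]
  exact Finset.sum_le_sum fun j _ => by have := hi j; gcongr

end LowestEigenvalue
end

noncomputable section

/-! ### Windows of the chain. -/

namespace SpinChain
variable {n d : ℕ}

namespace IsChain
variable {X : ℕ → Op n d}

theorem commute (hX : IsChain X) {i j : ℕ} (h : i + 2 ≤ j) : Commute (X i) (X j) :=
  commute_of_left_right (hX.mem_left i j h) (hX.mem_right j j le_rfl)

theorem norm_le_one (hX : IsChain X) (i : ℕ) : ‖X i‖ ≤ 1 :=
  (CStarAlgebra.norm_le_one_iff_of_nonneg _ (hX.nonneg i)).2 (hX.le_one i)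

theorem norm_conj_le (Z : ℕ → Op n d) (hn : ∀ i, ‖Z i‖ ≤ 1)
    (hc : ∀ i j, i + 2 ≤ j → Commute (Z i) (Z j)) (m : ℕ) :
    ‖NormedSpace.exp ((4⁻¹ : ℂ) • ∑ i ∈ Finset.range m, Z (1 + i)) * Z 0 *
      NormedSpace.exp (-((4⁻¹ : ℂ) • ∑ i ∈ Finset.range m, Z (1 + i)))‖ ≤ 2 := by
  have h : ∀ j, ‖(commutatorCLM (∑ i ∈ Finset.range m, Z (1 + i)) ^ j) (Z 0)‖ ≤
      2 ^ j * j.factorial := by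
    intro j
    have := norm_commutatorCLM_pow_le Z hn hc (m + 1) j
    rwa [Finset.sum_Ico_eq_sum_range] at this
  exact norm_exp_mul_mul_exp_neg_le _ _ h

/-- The bonds left of a window of the chain. -/
def leftPart (X : ℕ → Op n d) (b : ℕ) : Op n d := ∑ i ∈ Finset.range b, X i

/-- The `s` bonds from `b` on. -/
def midPart (X : ℕ → Op n d) (b s : ℕ) : Op n d := ∑ i : Fin s, X (b + i)

/-- The bonds from `b` on. -/
def rightPart (X : ℕ → Op n d) (b : ℕ) : Op n d := ∑ i ∈ Finset.range n, X (b + i)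

theorem sum_eq_parts (hX : IsChain X) (b s : ℕ) :
    ∑ i ∈ Finset.range (n - 1), X i = leftPart X b + X b + midPart X (b + 1) s + X (b + 1 + s) +
      rightPart X (b + s + 2) := by
  rw [← hX.sum_range (N := b + 1 + s + 1 + n) (by omega), Finset.sum_range_add,
    Finset.sum_range_succ, Finset.sum_range_add, Finset.sum_range_succ, midPart,
    Fin.sum_univ_eq_sum_range (fun i => X (b + 1 + i)), show b + 1 + s + 1 = b + s + 2 by omega]
  rfl

theorem leftPart_mem (hX : IsChain X) {b k : ℕ} (h : b + 1 ≤ k) : leftPart X b ∈ leftAlg n d k :=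
  Subalgebra.sum_mem _ fun i hi => hX.mem_left i k (by have := Finset.mem_range.1 hi; omega)

theorem rightPart_mem (hX : IsChain X) {b k : ℕ} (h : k ≤ b) : rightPart X b ∈ rightAlg n d k :=
  Subalgebra.sum_mem _ fun _ _ => hX.mem_right _ k (by omega)

theorem midPart_mem_left (hX : IsChain X) {b s k : ℕ} (h : b + s + 1 ≤ k) :
    midPart X b s ∈ leftAlg n d k :=
  Subalgebra.sum_mem _ fun _ _ => hX.mem_left _ k (by omega)

theorem midPart_mem_right (hX : IsChain X) {b s k : ℕ} (h : k ≤ b) :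
    midPart X b s ∈ rightAlg n d k :=
  Subalgebra.sum_mem _ fun _ _ => hX.mem_right _ k (by omega)

theorem midPart_le (hX : IsChain X) (b s : ℕ) : midPart X b s ≤ algebraMap ℝ (Op n d) s := by
  calc midPart X b s ≤ ∑ _i : Fin s, (1 : Op n d) := Finset.sum_le_sum fun _ _ => hX.le_one _
    _ = algebraMap ℝ (Op n d) s := by simp

theorem midPart_nonneg (hX : IsChain X) (b s : ℕ) : 0 ≤ midPart X b s :=
  Finset.sum_nonneg fun _ _ => hX.nonneg _

theorem exists_isWindow [Nontrivial (Space n d)] (hX : IsChain X) (b s : ℕ) :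
    ∃ a₁ m a₂ : ℝ, IsWindow (leftPart X b) (X b) (midPart X (b + 1) s) (X (b + 1 + s))
      (rightPart X (b + s + 2)) a₁ m a₂ s ∧
      ∃ u : Space n d, u ≠ 0 ∧ (leftPart X b + midPart X (b + 1) s + rightPart X (b + s + 2)) u =
        ((a₁ + m + a₂ : ℝ) : ℂ) • u := by
  obtain ⟨a₁, v₁, hv₁, hA, ha₁⟩ := exists_lowest_eigenvector (T := leftPart X b)
    (IsSelfAdjoint.of_nonneg (Finset.sum_nonneg fun i _ => hX.nonneg _))
  obtain ⟨m, v₂, hv₂, hM, hm⟩ := exists_lowest_eigenvector (T := midPart X (b + 1) s)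
    (IsSelfAdjoint.of_nonneg (hX.midPart_nonneg _ _))
  obtain ⟨a₂, v₃, hv₃, hB, ha₂⟩ := exists_lowest_eigenvector (T := rightPart X (b + s + 2))
    (IsSelfAdjoint.of_nonneg (Finset.sum_nonneg fun i _ => hX.nonneg _))
  have hm0 : 0 ≤ m := by
    have h1 := re_inner_le_of_le (hX.midPart_nonneg (b + 1) s) v₂
    rw [hM, re_inner_smul_self] at h1
    simp only [zero_apply, inner_zero_right, Complex.zero_re] at h1
    have h2 : 0 < ‖v₂‖ ^ 2 := by have := norm_pos_iff.2 hv₂; positivity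
    exact nonneg_of_mul_nonneg_left h1 h2
  refine ⟨a₁, m, a₂, ?_, ?_⟩
  · constructor
    · exact IsSelfAdjoint.of_nonneg (Finset.sum_nonneg fun i _ => hX.nonneg _)
    · exact IsSelfAdjoint.of_nonneg (Finset.sum_nonneg fun i _ => hX.nonneg _)
    · exact commute_of_left_right (hX.leftPart_mem le_rfl) (hX.rightPart_mem (by omega))
    · exact commute_of_left_right (hX.leftPart_mem le_rfl) (hX.midPart_mem_right le_rfl)
    · exact commute_of_left_right (hX.leftPart_mem le_rfl) (hX.mem_right _ _ (by omega))
    · exact (commute_of_left_right (hX.midPart_mem_left (by omega))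
        (hX.rightPart_mem le_rfl)).symm
    · exact (commute_of_left_right (hX.mem_left b (b + s + 2) (by omega))
        (hX.rightPart_mem le_rfl)).symm
    · exact ha₁
    · exact ha₂
    · exact hm
    · rw [map_add]
      refine (hX.midPart_le _ _).trans (le_add_of_nonneg_left ?_)
      rw [← map_zero (algebraMap ℝ (Op n d))]
      exact algebraMap_mono _ hm0
    · exact hX.nonneg _
    · exact hX.le_one _
    · exact hX.nonneg _
    · exact hX.le_one _
    -- On the left the bonds are numbered outwards, from the boundary bond `b` down to `0`, and
    -- padded by zero.
    · have h1 := norm_conj_le (fun q => if q ≤ b then X (b - q) else 0) (fun i => by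
        split_ifs
        · exact hX.norm_le_one _
        · simp) (fun i j hij => by
          split_ifs with h1 h2
          · exact (hX.commute (by omega)).symm
          · exact Commute.zero_right _
          · exact Commute.zero_left _
          · exact Commute.zero_left _) b
      have h2 : ∑ i ∈ Finset.range b, (if 1 + i ≤ b then X (b - (1 + i)) else 0) = leftPart X b := by
        rw [leftPart, ← Finset.sum_range_reflect]
        refine Finset.sum_congr rfl fun i hi => ?_
        have := Finset.mem_range.1 hi
        rw [if_pos (by omega)]; congr 1; omega
      simpa [h2] using h1
    · have h1 := norm_conj_le (fun q => X (b + 1 + s + q)) (fun i => hX.norm_le_one _)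
        (fun i j hij => hX.commute (by omega)) n
      have h2 : ∑ i ∈ Finset.range n, X (b + 1 + s + (1 + i)) = rightPart X (b + s + 2) := by
        rw [rightPart]
        refine Finset.sum_congr rfl fun i hi => ?_
        congr 1; omega
      simpa [h2] using h1
  · obtain ⟨u, hu, hu1, hu2⟩ := exists_joint_eigenvector (hX.leftPart_mem (b := b) le_rfl)
      (hX.midPart_mem_right (b := b + 1) (s := s) le_rfl) hv₁ hv₂ hA hM
    obtain ⟨w, hw, hw1, hw2⟩ := exists_joint_eigenvector (k := b + s + 2)
      (A := leftPart X b + midPart X (b + 1) s) (α := (a₁ + m : ℝ))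
      (Subalgebra.add_mem _ (hX.leftPart_mem (by omega)) (hX.midPart_mem_left (by omega)))
      (hX.rightPart_mem le_rfl) hu hv₃ (by rw [add_apply, hu1, hu2, ← add_smul]; push_cast; rfl) hB
    refine ⟨w, hw, ?_⟩
    rw [add_apply, hw1, hw2, ← add_smul]; push_cast; rfl

end IsChain
end SpinChain

theorem IsGapSpace.mul_norm_sq_le {E : Type*} [NormedAddCommGroup E] [InnerProductSpace ℂ E]
    [FiniteDimensional ℂ E] {H : E →L[ℂ] E} {Z : Submodule ℂ E} {e ε : ℝ}
    (h : IsGapSpace H Z e ε) (hε : 0 ≤ ε) (x : E) : e * ‖x‖ ^ 2 ≤ (inner ℂ x (H x)).re := by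
  obtain ⟨z, hz, y, hy, rfl⟩ := Submodule.exists_add_mem_mem_orthogonal (K := Z) x
  have := h.re_inner_add hz hy
  have : 0 ≤ ε * ‖y‖ ^ 2 := by positivity
  linarith

theorem IsGapSpace.mono {E : Type*} [NormedAddCommGroup E] [InnerProductSpace ℂ E]
    {H : E →L[ℂ] E} {Z : Submodule ℂ E} {e ε ε' : ℝ}
    (h : IsGapSpace H Z e ε) (hε : ε' ≤ ε) : IsGapSpace H Z e ε' where
  selfAdjoint := h.selfAdjoint
  apply_eq := h.apply_eq
  gap x hx := le_trans (by gcongr) (h.gap x hx)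

namespace SpinChain
variable {n d : ℕ}

/-- Both sides of the cut and the window contribute their lowest energies to the ground energy. -/
theorem IsChain.exists_isWindow_energy {X : ℕ → Op n d} (hX : IsChain X) {Z : Submodule ℂ (Space n d)}
    {e ε : ℝ} (hZ : IsGapSpace (∑ i ∈ Finset.range (n - 1), X i) Z e ε) (hε : 0 ≤ ε)
    (hZ0 : 0 < Module.finrank ℂ Z) (b s : ℕ) :
    ∃ a₁ m a₂ : ℝ, IsWindow (IsChain.leftPart X b) (X b) (IsChain.midPart X (b + 1) s)
      (X (b + 1 + s)) (IsChain.rightPart X (b + s + 2)) a₁ m a₂ s ∧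
      a₁ + m + a₂ ≤ e ∧ e ≤ a₁ + m + a₂ + 2 := by
  have hne : Nontrivial Z := Module.finrank_pos_iff.1 hZ0
  have : Nontrivial (Space n d) := Function.Injective.nontrivial Z.injective_subtype
  obtain ⟨a₁, m, a₂, hW, u, hu, hu'⟩ := hX.exists_isWindow b s
  refine ⟨a₁, m, a₂, hW, ?_, ?_⟩
  · obtain ⟨z, hz⟩ := exists_ne (0 : Z)
    have hz0 : 0 < ‖(z : Space n d)‖ ^ 2 := by
      have : 0 < ‖(z : Space n d)‖ := norm_pos_iff.2 (by simpa using hz)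
      positivity
    have h1 : algebraMap ℝ (Op n d) (a₁ + m + a₂) ≤ ∑ i ∈ Finset.range (n - 1), X i := by
      rw [hX.sum_eq_parts b s]
      have e : algebraMap ℝ (Op n d) (a₁ + m + a₂) =
          algebraMap ℝ _ a₁ + 0 + algebraMap ℝ _ m + 0 + algebraMap ℝ _ a₂ := by
        simp [map_add]
      rw [e]
      exact add_le_add (add_le_add (add_le_add (add_le_add hW.le_left (hX.nonneg _)) hW.le_mid)
        (hX.nonneg _)) hW.le_right
    have h2 := mul_norm_sq_le_re_inner h1 (z : Space n d)
    rw [hZ.apply_eq z z.2, re_inner_smul_self] at h2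
    exact le_of_mul_le_mul_right h2 hz0
  -- The joint lowest eigenvector of the three decoupled parts is a trial state; each boundary bond
  -- adds at most `1`.
  · have h1 := hZ.mul_norm_sq_le hε u
    have hu0 : 0 < ‖u‖ ^ 2 := by have := norm_pos_iff.2 hu; positivity
    have h2 : ∑ i ∈ Finset.range (n - 1), X i ≤ IsChain.leftPart X b + IsChain.midPart X (b + 1) s +
        IsChain.rightPart X (b + s + 2) + algebraMap ℝ (Op n d) 2 := by
      rw [hX.sum_eq_parts b s]
      have e : algebraMap ℝ (Op n d) 2 = 1 + 1 := by
        rw [map_ofNat]; norm_num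
      rw [e]
      calc _ = IsChain.leftPart X b + IsChain.midPart X (b + 1) s +
        IsChain.rightPart X (b + s + 2) + (X b + X (b + 1 + s)) := by abel
        _ ≤ _ := by gcongr; exact hX.le_one _; exact hX.le_one _
    have h3 := h1.trans (re_inner_le_of_le h2 u)
    rw [add_apply, hu', inner_add_right, Complex.add_re, algebraMap_real_apply, re_inner_smul_self,
      re_inner_smul_self, ← add_mul] at h3
    exact le_of_mul_le_mul_right h3 hu0

end SpinChain
end

noncomputable section

/-! ### Elementary consequences of a spectral gap. -/

namespace SpinChain
variable {n d : ℕ}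

theorem mem_energySpace {H : Matrix (Config n d) (Config n d) ℂ} {E : ℝ} {ψ : Space n d} :
    ψ ∈ energySpace H E ↔
      Matrix.toEuclideanCLM (n := Config n d) (𝕜 := ℂ) H ψ = (E : ℂ) • ψ := by
  rw [energySpace, Module.End.mem_eigenspace_iff, ← Matrix.coe_toEuclideanCLM_eq_toEuclideanLin]
  rfl

theorem mem_energies {H : Matrix (Config n d) (Config n d) ℂ} {E : ℝ} :
    E ∈ energies H ↔ ∃ ψ : Space n d, ψ ≠ 0 ∧
      Matrix.toEuclideanCLM (n := Config n d) (𝕜 := ℂ) H ψ = (E : ℂ) • ψ := by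
  constructor
  · intro h
    obtain ⟨ψ, h1, h2⟩ := Module.End.HasEigenvalue.exists_hasEigenvector h
    exact ⟨ψ, h2, mem_energySpace.1 h1⟩
  · rintro ⟨ψ, h1, h2⟩
    exact Module.End.hasEigenvalue_of_hasEigenvector ⟨mem_energySpace.2 h2, h1⟩

namespace IsGapped
variable {h : Fin (n - 1) → Matrix (Fin d × Fin d) (Fin d × Fin d) ℂ} {f : ℕ} {E₀ ε : ℝ}

theorem isChain (hg : IsGapped h f E₀ ε) : IsChain (bonds h) := isChain_bonds hg.nonneg hg.le_one

theorem pos (hg : IsGapped h f E₀ ε) : 0 < ε := by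
  have h1 := hg.ground.2 hg.gap.1.1
  have h2 : E₀ + ε ≠ E₀ := hg.gap.1.2
  rcases (by linarith : 0 ≤ ε).lt_or_eq with h3 | h3
  · exact h3
  · exact absurd (by linarith) h2

theorem isGapSpace (hg : IsGapped h f E₀ ε) :
    IsGapSpace (∑ i ∈ Finset.range (n - 1), bonds h i) (energySpace (hamiltonian h) E₀) E₀ ε := by
  have hsa : IsSelfAdjoint (∑ i ∈ Finset.range (n - 1), bonds h i) :=
    IsSelfAdjoint.of_nonneg (Finset.sum_nonneg fun _ _ => hg.isChain.nonneg _)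
  refine ⟨fun x y => hsa.inner_left_eq x y, fun z hz => ?_, fun x hx => ?_⟩
  · rw [← toEuclideanCLM_hamiltonian]
    exact mem_energySpace.1 hz
  · obtain ⟨b, μ, hb⟩ := exists_isEigenbasis hsa
    rw [hb.re_inner_apply, IsEigenbasis.norm_sq_eq b x, Finset.mul_sum]
    refine Finset.sum_le_sum fun i _ => ?_
    have hi := hb.apply_eq i
    rw [← toEuclideanCLM_hamiltonian] at hi
    by_cases hE : μ i = E₀
    · have : b.repr x i = 0 := by
        rw [b.repr_apply_apply]
        exact Submodule.inner_right_of_mem_orthogonal (mem_energySpace.2 (hE ▸ hi)) hx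
      rw [this]; simp
    · have := hg.gap.2 ⟨mem_energies.2 ⟨b i, b.orthonormal.ne_zero i, hi⟩, hE⟩
      gcongr

theorem finrank_pos (hg : IsGapped h f E₀ ε) : 0 < f := by
  obtain ⟨ψ, h1, h2⟩ := mem_energies.1 hg.ground.1
  rw [← hg.degeneracy]
  have : Nontrivial (energySpace (hamiltonian h) E₀) :=
    ⟨⟨⟨ψ, mem_energySpace.2 h2⟩, 0, by simpa using h1⟩⟩
  exact Module.finrank_pos

theorem two_le_dim (hg : IsGapped h f E₀ ε) : 2 ≤ d := by
  by_contra hd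
  obtain ⟨ψ, h1, h2⟩ := mem_energies.1 hg.ground.1
  obtain ⟨φ, h3, h4⟩ := mem_energies.1 hg.gap.1.1
  have : Subsingleton (Fin d) := ⟨fun a b => by ext; omega⟩
  obtain ⟨σ, hσ⟩ := exists_apply_ne_zero h1
  have e : φ = (φ σ / ψ σ) • ψ := by
    ext τ
    rw [Subsingleton.elim τ σ, PiLp.smul_apply, smul_eq_mul, div_mul_cancel₀ _ hσ]
  have e2 : Matrix.toEuclideanCLM (n := Config n d) (𝕜 := ℂ) (hamiltonian h) φ = (E₀ : ℂ) • φ := by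
    rw [e, map_smul, h2, smul_comm]
  rw [h4] at e2
  have := smul_left_injective ℂ h3 e2
  exact hg.gap.1.2 (by exact_mod_cast this)

theorem two_le_length (hg : IsGapped h f E₀ ε) : 2 ≤ n := by
  by_contra hn
  have h0 : Matrix.toEuclideanCLM (n := Config n d) (𝕜 := ℂ) (hamiltonian h) = 0 := by
    rw [toEuclideanCLM_hamiltonian, show n - 1 = 0 by omega]; simp
  have hz : ∀ E ∈ energies (hamiltonian h), E = 0 := by
    intro E hE
    obtain ⟨ψ, h1, h2⟩ := mem_energies.1 hE
    rw [h0] at h2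
    have : (E : ℂ) • ψ = 0 := h2.symm
    simpa [h1] using this
  exact hg.gap.1.2 ((hz _ hg.gap.1.1).trans (hz _ hg.ground.1).symm)

theorem norm_sq_bound_of_lt (hg : IsGapped h f E₀ ε) {V : Submodule ℂ (Space n d)}
    (hV : f < Module.finrank ℂ V) {c : ℝ}
    (hc : ∀ v ∈ V, (inner ℂ v ((∑ i ∈ Finset.range (n - 1), bonds h i) v)).re ≤ c * ‖v‖ ^ 2) :
    E₀ + ε ≤ c := by
  obtain ⟨v, hv, hv0, hvZ⟩ := Submodule.exists_ne_zero_mem_orthogonal (V := V)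
    (Z := energySpace (hamiltonian h) E₀) LinearMap.id (by rwa [hg.degeneracy])
  have h1 := (hg.isGapSpace.gap v hvZ).trans (hc v hv)
  exact le_of_mul_le_mul_right h1 (by have := norm_pos_iff.2 hv0; positivity)

/-- The gap is bounded in terms of the degeneracy. -/
theorem gap_le (hg : IsGapped h f E₀ ε) : ε ≤ f := by
  have hX := hg.isChain
  have hd := hg.two_le_dim
  obtain ⟨ψ, hψ, hψ'⟩ := mem_energies.1 hg.ground.1
  have hψ0 : 0 < ‖ψ‖ ^ 2 := by have := norm_pos_iff.2 hψ; positivity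
  rw [toEuclideanCLM_hamiltonian] at hψ'
  have hsum_le : ∀ S : Finset ℕ, ∑ i ∈ S, bonds h i ≤ algebraMap ℝ (Op n d) S.card := fun S => by
    calc ∑ i ∈ S, bonds h i ≤ ∑ _i ∈ S, (1 : Op n d) := Finset.sum_le_sum fun _ _ => hX.le_one _
      _ = algebraMap ℝ (Op n d) S.card := by simp
  rcases le_or_gt n f with hn | hn
  · have hE0 : 0 ≤ E₀ := by
      have h1 := re_inner_le_of_le
        (Finset.sum_nonneg fun i (_ : i ∈ Finset.range (n - 1)) => hX.nonneg i) ψ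
      rw [hψ', re_inner_smul_self] at h1
      simp only [zero_apply, inner_zero_right, Complex.zero_re] at h1
      exact nonneg_of_mul_nonneg_left h1 hψ0
    obtain ⟨φ, hφ, hφ'⟩ := mem_energies.1 hg.gap.1.1
    rw [toEuclideanCLM_hamiltonian] at hφ'
    have h1 := re_inner_le_mul_norm_sq (hsum_le (Finset.range (n - 1))) φ
    rw [hφ', re_inner_smul_self, Finset.card_range] at h1
    have h2 := le_of_mul_le_mul_right h1 (by have := norm_pos_iff.2 hφ; positivity)
    have h3 : ((n - 1 : ℕ) : ℝ) ≤ f := by exact_mod_cast (by omega)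
    linarith
  -- On a longer chain, put the bonds from `f` on in their lowest state and leave the first `f`
  -- spins free. This gives `d ^ f > f` dimensions of energy at most `c + f ≤ E₀ + f`, one of which
  -- must lie above the ground space.
  · have : Nontrivial (Space n d) := ⟨⟨ψ, 0, hψ⟩⟩
    have hsplit : ∑ i ∈ Finset.range (n - 1), bonds h i =
        ∑ i ∈ Finset.range f, bonds h i + IsChain.rightPart (bonds h) f := by
      rw [← hX.sum_range (N := f + n) (by omega), Finset.sum_range_add]; rfl
    have hRnn : 0 ≤ IsChain.rightPart (bonds h) f := Finset.sum_nonneg fun _ _ => hX.nonneg _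
    obtain ⟨c, w, hw, hwc, hc⟩ := exists_lowest_eigenvector (IsSelfAdjoint.of_nonneg hRnn)
    have hR : IsChain.rightPart (bonds h) f ∈ rightAlg n d f := hX.rightPart_mem le_rfl
    have hcE : c ≤ E₀ := by
      have h1 : algebraMap ℝ (Op n d) c ≤ ∑ i ∈ Finset.range (n - 1), bonds h i := by
        rw [hsplit]
        exact hc.trans (le_add_of_nonneg_left (Finset.sum_nonneg fun _ _ => hX.nonneg _))
      have h2 := mul_norm_sq_le_re_inner h1 ψ
      rw [hψ', re_inner_smul_self] at h2
      exact le_of_mul_le_mul_right h2 hψ0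
    obtain ⟨σ, hσ⟩ := exists_apply_ne_zero hw
    set w0 := pullback (splice f σ) w with hw0
    have hw0c : IsChain.rightPart (bonds h) f w0 = (c : ℂ) • w0 := by
      rw [hw0, mem_rightAlg.1 hR, hwc, map_smul]
    let ext : (Fin f → Fin d) → Config n d := fun a i => if hi : i.1 < f then a ⟨i, hi⟩ else σ i
    let χ : (Fin f → Fin d) → Config n d → ℂ := fun a τ =>
      if ∀ i : Fin n, i.1 < f → τ i = ext a i then 1 else 0
    have hχ : ∀ a, diagOp (χ a) ∈ leftAlg n d f := fun a => diagOp_mem_leftAlg fun τ b => by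
      simp only [χ]
      congr 1
      refine propext (forall_congr' fun i => forall_congr' fun hi => ?_)
      simp [splice, hi]
    have hli : LinearIndependent ℂ fun a => diagOp (χ a) w0 := by
      rw [Fintype.linearIndependent_iff]
      intro g hg' a
      have h1 := congrArg (fun x : Space n d => x (ext a)) hg'
      simp only [WithLp.ofLp_sum, Finset.sum_apply, PiLp.smul_apply, diagOp_apply, smul_eq_mul,
        PiLp.zero_apply] at h1
      rw [Finset.sum_eq_single a] at h1
      · have h2 : w0 (ext a) = w σ := by
          rw [hw0, pullback_apply]
          refine congrArg w.ofLp (funext fun i => ?_)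
          simp only [splice, ext]
          split_ifs <;> rfl
        rw [h2] at h1
        simpa [χ, hσ] using h1
      · intro b _ hb
        have : χ b (ext a) = 0 := by
          simp only [χ]
          rw [if_neg]
          intro hall
          apply hb
          funext i
          have := hall ⟨i.1, by omega⟩ i.2
          simpa [ext] using this.symm
        rw [this]; simp
      · simp
    set V := Submodule.span ℂ (Set.range fun a => diagOp (χ a) w0) with hV
    have hVdim : Module.finrank ℂ V = d ^ f := by
      rw [hV, finrank_span_eq_card hli]; simp
    have hVc : ∀ v ∈ V, IsChain.rightPart (bonds h) f v = (c : ℂ) • v := by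
      intro v hv
      induction hv using Submodule.span_induction with
      | mem v hv =>
        obtain ⟨a, rfl⟩ := hv
        dsimp only
        rw [← ContinuousLinearMap.mul_apply_eq, ← (commute_of_left_right (hχ a) hR).eq,
          ContinuousLinearMap.mul_apply_eq, hw0c, map_smul]
      | zero => simp
      | add x y _ _ hx hy => rw [map_add, hx, hy, smul_add]
      | smul r x _ hx => rw [map_smul, hx, smul_comm]
    have hlt : f < d ^ f := Nat.lt_pow_self (by omega)
    have h1 := hg.norm_sq_bound_of_lt (V := V) (by rw [hVdim]; exact hlt) (c := c + f) (by
      intro v hv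
      rw [hsplit, add_apply, hVc v hv, inner_add_right, Complex.add_re, re_inner_smul_self]
      have := re_inner_le_mul_norm_sq (hsum_le (Finset.range f)) v
      rw [Finset.card_range] at this
      linarith)
    linarith

end IsGapped
end SpinChain
end

noncomputable section

/-! ### The approximate ground space projector of a chain. -/

namespace SpinChain
variable {n d : ℕ}

/-- The Schmidt rank produced by a polynomial of degree `s ^ 2` in a window of `s` bonds. -/
def rankFactor (d s : ℕ) : ℕ :=
  (s ^ 2 + 1) * (s * ((s ^ 2 + 1) ^ s * (d ^ (2 * s) * ((s + 1) *
    ((s ^ 2 + 1) * ((s ^ 2 + 1) ^ 2 * (d ^ 2 + 1)) ^ s)))))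

/-- Every factor is absorbed into a power of `s + 1`; the exponent linear in `s` gives a rank `exp
(O(s log s))`. -/
theorem rankFactor_le {s : ℕ} (hs : 1 ≤ s) (d : ℕ) :
    rankFactor d s ≤ (s + 1) ^ ((12 + 2 * d ^ 2) * s) := by
  have h1 : s ^ 2 + 1 ≤ (s + 1) ^ 2 := by nlinarith
  have h2 : d ^ 2 + 1 ≤ (s + 1) ^ d ^ 2 := (Nat.lt_pow_self (by omega))
  calc rankFactor d s ≤ (s + 1) ^ 2 * ((s + 1) * (((s + 1) ^ 2) ^ s * (((s + 1) ^ d ^ 2) ^ s * ((s + 1) *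
        ((s + 1) ^ 2 * (((s + 1) ^ 2) ^ 2 * (s + 1) ^ d ^ 2) ^ s))))) := by
        unfold rankFactor
        have h3 : d ^ (2 * s) ≤ ((s + 1) ^ d ^ 2) ^ s := by
          rw [pow_mul]; exact Nat.pow_le_pow_left (by omega) s
        gcongr
        omega
    _ = (s + 1) ^ (6 + (6 + 2 * d ^ 2) * s) := by
        generalize s + 1 = q
        generalize d ^ 2 = r
        ring
    _ ≤ _ := Nat.pow_le_pow_right (by omega) (by nlinarith)

theorem le_rankFactor {s : ℕ} (hs : 1 ≤ s) (hd : 1 ≤ d) : d ^ s ≤ rankFactor d s := by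
  have h1 : ∀ a b : ℕ, 1 ≤ a → b ≤ a * b := fun a b h => Nat.le_mul_of_pos_left b h
  have h2 : ∀ a b : ℕ, 1 ≤ b → a ≤ a * b := fun a b h => Nat.le_mul_of_pos_right a h
  calc d ^ s ≤ d ^ (2 * s) := Nat.pow_le_pow_right hd (by omega)
    _ ≤ _ := h2 _ ((s + 1) * ((s ^ 2 + 1) * ((s ^ 2 + 1) ^ 2 * (d ^ 2 + 1)) ^ s)) (by
        refine Nat.one_le_iff_ne_zero.2 ?_; positivity)
    _ ≤ _ := h1 ((s ^ 2 + 1) ^ s) _ (Nat.one_le_pow _ _ (by omega))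
    _ ≤ _ := h1 s _ hs
    _ ≤ _ := h1 (s ^ 2 + 1) _ (by omega)

theorem rankFactor_pos {s : ℕ} (hs : 1 ≤ s) (hd : 1 ≤ d) : 0 < rankFactor d s :=
  (Nat.pow_pos hd).trans_le (le_rankFactor hs hd)

/-- An operator of low Schmidt rank that approximately projects onto a space close to the ground
space. -/
theorem IsChain.exists_isGroundProjector {X : ℕ → Op n d} (hX : IsChain X) (hd : 1 ≤ d)
    {Z : Submodule ℂ (Space n d)} {e ε : ℝ}
    (hZ : IsGapSpace (∑ i ∈ Finset.range (n - 1), X i) Z e ε) (hε : 0 < ε) (hε1 : ε ≤ 1)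
    (hZ0 : 0 < Module.finrank ℂ Z) {s k : ℕ} (hs : 1 ≤ s) (hk : s < k) {t τ u : ℝ} (ht : 0 ≤ t)
    (hu : u = s + 2 + 2 * t)
    (hτ : τ = √((Module.finrank ℂ Z : ℝ) + 1) * (32 * Real.exp (-t / 4)))
    (hsmall : 16 * u * τ ≤ ε) :
    ∃ (W : Submodule ℂ (Space n d)) (K : Op n d), Module.finrank ℂ W = Module.finrank ℂ Z ∧
      IsGroundProjector K W (2 * Real.exp (-(s ^ 2 * √(ε / u)))) ∧
      RankBound k (rankFactor d s) K ∧
      ∀ z ∈ Z, ∃ w ∈ W, ‖z - w‖ ≤ (τ + √(8 * u * τ / ε)) * ‖z‖ := by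
  -- The window is placed so that the cut passes through its last bond; all its bonds are within
  -- distance `s` of the cut.
  obtain ⟨b, rfl⟩ : ∃ b, k = b + 1 + s := ⟨k - 1 - s, by omega⟩
  obtain ⟨a₁, m, a₂, hW, h1, h2⟩ := hX.exists_isWindow_energy hZ hε.le hZ0 b s
  rw [hX.sum_eq_parts b s] at hZ
  obtain ⟨W, hWf, hWs, -, hWZ⟩ := hW.exists_spectralSpace hZ h1 h2 hε hε1 ht (by positivity) hu hτ
    hsmall
  have hu2 : 2 ≤ u := by rw [hu]; have : (0 : ℝ) ≤ s := by positivity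
                         linarith
  obtain ⟨p, hp, hp1, hpδ⟩ := exists_separating_polynomial (s ^ 2) (e := e) (η := ε / 2) (U := u)
    (by linarith) (by linarith)
  refine ⟨W, polyOp p (s ^ 2) (IsWindow.truncated (leftPart X b) (X b) (midPart X (b + 1) s)
    (X (b + 1 + s)) (rightPart X (b + s + 2)) a₁ a₂ t), hWf, ?_, ?_, hWZ⟩
  · refine IsSpectralSpace.isGroundProjector hWs hp hp1 (by positivity) fun x hx hx' => ?_
    have := hpδ x hx (by linarith)
    rwa [mul_div_cancel₀ _ (by norm_num), Nat.cast_pow] at this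
  -- Words of length at most `s ^ 2 < s * (s + 1)` contain some window bond at most `s` times. A
  -- bond has rank factor `1` one site beyond its own cut, hence `d ^ 2` at it.
  · have key := rankBound_polyOp (hd := hd) (s := s) (l := s ^ 2) (r := s) (k := b + 1 + s) (e := d ^ 2)
      (by nlinarith) p (L := truncAt (leftPart X b) (a₁ + t) + X b)
      (R := X (b + 1 + s) + truncAt (rightPart X (b + s + 2)) (a₂ + t))
      (Y := fun i => X (b + 1 + i)) (κ := fun i => b + 2 + i) (fun i => by omega) (fun i => by omega)
      (fun i => Subalgebra.add_mem _ (cfc_mem_leftAlg (hX.leftPart_mem (by omega)) _)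
        (hX.mem_left _ _ (by omega)))
      (fun i => Subalgebra.add_mem _ (hX.mem_right _ _ (by omega))
        (cfc_mem_rightAlg (hX.rightPart_mem (by omega)) _))
      (fun i i' hi => hX.mem_left _ _ (by have : i'.1 < i.1 := hi; omega))
      (fun i i' hi => hX.mem_right _ _ (by have : i.1 < i'.1 := hi; omega))
      (fun i => by
        have := (RankBound.of_left (hX.mem_left (b + 1 + i) (b + 3 + i) (by omega))).move hd
          (k := b + 2 + i) (m := 1) (by omega) (by omega)
        simpa using this)
    have e : IsWindow.truncated (leftPart X b) (X b) (midPart X (b + 1) s) (X (b + 1 + s))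
        (rightPart X (b + s + 2)) a₁ a₂ t = truncAt (leftPart X b) (a₁ + t) + X b +
        ∑ i : Fin s, X (b + 1 + i) + (X (b + 1 + s) + truncAt (rightPart X (b + s + 2)) (a₂ + t)) := by
      unfold IsWindow.truncated midPart
      abel
    rw [e]
    exact key

theorem schmidtRank_le_pow (hd : 1 ≤ d) (k : ℕ) (ψ : Space n d) : schmidtRank k ψ ≤ d ^ k := by
  have h1 := schmidtRank_le_of_dist (k := k) (k' := 0) (m := k) hd (by omega) (by omega) ψ
  have h2 : schmidtRank 0 ψ ≤ 1 := schmidtRank_le_one ψ fun a => ⟨1, by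
    ext σ
    rw [one_smul, pullback_apply]
    exact congrArg ψ.ofLp (funext fun i => by simp [splice])⟩
  calc _ ≤ d ^ k * schmidtRank 0 ψ := h1
    _ ≤ d ^ k * 1 := Nat.mul_le_mul_left _ h2
    _ = _ := mul_one _

/-- Ground states are approximated by states of low Schmidt rank. -/
theorem IsChain.exists_approx {X : ℕ → Op n d} (hX : IsChain X) (hd : 1 ≤ d)
    {Z : Submodule ℂ (Space n d)} {e ε : ℝ}
    (hZ : IsGapSpace (∑ i ∈ Finset.range (n - 1), X i) Z e ε) (hε : 0 < ε) (hε1 : ε ≤ 1) {f : ℕ}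
    (hf : Module.finrank ℂ Z = f) (hf0 : 0 < f) {s k : ℕ} (hs : 1 ≤ s) {t τ u δ : ℝ} (ht : 0 ≤ t)
    (hu : u = s + 2 + 2 * t) (hτ : τ = √((f : ℝ) + 1) * (32 * Real.exp (-t / 4)))
    (hsmall : 16 * u * τ ≤ ε) (hδ : δ = 2 * Real.exp (-(s ^ 2 * √(ε / u))))
    (hboot : 16 * f ^ 3 * rankFactor d s * δ ^ 2 ≤ 1) {z : Space n d} (hz : z ∈ Z) :
    ∃ y : Space n d, schmidtRank k y ≤ rankFactor d s * f ∧
      ‖z - y‖ ≤ (2 * (τ + √(8 * u * τ / ε)) + √(16 * f ^ 3 * rankFactor d s * δ ^ 2)) * ‖z‖ := by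
  have hu0 : 0 ≤ u := by rw [hu]; positivity
  have hτ0 : 0 ≤ τ := by rw [hτ]; positivity
  have hD0 := rankFactor_pos (d := d) hs hd
  -- Near the left end there is no room for the window, but the Schmidt rank is at most `d ^ s`
  -- anyway.
  rcases le_or_gt k s with hk | hk
  · refine ⟨z, ?_, by rw [sub_self, norm_zero]; positivity⟩
    calc schmidtRank k z ≤ d ^ k := schmidtRank_le_pow hd k z
      _ ≤ d ^ s := Nat.pow_le_pow_right hd hk
      _ ≤ rankFactor d s := le_rankFactor hs hd
      _ ≤ _ := Nat.le_mul_of_pos_right _ hf0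
  · subst hf
    obtain ⟨W, K, hWf, hK, hD, hWZ⟩ := hX.exists_isGroundProjector hd hZ hε hε1 hf0 hs hk ht hu hτ
      hsmall
    rw [← hδ] at hK
    have hDf : 0 < rankFactor d s * Module.finrank ℂ Z := Nat.mul_pos hD0 hf0
    have hov := hasProductOverlap_of_isGroundProjector hWf hK hD hDf (by exact_mod_cast hboot)
    obtain ⟨w, hw, hzw⟩ := hWZ z hz
    have hDf' : (0 : ℝ) < rankFactor d s * Module.finrank ℂ Z := by exact_mod_cast hDf
    obtain ⟨y, hy, -, hyw⟩ := hov.exists_approx (by rw [mul_assoc]; positivity) hWf hK hD hw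
    refine ⟨y, hy, ?_⟩
    set F : ℝ := ((Module.finrank ℂ Z : ℕ) : ℝ)
    set q := 16 * F ^ 3 * rankFactor d s * δ ^ 2 with hq
    set η := τ + √(8 * u * τ / ε)
    have hη : 0 ≤ η := by positivity
    have hq0 : 0 ≤ q := by positivity
    have hF : F ≠ 0 := by intro h0; rw [h0, mul_zero] at hDf'; exact lt_irrefl _ hDf'
    have e1 : δ ^ 2 * (4 * F ^ 2 / (1 / (4 * rankFactor d s * F))) * ‖w‖ ^ 2 = q * ‖w‖ ^ 2 := by
      rw [hq]; field_simp; ring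
    rw [e1] at hyw
    have h1 : ‖y - w‖ ≤ √q * ‖w‖ := by
      refine (sq_le_sq₀ (by positivity) (by positivity)).1 ?_
      rwa [mul_pow, Real.sq_sqrt hq0]
    have h2 : ‖w‖ ≤ (1 + η) * ‖z‖ := by
      have := norm_sub_norm_le w z
      rw [norm_sub_rev] at this
      linarith
    have h3 : √q ≤ 1 := Real.sqrt_le_one.2 hboot
    calc ‖z - y‖ = ‖(z - w) - (y - w)‖ := by congr 1; abel
      _ ≤ η * ‖z‖ + √q * ((1 + η) * ‖z‖) :=
        (norm_sub_le _ _).trans (add_le_add hzw (h1.trans (by gcongr)))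
      _ = (η + √q + √q * η) * ‖z‖ := by ring
      _ ≤ (η + √q + 1 * η) * ‖z‖ := by gcongr
      _ = _ := by ring

end SpinChain
end

/-! ### Choice of the window size and the truncation height. -/

noncomputable section

theorem Real.one_le_log_two_add {x : ℝ} (hx : 1 ≤ x) : 1 ≤ Real.log (2 + x) := by
  rw [Real.le_log_iff_exp_le (by linarith)]
  linarith [Real.exp_one_lt_d9]

/-- This inverts `t ≥ K x log ^ 4 t`. For `t ≤ x ^ 2` the logarithms of `t` and `x` are comparable;
for larger `t` both `x` and `K log ^ 4 t` are below `√t`. -/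
theorem exists_polylog_threshold (K : ℝ) : ∃ C : ℝ, 1 ≤ C ∧ ∀ x t : ℝ, 1 ≤ x →
    C * (x * Real.log (2 + x) ^ 4) ≤ t → K * (x * Real.log (2 + t) ^ 4) ≤ t := by
  have h1 : ∀ᶠ y : ℝ in Filter.atTop, Real.log y ^ 8 ≤ 1 / (3 * (K ^ 2 + 1)) * y := by
    have := (Real.isLittleO_pow_log_id_atTop (n := 8)).bound (c := 1 / (3 * (K ^ 2 + 1))) (by positivity)
    filter_upwards [this, Filter.eventually_ge_atTop 1] with y hy hy1
    rw [Real.norm_of_nonneg (by have := Real.log_nonneg hy1; positivity), id,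
      Real.norm_of_nonneg (by linarith)] at hy
    exact hy
  obtain ⟨T, hT⟩ := Filter.eventually_atTop.1 h1
  refine ⟨max 1 (max (16 * K) T), le_max_left _ _, fun x t hx ht => ?_⟩
  set C := max 1 (max (16 * K) T)
  have hC1 : 1 ≤ C := le_max_left _ _
  have hC2 : 16 * K ≤ C := (le_max_left _ _).trans (le_max_right _ _)
  have hC3 : T ≤ C := (le_max_right _ _).trans (le_max_right _ _)
  have hL := Real.one_le_log_two_add hx
  have hxL : 1 ≤ x * Real.log (2 + x) ^ 4 := one_le_mul_of_one_le_of_one_le hx (one_le_pow₀ hL)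
  have htC : C ≤ t := le_trans (le_mul_of_one_le_right (by linarith) hxL) ht
  have ht1 : 1 ≤ t := hC1.trans htC
  have hLt := Real.one_le_log_two_add ht1
  rcases le_or_gt K 0 with hK | hK
  · have : K * (x * Real.log (2 + t) ^ 4) ≤ 0 := mul_nonpos_of_nonpos_of_nonneg hK (by positivity)
    linarith
  rcases le_or_gt t (x ^ 2) with h | h
  · have h2 : Real.log (2 + t) ≤ 2 * Real.log (2 + x) := by
      rw [← Real.log_rpow (by linarith) 2]
      apply Real.log_le_log (by linarith)
      norm_cast
      nlinarith
    calc K * (x * Real.log (2 + t) ^ 4) ≤ K * (x * (2 * Real.log (2 + x)) ^ 4) := by gcongr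
      _ = 16 * K * (x * Real.log (2 + x) ^ 4) := by ring
      _ ≤ C * (x * Real.log (2 + x) ^ 4) := by gcongr
      _ ≤ t := ht
  · have h2 := hT (2 + t) (by linarith)
    have h3 : (K * Real.log (2 + t) ^ 4) ^ 2 ≤ t := by
      calc (K * Real.log (2 + t) ^ 4) ^ 2 = K ^ 2 * Real.log (2 + t) ^ 8 := by ring
        _ ≤ K ^ 2 * (1 / (3 * (K ^ 2 + 1)) * (3 * t)) := by gcongr; linarith [h2, mul_le_mul_of_nonneg_left (show 2 + t ≤ 3 * t by linarith) (show 0 ≤ 1 / (3 * (K ^ 2 + 1)) by positivity)]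
        _ = K ^ 2 / (K ^ 2 + 1) * t := by field_simp
        _ ≤ 1 * t := by gcongr; rw [div_le_one (by positivity)]; linarith
        _ = t := one_mul t
    have h4 : K * Real.log (2 + t) ^ 4 ≤ √t := Real.le_sqrt_of_sq_le h3
    have h5 : x ≤ √t := Real.le_sqrt_of_sq_le h.le
    calc K * (x * Real.log (2 + t) ^ 4) = x * (K * Real.log (2 + t) ^ 4) := by ring
      _ ≤ √t * √t := mul_le_mul h5 h4 (by positivity) (by positivity)
      _ = t := Real.mul_self_sqrt (by linarith)

theorem sq_le_exp_eighth {t : ℝ} (ht : 0 ≤ t) : t ^ 2 ≤ 128 * Real.exp (t / 8) := by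
  have := Real.quadratic_le_exp_of_nonneg (x := t / 8) (by positivity)
  nlinarith

namespace SpinChain
variable {n d : ℕ}

theorem rankFactor_le_exp {s d : ℕ} (hs : 1 ≤ s) {S t : ℝ} (hsS : (s : ℝ) ≤ 2 * S) (hSt : S ≤ t) :
    (rankFactor d s : ℝ) ≤ Real.exp (4 * (12 + 2 * d ^ 2) * (S * Real.log (2 + t))) := by
  have hs' : (1 : ℝ) ≤ s := by exact_mod_cast hs
  have h1 : (rankFactor d s : ℝ) ≤ ((s : ℝ) + 1) ^ ((12 + 2 * d ^ 2) * s) := by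
    exact_mod_cast rankFactor_le hs d
  refine h1.trans ?_
  rw [← Real.exp_log (show (0 : ℝ) < (s : ℝ) + 1 by linarith), ← Real.exp_nat_mul]
  apply Real.exp_le_exp.2
  have h2 : Real.log ((s : ℝ) + 1) ≤ 2 * Real.log (2 + t) := by
    rw [show 2 * Real.log (2 + t) = Real.log ((2 + t) ^ 2) by rw [Real.log_pow]; norm_num]
    apply Real.log_le_log (by linarith)
    nlinarith
  have h3 : 0 ≤ Real.log ((s : ℝ) + 1) := Real.log_nonneg (by linarith)
  push_cast
  calc (12 + 2 * (d : ℝ) ^ 2) * s * Real.log ((s : ℝ) + 1)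
      ≤ (12 + 2 * (d : ℝ) ^ 2) * (2 * S) * (2 * Real.log (2 + t)) := by gcongr; nlinarith
    _ = _ := by ring

set_option maxHeartbeats 1000000 in
-- The filter exponent `s ^ 2 √(ε / u)` must reach order `t`, to match the truncation error, while
-- `u` is of order `t`; this forces `s ^ 4` to be about `t ^ 3 / ε`. The lower bound on `t` makes `s
-- log s` small compared with `t`, so that `D δ ^ 2` stays exponentially small.
theorem exists_lowRank_approx (d f : ℕ) : ∃ C c : ℝ, 1 ≤ C ∧ 0 ≤ c ∧ ∀ (n : ℕ)
    (h : Fin (n - 1) → Matrix (Fin d × Fin d) (Fin d × Fin d) ℂ) (E₀ ε : ℝ), IsGapped h f E₀ ε →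
    ∀ z : Space n d, IsGroundState h E₀ z → ∀ (k : ℕ) (x t : ℝ), x = (min ε 1)⁻¹ →
      C * (x * Real.log (2 + x) ^ 4) ≤ t →
      ∃ y : Space n d, (schmidtRank k y : ℝ) ≤
        Real.exp (c * (t ^ (3 / 4 : ℝ) * x ^ (1 / 4 : ℝ) * Real.log (2 + t))) ∧
        ‖z - y‖ ≤ Real.exp (-t / 32) := by
  set c₁ : ℝ := 12 + 2 * d ^ 2 with hc₁
  have hc₁0 : 0 < c₁ := by positivity
  obtain ⟨C₁, hC₁, hth⟩ := exists_polylog_threshold ((24 * c₁) ^ 4)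
  set M : ℝ := 393216 * ((f : ℝ) + 1) ^ 3 with hM
  have hf1 : (1 : ℝ) ≤ (f : ℝ) + 1 := by have : (0 : ℝ) ≤ f := by positivity
                                         linarith
  have hM1 : (393216 : ℝ) ≤ M := by
    have := one_le_pow₀ (n := 3) hf1
    rw [hM]; linarith
  have hM5 : 5 * M ≤ M ^ 2 := by
    rw [pow_two]; exact mul_le_mul_of_nonneg_right (by linarith) (by linarith)
  refine ⟨max C₁ (64 * M), 4 * c₁ + f, hC₁.trans (le_max_left _ _), by positivity, ?_⟩
  intro n h E₀ ε₀ hg z hz k x t hx ht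
  set C := max C₁ (64 * M)
  have hε₀ := hg.pos
  set ε := min ε₀ 1 with hεdef
  have hε : 0 < ε := lt_min hε₀ one_pos
  have hε1 : ε ≤ 1 := min_le_right _ _
  have hx1 : 1 ≤ x := by rw [hx]; exact (one_le_inv₀ hε).2 hε1
  have hεx : ε = 1 / x := by rw [hx]; simp
  have hL := Real.one_le_log_two_add hx1
  have hL4 : 1 ≤ Real.log (2 + x) ^ 4 := one_le_pow₀ hL
  have hCC : C₁ ≤ C := le_max_left _ _
  have hCM : 64 * M ≤ C := le_max_right _ _
  have htx : C * x ≤ t := by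
    refine le_trans ?_ ht
    exact mul_le_mul_of_nonneg_left (le_mul_of_one_le_right (by linarith) hL4)
      (by linarith [hC₁.trans hCC])
  have hxt : x ≤ t := (le_mul_of_one_le_left (by linarith) (hC₁.trans hCC)).trans htx
  have htM : 64 * M ≤ t := by
    have : C * 1 ≤ C * x := by gcongr
    linarith
  have ht1 : 1 ≤ t := hx1.trans hxt
  have hMexp : M ≤ Real.exp (t / 64) := by
    have := Real.add_one_le_exp (t / 64)
    linarith
  have hLt := Real.one_le_log_two_add ht1
  set Lg := Real.log (2 + t)
  have hpoly : (24 * c₁) ^ 4 * (x * Lg ^ 4) ≤ t := by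
    refine hth x t hx1 (le_trans ?_ ht)
    gcongr
  set S : ℝ := t ^ (3 / 4 : ℝ) * x ^ (1 / 4 : ℝ) with hS
  have hS4 : S ^ 4 = t ^ 3 * x := by
    rw [hS, mul_pow, ← Real.rpow_natCast, ← Real.rpow_natCast, ← Real.rpow_mul (by linarith),
      ← Real.rpow_mul (by linarith)]
    norm_num
  have hS0 : 0 ≤ S := by positivity
  have hS1 : 1 ≤ S := one_le_mul_of_one_le_of_one_le (Real.one_le_rpow ht1 (by norm_num))
    (Real.one_le_rpow hx1 (by norm_num))
  have hSt : S ≤ t := by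
    refine le_of_pow_le_pow_left₀ (n := 4) (by norm_num) (by linarith) ?_
    rw [hS4]
    nlinarith [pow_pos (show 0 < t by linarith) 3]
  -- The fourth power of this is exactly the polylogarithmic threshold; it yields `D ≤ exp (t / 6)`,
  -- against `δ ^ 2 ≤ 4 * exp (-(2 * t / 3))`.
  have hSL : 24 * c₁ * (S * Lg) ≤ t := by
    refine le_of_pow_le_pow_left₀ (n := 4) (by norm_num) (by linarith) ?_
    calc (24 * c₁ * (S * Lg)) ^ 4 = (24 * c₁) ^ 4 * (S ^ 4 * Lg ^ 4) := by ring
      _ = t ^ 3 * ((24 * c₁) ^ 4 * (x * Lg ^ 4)) := by rw [hS4]; ring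
      _ ≤ t ^ 3 * t := by gcongr
      _ = t ^ 4 := by ring
  set s := ⌈S⌉₊ with hs
  have hs1 : 1 ≤ s := Nat.one_le_ceil_iff.2 (by linarith)
  have hsS : S ≤ s := Nat.le_ceil S
  have hsS2 : (s : ℝ) ≤ 2 * S := by
    have := (Nat.ceil_lt_add_one hS0).le
    linarith
  have hD : (rankFactor d s : ℝ) ≤ Real.exp (4 * c₁ * (S * Lg)) := rankFactor_le_exp hs1 hsS2 hSt
  have hDt : (rankFactor d s : ℝ) ≤ Real.exp (t / 6) := hD.trans (Real.exp_le_exp.2 (by linarith))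
  set u : ℝ := s + 2 + 2 * t with hu
  have hu6 : u ≤ 6 * t := by rw [hu]; linarith
  have hu0 : 0 < u := by rw [hu]; positivity
  set F := √((f : ℝ) + 1) with hF
  have hFf : F ≤ (f : ℝ) + 1 := by
    rw [hF, Real.sqrt_le_left (by linarith)]
    nlinarith
  have hf3 : (f : ℝ) + 1 ≤ ((f : ℝ) + 1) ^ 3 := le_self_pow₀ hf1 (by norm_num)
  have hFM : 393216 * F ≤ M := by rw [hM]; linarith
  set τ := F * (32 * Real.exp (-t / 4)) with hτ
  have hτ0 : 0 ≤ τ := by positivity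
  have huτ : u * τ / ε ≤ 24576 * F * Real.exp (-t / 8) := by
    have e1 : Real.exp (-t / 4) = Real.exp (-t / 8) * Real.exp (-t / 8) := by
      rw [← Real.exp_add]; congr 1; ring
    have e2 : Real.exp (t / 8) * Real.exp (-t / 8) = 1 := by
      rw [← Real.exp_add, show t / 8 + -t / 8 = 0 by ring, Real.exp_zero]
    calc u * τ / ε = u * τ * x := by rw [hεx]; field_simp
      _ ≤ 6 * t * τ * t := by gcongr
      _ = 192 * F * Real.exp (-t / 4) * t ^ 2 := by rw [hτ]; ring
      _ ≤ 192 * F * Real.exp (-t / 4) * (128 * Real.exp (t / 8)) := by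
        gcongr; exact sq_le_exp_eighth (by linarith)
      _ = 24576 * F * Real.exp (-t / 8) * (Real.exp (t / 8) * Real.exp (-t / 8)) := by
        rw [e1]; ring
      _ = _ := by rw [e2, mul_one]
  have hexp8 : M ^ 2 * Real.exp (-t / 8) ≤ 1 := by
    have e2 : Real.exp (t / 64) ^ 2 * Real.exp (-t / 8) ≤ 1 := by
      rw [← Real.exp_nat_mul, ← Real.exp_add, Real.exp_le_one_iff]; push_cast; linarith
    refine le_trans ?_ e2
    gcongr
  have hsmall : 16 * u * τ ≤ ε := by
    have h1 : 16 * (u * τ / ε) ≤ 1 := by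
      calc 16 * (u * τ / ε) ≤ 16 * (24576 * F * Real.exp (-t / 8)) := by gcongr
        _ = 393216 * F * Real.exp (-t / 8) := by ring
        _ ≤ M ^ 2 * Real.exp (-t / 8) :=
          mul_le_mul_of_nonneg_right (by linarith) (Real.exp_pos _).le
        _ ≤ 1 := hexp8
    have h2 : 16 * u * τ = 16 * (u * τ / ε) * ε := by field_simp
    rw [h2]
    exact mul_le_of_le_one_left hε.le h1
  have hexp16 : Real.exp (-t / 8) = Real.exp (-t / 16) ^ 2 := by
    rw [← Real.exp_nat_mul]; congr 1; push_cast; ring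
  have hη : τ + √(8 * u * τ / ε) ≤ 2 * (M * Real.exp (-t / 16)) := by
    have h1 : τ ≤ M * Real.exp (-t / 16) := by
      rw [hτ, ← mul_assoc]
      exact mul_le_mul (by linarith) (Real.exp_le_exp.2 (by linarith)) (Real.exp_pos _).le
        (by linarith)
    have h2 : √(8 * u * τ / ε) ≤ M * Real.exp (-t / 16) := by
      rw [Real.sqrt_le_left (by positivity), mul_pow, ← hexp16]
      calc 8 * u * τ / ε = 8 * (u * τ / ε) := by ring
        _ ≤ 8 * (24576 * F * Real.exp (-t / 8)) := by gcongr
        _ = (196608 * F) * Real.exp (-t / 8) := by ring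
        _ ≤ _ := mul_le_mul_of_nonneg_right (by linarith) (Real.exp_pos _).le
    linarith
  set δ := 2 * Real.exp (-((s : ℝ) ^ 2 * √(ε / u))) with hδ
  have hδt : δ ^ 2 ≤ 4 * Real.exp (-(2 * t / 3)) := by
    have h1 : t / 3 ≤ (s : ℝ) ^ 2 * √(ε / u) := by
      refine (sq_le_sq₀ (by positivity) (by positivity)).1 ?_
      rw [mul_pow, Real.sq_sqrt (by positivity)]
      calc (t / 3) ^ 2 ≤ t ^ 2 / 6 := by nlinarith [sq_nonneg t]
        _ = S ^ 4 * (ε / (6 * t)) := by rw [hS4, hεx]; field_simp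
        _ ≤ (s : ℝ) ^ 4 * (ε / u) := by gcongr
        _ = _ := by ring
    calc δ ^ 2 = 4 * Real.exp (-((s : ℝ) ^ 2 * √(ε / u))) ^ 2 := by rw [hδ]; ring
      _ ≤ 4 * Real.exp (-(t / 3)) ^ 2 := by gcongr
      _ = _ := by rw [← Real.exp_nat_mul]; congr 2; push_cast; ring
  have hq : 16 * (f : ℝ) ^ 3 * rankFactor d s * δ ^ 2 ≤ M ^ 2 * Real.exp (-t / 8) := by
    have hff : (f : ℝ) ^ 3 ≤ ((f : ℝ) + 1) ^ 3 := by gcongr; linarith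
    calc 16 * (f : ℝ) ^ 3 * rankFactor d s * δ ^ 2
        ≤ 16 * (f : ℝ) ^ 3 * Real.exp (t / 6) * (4 * Real.exp (-(2 * t / 3))) := by gcongr
      _ = 64 * (f : ℝ) ^ 3 * Real.exp (-t / 2) := by
        have : Real.exp (t / 6) * Real.exp (-(2 * t / 3)) = Real.exp (-t / 2) := by
          rw [← Real.exp_add]; congr 1; ring
        rw [← this]; ring
      _ ≤ M ^ 2 * Real.exp (-t / 8) := by
        refine mul_le_mul ?_ (Real.exp_le_exp.2 (by linarith)) (Real.exp_pos _).le (by positivity)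
        rw [hM] at hM5 ⊢
        linarith
  obtain ⟨y, hy, hzy⟩ := hg.isChain.exists_approx (by have := hg.two_le_dim; omega)
    (hg.isGapSpace.mono (min_le_left ε₀ 1)) hε hε1 hg.degeneracy hg.finrank_pos (k := k) hs1
    (by linarith : 0 ≤ t) hu hτ hsmall hδ (hq.trans hexp8) hz.1
  refine ⟨y, ?_, ?_⟩
  · calc (schmidtRank k y : ℝ) ≤ rankFactor d s * f := by exact_mod_cast hy
      _ ≤ Real.exp (4 * c₁ * (S * Lg)) * Real.exp (f * (S * Lg)) := by
        gcongr
        have h1 : (1 : ℝ) ≤ S * Lg := one_le_mul_of_one_le_of_one_le hS1 hLt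
        have h2 : (f : ℝ) ≤ f * (S * Lg) := le_mul_of_one_le_right (by positivity) h1
        linarith [Real.add_one_le_exp (f * (S * Lg))]
      _ = _ := by rw [← Real.exp_add]; congr 1; ring
  · rw [hz.2, mul_one] at hzy
    refine hzy.trans ?_
    have h1 : √(16 * (f : ℝ) ^ 3 * rankFactor d s * δ ^ 2) ≤ M * Real.exp (-t / 16) := by
      rw [Real.sqrt_le_left (by positivity), mul_pow M, ← hexp16]
      exact hq
    calc _ ≤ 2 * (2 * (M * Real.exp (-t / 16))) + M * Real.exp (-t / 16) := by gcongr
      _ = 5 * M * Real.exp (-t / 16) := by ring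
      _ ≤ Real.exp (t / 64) ^ 2 * Real.exp (-t / 16) := by
        refine mul_le_mul_of_nonneg_right (hM5.trans ?_) (Real.exp_pos _).le
        exact pow_le_pow_left₀ (by linarith) hMexp 2
      _ = Real.exp (-t / 32) := by
        rw [← Real.exp_nat_mul, ← Real.exp_add]; congr 1; push_cast; ring

end SpinChain
end

noncomputable section

/-! ### Power sums and entropies of a probability vector. -/

section PowerSums
variable {ι : Type*} [Fintype ι]

/-- Hölder's inequality for the measure `w`, by weighted arithmetic and geometric means term by
term. -/
theorem sum_mul_rpow_le {w lam : ι → ℝ} (hw : ∀ i, 0 ≤ w i) (hlam : ∀ i, 0 ≤ lam i) {α R e : ℝ}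
    (hα : 0 < α) (hα1 : α < 1) (hR : 0 < R) (he : 0 < e) (hwR : ∑ i, w i ≤ R)
    (hwe : ∑ i, w i * lam i ≤ e) : ∑ i, w i * lam i ^ α ≤ R ^ (1 - α) * e ^ α := by
  have h1 : ∀ i, w i * lam i ^ α ≤
      R ^ (1 - α) * e ^ α * ((1 - α) * (w i / R) + α * (w i * lam i / e)) := by
    intro i
    have h2 := Real.geom_mean_le_arith_mean2_weighted (w₁ := 1 - α) (w₂ := α) (p₁ := w i / R)
      (p₂ := w i * lam i / e) (by linarith) hα.le (div_nonneg (hw i) hR.le)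
      (div_nonneg (mul_nonneg (hw i) (hlam i)) he.le) (by ring)
    have h3 : w i * lam i ^ α =
        R ^ (1 - α) * e ^ α * ((w i / R) ^ (1 - α) * (w i * lam i / e) ^ α) := by
      rw [Real.div_rpow (hw i) hR.le, Real.div_rpow (mul_nonneg (hw i) (hlam i)) he.le,
        Real.mul_rpow (hw i) (hlam i)]
      have e1 : w i ^ (1 - α) * w i ^ α = w i := by
        rw [← Real.rpow_add_of_nonneg (hw i) (by linarith) hα.le]; simp
      have hR' : R ^ (1 - α) ≠ 0 := (Real.rpow_pos_of_pos hR _).ne'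
      have he' : e ^ α ≠ 0 := (Real.rpow_pos_of_pos he _).ne'
      field_simp
      rw [mul_assoc, e1, mul_comm]
    rw [h3]
    exact mul_le_mul_of_nonneg_left h2 (by positivity)
  calc ∑ i, w i * lam i ^ α
      ≤ ∑ i, R ^ (1 - α) * e ^ α * ((1 - α) * (w i / R) + α * (w i * lam i / e)) :=
        Finset.sum_le_sum fun i _ => h1 i
    _ = R ^ (1 - α) * e ^ α * ((1 - α) * ((∑ i, w i) / R) + α * ((∑ i, w i * lam i) / e)) := by
        rw [← Finset.mul_sum, Finset.sum_add_distrib, ← Finset.mul_sum, ← Finset.mul_sum,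
          Finset.sum_div, Finset.sum_div]
    _ ≤ R ^ (1 - α) * e ^ α * ((1 - α) * 1 + α * 1) := by
        have := sub_nonneg.2 hα1.le
        gcongr
        · exact (div_le_one hR).2 hwR
        · exact (div_le_one he).2 hwe
    _ = _ := by ring

/-- Telescoping `1 = q₀ + (1 - q₀) q₁ + ⋯` cuts the sum into blocks. The block `j + 1` has size at
most `R (j + 1)` but carries only the mass missed by `q j`, so Hölder's inequality applies with `e
j`. -/
theorem sum_rpow_le_of_weights {lam : ι → ℝ} (hlam : ∀ i, 0 ≤ lam i) (hsum : ∑ i, lam i ≤ 1) {α : ℝ}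
    (hα : 0 < α) (hα1 : α < 1) {R e : ℕ → ℝ} (hR : ∀ j, 0 < R j) (he : ∀ j, 0 < e j)
    {q : ℕ → ι → ℝ} (hq0 : ∀ j i, 0 ≤ q j i) (hq1 : ∀ j i, q j i ≤ 1)
    (hqR : ∀ j, ∑ i, q j i ≤ R j) (hqe : ∀ j, ∑ i, lam i * (1 - q j i) ≤ e j) (J : ℕ) :
    ∑ i, lam i ^ α ≤ R 0 ^ (1 - α) + ∑ j ∈ Finset.range J, R (j + 1) ^ (1 - α) * e j ^ α +
      ((Fintype.card ι : ℝ) + 1) ^ (1 - α) * e J ^ α := by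
  set p : ℕ → ι → ℝ := fun j i => ∏ l ∈ Finset.range j, (1 - q l i) with hp
  have hp0 : ∀ j i, 0 ≤ p j i := fun j i => Finset.prod_nonneg fun l _ => by linarith [hq1 l i]
  have hp1 : ∀ j i, p j i ≤ 1 := fun j i =>
    Finset.prod_le_one (fun l _ => by linarith [hq1 l i]) fun l _ => by linarith [hq0 l i]
  have hps : ∀ j i, p (j + 1) i = p j i * (1 - q j i) := fun j i => Finset.prod_range_succ _ _
  have hple : ∀ j i, p (j + 1) i ≤ 1 - q j i := fun j i => by
    rw [hps]; exact mul_le_of_le_one_left (by linarith [hq1 j i]) (hp1 j i)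
  have hpe : ∀ j, ∑ i, p (j + 1) i * lam i ≤ e j := fun j => by
    refine le_trans (Finset.sum_le_sum fun i _ => ?_) (hqe j)
    rw [mul_comm]
    exact mul_le_mul_of_nonneg_left (hple j i) (hlam i)
  have hpqR : ∀ j, ∑ i, p j i * q j i ≤ R j := fun j =>
    le_trans (Finset.sum_le_sum fun i _ => mul_le_of_le_one_left (hq0 j i) (hp1 j i)) (hqR j)
  have hpq0 : ∀ j i, 0 ≤ p j i * q j i := fun j i => mul_nonneg (hp0 j i) (hq0 j i)
  have main : ∀ J, ∑ i, lam i ^ α ≤ R 0 ^ (1 - α) +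
      ∑ j ∈ Finset.range J, R (j + 1) ^ (1 - α) * e j ^ α + ∑ i, p (J + 1) i * lam i ^ α := by
    intro J
    induction J with
    | zero =>
      have h1 : ∑ i, lam i ^ α = ∑ i, q 0 i * lam i ^ α + ∑ i, p 1 i * lam i ^ α := by
        rw [← Finset.sum_add_distrib]
        refine Finset.sum_congr rfl fun i _ => ?_
        simp [hp]; ring
      have h2 : ∑ i, q 0 i * lam i ^ α ≤ R 0 ^ (1 - α) * 1 ^ α :=
        sum_mul_rpow_le (hq0 0) hlam hα hα1 (hR 0) one_pos (hqR 0)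
          (le_trans (Finset.sum_le_sum fun i _ => mul_le_of_le_one_left (hlam i) (hq1 0 i)) hsum)
      rw [Real.one_rpow, mul_one] at h2
      rw [h1]; simpa using h2
    | succ J ih =>
      refine ih.trans ?_
      have h1 : ∑ i, p (J + 1) i * lam i ^ α =
          ∑ i, p (J + 1) i * q (J + 1) i * lam i ^ α + ∑ i, p (J + 1 + 1) i * lam i ^ α := by
        rw [← Finset.sum_add_distrib]
        refine Finset.sum_congr rfl fun i _ => ?_
        rw [hps (J + 1)]; ring
      have h2 : ∑ i, p (J + 1) i * q (J + 1) i * lam i ^ α ≤ R (J + 1) ^ (1 - α) * e J ^ α :=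
        sum_mul_rpow_le (hpq0 (J + 1)) hlam hα hα1 (hR _) (he J) (hpqR _)
          (le_trans (Finset.sum_le_sum fun i _ => mul_le_mul_of_nonneg_right
            (mul_le_of_le_one_right (hp0 _ i) (hq1 _ i)) (hlam i)) (hpe J))
      rw [h1, Finset.sum_range_succ]
      linarith
  refine (main J).trans ?_
  gcongr
  refine sum_mul_rpow_le (hp0 _) hlam hα hα1 (by positivity) (he J) ?_ (hpe J)
  refine (Finset.sum_le_sum fun i _ => hp1 _ i).trans ?_
  simp

/-- A power sum is small if the weight of `lam` outside few indices decays quickly. -/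
theorem log_sum_rpow_le {lam : ι → ℝ} (hlam : ∀ i, 0 ≤ lam i) (hsum : ∑ i, lam i ≤ 1) {α T : ℝ}
    (hα : 0 < α) (hα1 : α < 1) (hT : 64 ≤ α * T)
    (h : ∀ t, T ≤ t → ∃ q : ι → ℝ, (∀ i, 0 ≤ q i) ∧ (∀ i, q i ≤ 1) ∧
      ∑ i, q i ≤ Real.exp (α * t / 64) ∧ ∑ i, lam i * (1 - q i) ≤ Real.exp (-t / 16)) :
    Real.log (∑ i, lam i ^ α) ≤ α * T := by
  have hT0 : 0 < T := by
    by_contra hcon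
    have : α * T ≤ 0 := mul_nonpos_of_nonneg_of_nonpos hα.le (not_lt.1 hcon)
    linarith
  set y := α * T with hy
  have ht : ∀ j : ℕ, T ≤ T * (j + 1) := fun j =>
    le_mul_of_one_le_right hT0.le (by have : (0 : ℝ) ≤ j := by positivity
                                      linarith)
  choose q hq0 hq1 hqR hqe using fun j : ℕ => h (T * (j + 1)) (ht j)
  -- The remainder after enough blocks beats the dimension, so the final bound is independent of it.
  obtain ⟨J, hJ⟩ := exists_nat_gt ((Fintype.card ι : ℝ) + 1)
  have key := sum_rpow_le_of_weights hlam hsum hα hα1 (fun j => Real.exp_pos _)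
    (fun j => Real.exp_pos _) hq0 hq1 hqR hqe J
  have hterm : ∀ j : ℕ, Real.exp (α * (T * (((j + 1 : ℕ) : ℝ) + 1)) / 64) ^ (1 - α) *
      Real.exp (-(T * ((j : ℝ) + 1)) / 16) ^ α ≤ (1 / 2) ^ (j + 1) := by
    intro j
    rw [← Real.exp_mul, ← Real.exp_mul, ← Real.exp_add]
    have h2 : Real.exp (-1) ≤ 1 / 2 := by
      rw [Real.exp_neg, ← one_div]
      exact one_div_le_one_div_of_le (by norm_num) (by linarith [Real.add_one_le_exp (1 : ℝ)])
    have h3 : ((1 : ℝ) / 2) ^ (j + 1) ≥ Real.exp (-1) ^ (j + 1) := by gcongr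
    refine le_trans ?_ h3
    rw [← Real.exp_nat_mul]
    apply Real.exp_le_exp.2
    have hj : (0 : ℝ) ≤ j := by positivity
    push_cast
    have e1 : α * (T * ((j : ℝ) + 1 + 1)) / 64 * (1 - α) ≤ y * ((j : ℝ) + 2) / 64 := by
      have : 0 ≤ y * ((j : ℝ) + 2) / 64 := by positivity
      calc α * (T * ((j : ℝ) + 1 + 1)) / 64 * (1 - α) = y * ((j : ℝ) + 2) / 64 * (1 - α) := by
            rw [hy]; ring
        _ ≤ _ := mul_le_of_le_one_right this (by linarith)
    have e2 : -(T * ((j : ℝ) + 1)) / 16 * α = -(y * ((j : ℝ) + 1) / 16) := by rw [hy]; ring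
    rw [e2]
    have e3 : 64 * ((j : ℝ) + 1) ≤ y * ((j : ℝ) + 1) := by gcongr
    have e4 : 64 * (j : ℝ) ≤ y * (j : ℝ) := by gcongr
    nlinarith
  have hgeom : ∑ j ∈ Finset.range J, Real.exp (α * (T * (((j + 1 : ℕ) : ℝ) + 1)) / 64) ^ (1 - α) *
      Real.exp (-(T * ((j : ℝ) + 1)) / 16) ^ α ≤ 1 := by
    refine (Finset.sum_le_sum fun j _ => hterm j).trans ?_
    simp only [pow_succ, ← Finset.sum_mul]
    have := geom_sum_eq (show (1 / 2 : ℝ) ≠ 1 by norm_num) J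
    rw [this]
    have e1 : ((1 / 2 : ℝ) ^ J - 1) / (1 / 2 - 1) * (1 / 2) = 1 - (1 / 2) ^ J := by ring
    have : (0 : ℝ) < (1 / 2) ^ J := by positivity
    rw [e1]
    linarith
  have hlast : ((Fintype.card ι : ℝ) + 1) ^ (1 - α) * Real.exp (-(T * ((J : ℝ) + 1)) / 16) ^ α ≤ 1 := by
    have h1 : ((Fintype.card ι : ℝ) + 1) ^ (1 - α) ≤ Real.exp J := by
      calc ((Fintype.card ι : ℝ) + 1) ^ (1 - α) ≤ ((Fintype.card ι : ℝ) + 1) ^ (1 : ℝ) :=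
            Real.rpow_le_rpow_of_exponent_le (by
              have : (0 : ℝ) ≤ Fintype.card ι := by positivity
              linarith) (by linarith)
        _ ≤ J := by rw [Real.rpow_one]; exact hJ.le
        _ ≤ Real.exp J := by linarith [Real.add_one_le_exp (J : ℝ)]
    calc _ ≤ Real.exp J * Real.exp (-(T * ((J : ℝ) + 1)) / 16) ^ α := by gcongr
      _ = Real.exp (J - y * ((J : ℝ) + 1) / 16) := by
        rw [← Real.exp_mul, ← Real.exp_add]; congr 1; rw [hy]; ring
      _ ≤ 1 := by
        rw [Real.exp_le_one_iff]
        have hj : (0 : ℝ) ≤ J := by positivity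
        have : 64 * ((J : ℝ) + 1) ≤ y * ((J : ℝ) + 1) := by gcongr
        linarith
  have hfirst : Real.exp (α * (T * (((0 : ℕ) : ℝ) + 1)) / 64) ^ (1 - α) ≤ Real.exp (y / 64) := by
    rw [← Real.exp_mul]
    apply Real.exp_le_exp.2
    have e : α * (T * (((0 : ℕ) : ℝ) + 1)) / 64 = y / 64 := by rw [hy]; simp
    rw [e]
    exact mul_le_of_le_one_right (by linarith) (by linarith)
  have htot : ∑ i, lam i ^ α ≤ Real.exp y := by
    have h1 : Real.exp (y / 64) * 2 ≤ Real.exp y := by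
      calc Real.exp (y / 64) * 2 ≤ Real.exp (y / 64) * Real.exp (63 * (y / 64)) := by
            gcongr
            linarith [Real.add_one_le_exp (63 * (y / 64))]
        _ = Real.exp y := by rw [← Real.exp_add]; congr 1; ring
    have h2 : 2 ≤ Real.exp (y / 64) := by linarith [Real.add_one_le_exp (y / 64)]
    linarith
  rcases (Finset.sum_nonneg fun i (_ : i ∈ Finset.univ) =>
    Real.rpow_nonneg (hlam i) α).lt_or_eq with h0 | h0
  · exact (Real.log_le_log h0 htot).trans_eq (Real.log_exp y)
  · rw [← h0, Real.log_zero]; linarith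

/-- Rényi entropies with index above `1 / 2` are at most the one with index `1 / 2`. -/
theorem log_sum_rpow_le_half {lam : ι → ℝ} (hlam : ∀ i, 0 ≤ lam i) (hsum : ∑ i, lam i = 1) {α : ℝ}
    (hα : 1 / 2 < α) (hα1 : α < 1) :
    (1 - α)⁻¹ * Real.log (∑ i, lam i ^ α) ≤ 2 * Real.log (∑ i, lam i ^ (1 / 2 : ℝ)) := by
  have hle : ∀ β : ℝ, 0 < β → 0 < ∑ i, lam i ^ β := fun β hβ => by
    obtain ⟨i, -, hi⟩ := Finset.exists_ne_zero_of_sum_ne_zero (by rw [hsum]; norm_num :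
      ∑ i, lam i ≠ 0)
    exact Finset.sum_pos' (fun j _ => Real.rpow_nonneg (hlam j) β)
      ⟨i, Finset.mem_univ i, Real.rpow_pos_of_pos (lt_of_le_of_ne (hlam i) hi.symm) β⟩
  set Z := ∑ i, lam i ^ (1 / 2 : ℝ) with hZ
  -- With `√λ` as both weight and function, the exponent `2 * α - 1` reproduces `λ ^ α`, and the
  -- factor `2 - 2 * α` left on `Z` cancels `(1 - α)⁻¹`.
  have h1 := sum_mul_rpow_le (w := fun i => lam i ^ (1 / 2 : ℝ)) (lam := fun i => lam i ^ (1 / 2 : ℝ))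
    (α := 2 * α - 1) (R := Z) (e := 1) (fun i => Real.rpow_nonneg (hlam i) _)
    (fun i => Real.rpow_nonneg (hlam i) _) (by linarith) (by linarith) (hle _ (by norm_num)) one_pos
    le_rfl (by
      refine (Finset.sum_le_sum fun i _ => ?_).trans_eq hsum
      rw [← Real.rpow_add_of_nonneg (hlam i) (by norm_num) (by norm_num)]
      norm_num [Real.rpow_one])
  have h2 : ∑ i, lam i ^ (1 / 2 : ℝ) * (lam i ^ (1 / 2 : ℝ)) ^ (2 * α - 1) = ∑ i, lam i ^ α := by
    refine Finset.sum_congr rfl fun i _ => ?_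
    rw [← Real.rpow_mul (hlam i), ← Real.rpow_add_of_nonneg (hlam i) (by norm_num) (by linarith)]
    congr 1; ring
  rw [h2, Real.one_rpow, mul_one] at h1
  have h3 := Real.log_le_log (hle α (by linarith)) h1
  rw [Real.log_rpow (hle _ (by norm_num))] at h3
  rw [inv_mul_le_iff₀ (by linarith)]
  calc _ ≤ _ := h3
    _ = _ := by ring

/-- The von Neumann entropy is at most the Rényi entropy with index `1 / 2`. -/
theorem sum_negMulLog_le_half {lam : ι → ℝ} (hlam : ∀ i, 0 ≤ lam i) (hsum : ∑ i, lam i = 1) :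
    ∑ i, Real.negMulLog (lam i) ≤ 2 * Real.log (∑ i, lam i ^ (1 / 2 : ℝ)) := by
  set Z := ∑ i, lam i ^ (1 / 2 : ℝ) with hZ
  have hZ0 : 0 < Z := by
    obtain ⟨i, -, hi⟩ := Finset.exists_ne_zero_of_sum_ne_zero (by rw [hsum]; norm_num :
      ∑ i, lam i ≠ 0)
    exact Finset.sum_pos' (fun j _ => Real.rpow_nonneg (hlam j) _)
      ⟨i, Finset.mem_univ i, Real.rpow_pos_of_pos (lt_of_le_of_ne (hlam i) hi.symm) _⟩
  have h1 : ∀ i, Real.negMulLog (lam i) ≤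
      2 * (lam i ^ (1 / 2 : ℝ) / Z + lam i * (Real.log Z - 1)) := by
    intro i
    rcases (hlam i).lt_or_eq with h0 | h0
    -- Jensen's inequality for the logarithm, as a tangent line bound that becomes exact after
    -- summation.
    · have h2 := Real.log_le_sub_one_of_pos
        (show 0 < lam i ^ (-(1 / 2) : ℝ) / Z by positivity)
      rw [Real.log_div (by positivity) hZ0.ne', Real.log_rpow h0] at h2
      have h3 : lam i * (lam i ^ (-(1 / 2) : ℝ) / Z) = lam i ^ (1 / 2 : ℝ) / Z := by
        rw [mul_div_assoc']
        congr 1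
        nth_rewrite 1 [← Real.rpow_one (lam i)]
        rw [← Real.rpow_add h0]; norm_num
      have h4 := mul_le_mul_of_nonneg_left h2 h0.le
      rw [Real.negMulLog]
      rw [mul_sub, mul_sub, h3] at h4
      linarith
    · rw [← h0]
      simp [Real.negMulLog]
  calc ∑ i, Real.negMulLog (lam i)
      ≤ ∑ i, 2 * (lam i ^ (1 / 2 : ℝ) / Z + lam i * (Real.log Z - 1)) :=
        Finset.sum_le_sum fun i _ => h1 i
    _ = 2 * (Z / Z + 1 * (Real.log Z - 1)) := by
        rw [← Finset.mul_sum, Finset.sum_add_distrib, ← Finset.sum_div, ← Finset.sum_mul, hsum]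
    _ = _ := by rw [div_self hZ0.ne']; ring

end PowerSums
end

/-! ### Low-rank approximations and the spectrum of the reduced density matrix. -/

noncomputable section

/-- Take for `q i` the squared length of the projection of `u i` to `V`. The sum is the trace of
that projection, and the missed mass is the part of the vectors `m b` orthogonal to `V`. Fractional
weights avoid having to order the eigenvalues. -/
theorem exists_weights_of_span {E ι B : Type*} [NormedAddCommGroup E] [InnerProductSpace ℂ E]
    [FiniteDimensional ℂ E] [Fintype ι] [DecidableEq ι] [Fintype B] (u : OrthonormalBasis ι ℂ E)
    {m x : B → E} {lam : ι → ℝ}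
    (hlam : ∀ i j, ∑ b, inner ℂ (u i) (m b) * inner ℂ (m b) (u j) = if i = j then (lam i : ℂ) else 0)
    {V : Submodule ℂ E} (hx : ∀ b, x b ∈ V) :
    ∃ q : ι → ℝ, (∀ i, 0 ≤ q i) ∧ (∀ i, q i ≤ 1) ∧ ∑ i, q i = Module.finrank ℂ V ∧
      ∑ i, lam i * (1 - q i) ≤ ∑ b, ‖m b - x b‖ ^ 2 := by
  let w := stdOrthonormalBasis ℂ Vᗮ
  have hw : Orthonormal ℂ fun j => (w j : E) := w.orthonormal.comp_linearIsometry Vᗮ.subtypeₗᵢ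
  refine ⟨fun i => 1 - ∑ j, ‖inner ℂ (w j : E) (u i)‖ ^ 2, fun i => ?_, fun i => ?_, ?_, ?_⟩
  · have := hw.sum_inner_products_le (u i) (s := Finset.univ)
    rw [u.norm_eq_one, one_pow] at this
    linarith
  · have : 0 ≤ ∑ j, ‖inner ℂ (w j : E) (u i)‖ ^ 2 := by positivity
    linarith
  · rw [Finset.sum_sub_distrib, Finset.sum_comm]
    have h1 : ∀ j, ∑ i, ‖inner ℂ (w j : E) (u i)‖ ^ 2 = 1 := fun j => by
      rw [u.sum_sq_norm_inner_left]
      have := w.norm_eq_one j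
      rw [Submodule.coe_norm] at this
      rw [this, one_pow]
    simp only [h1, Finset.sum_const, Finset.card_univ, nsmul_eq_mul, mul_one, Fintype.card_fin]
    have h2 := V.finrank_add_finrank_orthogonal
    rw [Module.finrank_eq_card_basis u.toBasis] at h2
    rw [← h2]; push_cast; ring
  · have h1 : ∀ v : E, ∑ i, lam i * ‖inner ℂ v (u i)‖ ^ 2 = ∑ b, ‖inner ℂ v (m b)‖ ^ 2 := by
      intro v
      have hc : ∀ a b : E, ((‖inner ℂ a b‖ ^ 2 : ℝ) : ℂ) = inner ℂ a b * inner ℂ b a := fun a b => by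
        rw [← inner_conj_symm b a, Complex.mul_conj, Complex.normSq_eq_norm_sq]
      rw [← Complex.ofReal_inj]
      push_cast
      simp only [← Complex.ofReal_pow, hc]
      calc ∑ i, (lam i : ℂ) * (inner ℂ v (u i) * inner ℂ (u i) v)
          = ∑ i, ∑ j, inner ℂ v (u i) * inner ℂ (u j) v *
              ∑ b, inner ℂ (u i) (m b) * inner ℂ (m b) (u j) := by
            refine Finset.sum_congr rfl fun i _ => ?_
            simp only [hlam, mul_ite, mul_zero, Finset.sum_ite_eq, Finset.mem_univ, if_true]
            ring
        _ = ∑ b, (∑ i, inner ℂ v (u i) * inner ℂ (u i) (m b)) *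
              ∑ j, inner ℂ (m b) (u j) * inner ℂ (u j) v := by
            simp only [Finset.mul_sum, Finset.sum_mul]
            rw [Finset.sum_comm' (t' := Finset.univ) (s' := fun _ => Finset.univ) (by simp)]
            rw [Finset.sum_congr rfl fun j _ => Finset.sum_comm, Finset.sum_comm]
            refine Finset.sum_congr rfl fun b _ => Finset.sum_congr rfl fun i _ =>
              Finset.sum_congr rfl fun j _ => ?_
            ring
        _ = _ := by simp only [u.sum_inner_mul_inner]
    simp only [sub_sub_cancel, Finset.mul_sum]
    rw [Finset.sum_comm]
    simp only [h1]
    rw [Finset.sum_comm]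
    refine Finset.sum_le_sum fun b _ => ?_
    have h2 := hw.sum_inner_products_le (m b - x b) (s := Finset.univ)
    refine le_trans (le_of_eq ?_) h2
    refine Finset.sum_congr rfl fun j _ => ?_
    rw [inner_sub_right, Submodule.inner_left_of_mem_orthogonal (hx b) (w j).2, sub_zero]

namespace SpinChain
variable {n d : ℕ}

/-- The columns of the coefficient matrix. -/
def cutColumn (k : ℕ) (ψ : Space n d) (b : {i : Fin n // ¬ i.1 < k} → Fin d) :
    EuclideanSpace ℂ ({i : Fin n // i.1 < k} → Fin d) := WithLp.toLp 2 fun a => cutMatrix k ψ a b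

theorem sum_norm_sq_cutColumn (k : ℕ) (ψ : Space n d) : ∑ b, ‖cutColumn k ψ b‖ ^ 2 = ‖ψ‖ ^ 2 := by
  simp only [EuclideanSpace.norm_sq_eq, cutColumn, cutMatrix]
  rw [Finset.sum_comm, ← Fintype.sum_prod_type']
  exact Equiv.sum_comp (Equiv.piEquivPiSubtypeProd (fun i : Fin n => i.1 < k) fun _ => Fin d).symm
    fun σ => ‖ψ σ‖ ^ 2

theorem cutColumn_sub (k : ℕ) (ψ φ : Space n d) (b) :
    cutColumn k (ψ - φ) b = cutColumn k ψ b - cutColumn k φ b := rfl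

/-- Column rank equals row rank, and the rows of the coefficient matrix are restrictions of those
spanning `rowSpace`. -/
theorem finrank_span_cutColumn_le (k : ℕ) (ψ : Space n d) :
    Module.finrank ℂ (Submodule.span ℂ (Set.range (cutColumn k ψ))) ≤ schmidtRank k ψ := by
  have h1 : Module.finrank ℂ (Submodule.span ℂ (Set.range (cutColumn k ψ))) = (cutMatrix k ψ).rank := by
    rw [Matrix.rank_eq_finrank_span_cols]
    have : Set.range (cutColumn k ψ) = (WithLp.linearEquiv 2 ℂ _).symm '' (Set.range (cutMatrix k ψ).col) := by
      rw [← Set.range_comp]; rfl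
    rw [this]
    refine Eq.trans (congrArg (fun S : Submodule ℂ _ => Module.finrank ℂ S)
      (Submodule.map_span (WithLp.linearEquiv 2 ℂ _).symm.toLinearMap _).symm) ?_
    exact LinearEquiv.finrank_map_eq _ _
  rw [h1, Matrix.rank_eq_finrank_span_row]
  rcases isEmpty_or_nonempty (Config n d) with hC | ⟨⟨σ⟩⟩
  · have : ∀ a, cutMatrix k ψ a = 0 := fun a => by
      funext b
      exact hC.elim ((Equiv.piEquivPiSubtypeProd (fun i : Fin n => i.1 < k) fun _ => Fin d).symm (a, b))
    have h2 : Submodule.span ℂ (Set.range (cutMatrix k ψ).row) = ⊥ := by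
      rw [Submodule.span_eq_bot]
      rintro _ ⟨a, rfl⟩
      exact this a
    rw [h2, finrank_bot]; omega
  · let e := Equiv.piEquivPiSubtypeProd (fun i : Fin n => i.1 < k) fun _ => Fin d
    let L : Space n d →ₗ[ℂ] ({i : Fin n // ¬ i.1 < k} → Fin d) → ℂ :=
      { toFun := fun ξ b => ξ (e.symm ((e σ).1, b))
        map_add' := fun _ _ => rfl
        map_smul' := fun _ _ => rfl }
    refine (Submodule.finrank_mono (t := (rowSpace k ψ).map L) ?_).trans (Submodule.finrank_map_le _ _)
    rw [Submodule.span_le]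
    rintro _ ⟨a, rfl⟩
    refine ⟨_, pullback_mem_rowSpace k ψ (e.symm (a, (e σ).2)), ?_⟩
    funext b
    refine congrArg ψ.ofLp (funext fun i => ?_)
    simp only [splice, e, Equiv.piEquivPiSubtypeProd_symm_apply]
    split_ifs <;> rfl

theorem sum_inner_cutColumn (k : ℕ) (ψ : Space n d) (i j) :
    ∑ b, inner ℂ ((reducedDensity_isHermitian k ψ).eigenvectorBasis i) (cutColumn k ψ b) *
      inner ℂ (cutColumn k ψ b) ((reducedDensity_isHermitian k ψ).eigenvectorBasis j) =
      if i = j then ((reducedDensity_isHermitian k ψ).eigenvalues i : ℂ) else 0 := by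
  set h := reducedDensity_isHermitian k ψ
  set u := h.eigenvectorBasis
  have h1 : ∑ b, inner ℂ (u i) (cutColumn k ψ b) * inner ℂ (cutColumn k ψ b) (u j) =
      ∑ a, star (u i a) * (reducedDensity k ψ *ᵥ u j) a := by
    simp only [PiLp.inner_apply, cutColumn, RCLike.inner_apply, reducedDensity, Matrix.mulVec,
      dotProduct, Matrix.mul_apply, Matrix.conjTranspose_apply, Finset.mul_sum, Finset.sum_mul]
    rw [Finset.sum_comm]
    simp only [starRingEnd_apply]
    rw [Finset.sum_congr rfl fun a _ => Finset.sum_comm, Finset.sum_comm,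
      Finset.sum_congr rfl fun a _ => Finset.sum_comm]
    refine Finset.sum_congr rfl fun a _ => ?_
    rw [Finset.sum_comm]
    refine Finset.sum_congr rfl fun a' _ => Finset.sum_congr rfl fun b _ => ?_
    ring
  rw [h1, h.mulVec_eigenvectorBasis j]
  have h2 : ∑ a, star (u i a) * ((h.eigenvalues j • ⇑(u j)) a) = (h.eigenvalues j : ℂ) * inner ℂ (u i) (u j) := by
    simp only [PiLp.inner_apply, RCLike.inner_apply, Finset.mul_sum, Pi.smul_apply, starRingEnd_apply]
    refine Finset.sum_congr rfl fun a _ => ?_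
    rw [Complex.real_smul]; ring
  refine h2.trans ?_
  rw [OrthonormalBasis.inner_eq_ite]
  split_ifs with hij
  · rw [hij, mul_one]
  · rw [mul_zero]

theorem eigenvalues_reducedDensity_nonneg (k : ℕ) (ψ : Space n d) (i) :
    0 ≤ (reducedDensity_isHermitian k ψ).eigenvalues i :=
  (Matrix.posSemidef_self_mul_conjTranspose (cutMatrix k ψ)).eigenvalues_nonneg i

theorem sum_eigenvalues_reducedDensity (k : ℕ) (ψ : Space n d) :
    ∑ i, (reducedDensity_isHermitian k ψ).eigenvalues i = ‖ψ‖ ^ 2 := by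
  have h1 : ∀ i, (reducedDensity_isHermitian k ψ).eigenvalues i =
      ∑ b, ‖inner ℂ ((reducedDensity_isHermitian k ψ).eigenvectorBasis i) (cutColumn k ψ b)‖ ^ 2 := by
    intro i
    have := sum_inner_cutColumn k ψ i i
    rw [if_pos rfl] at this
    rw [← Complex.ofReal_inj, ← this]
    push_cast
    refine Finset.sum_congr rfl fun b _ => ?_
    rw [← inner_conj_symm (cutColumn k ψ b), Complex.mul_conj, Complex.normSq_eq_norm_sq]
    push_cast; rfl
  simp only [h1]
  rw [Finset.sum_comm, ← sum_norm_sq_cutColumn k ψ]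
  refine Finset.sum_congr rfl fun b _ => ?_
  exact OrthonormalBasis.sum_sq_norm_inner_right _ _

/-- A state of low Schmidt rank near `ψ` bounds the weight of the reduced density matrix outside
few dimensions. -/
theorem exists_weights_of_schmidtRank (k : ℕ) (ψ y : Space n d) :
    ∃ q : ({i : Fin n // i.1 < k} → Fin d) → ℝ, (∀ i, 0 ≤ q i) ∧ (∀ i, q i ≤ 1) ∧
      ∑ i, q i ≤ (schmidtRank k y : ℝ) ∧
      ∑ i, (reducedDensity_isHermitian k ψ).eigenvalues i * (1 - q i) ≤ ‖ψ - y‖ ^ 2 := by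
  obtain ⟨q, h0, h1, h2, h3⟩ := exists_weights_of_span
    (reducedDensity_isHermitian k ψ).eigenvectorBasis (m := cutColumn k ψ) (x := cutColumn k y)
    (sum_inner_cutColumn k ψ) (V := Submodule.span ℂ (Set.range (cutColumn k y)))
    (fun b => Submodule.subset_span ⟨b, rfl⟩)
  refine ⟨q, h0, h1, ?_, ?_⟩
  · rw [h2]; exact_mod_cast finrank_span_cutColumn_le k y
  · rw [← sum_norm_sq_cutColumn k (ψ - y)]
    simpa only [cutColumn_sub] using h3

end SpinChain
end

/-! ### Entropy bounds. -/

noncomputable section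

theorem Real.half_le_log_two_add {Y : ℝ} (hY : 0 ≤ Y) : 1 / 2 ≤ Real.log (2 + Y) :=
  le_trans (by linarith [Real.log_two_gt_d9]) (Real.log_le_log two_pos (by linarith))

/-- Constant factors and squares are absorbed into a logarithm. -/
theorem log_le_mul_log_two_add {A Y f : ℝ} (hA : 0 < A) (hY : 0 ≤ Y) (hf : 0 ≤ f)
    (h : A ≤ (1 + f) ^ 2 * (2 + Y) ^ 2) : Real.log A ≤ (2 + 4 * f) * Real.log (2 + Y) := by
  have h1 := Real.log_le_log hA h
  rw [Real.log_mul (by positivity) (by positivity), Real.log_pow, Real.log_pow] at h1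
  have h2 : Real.log (1 + f) ≤ f := by
    have := Real.log_le_sub_one_of_pos (show 0 < 1 + f by linarith)
    linarith
  have h3 := Real.half_le_log_two_add hY
  have h4 : f * (1 / 2) ≤ f * Real.log (2 + Y) := by gcongr
  push_cast at h1
  linarith

namespace SpinChain

theorem softBound_mul_eight_le {C Y : ℝ} (hC : 0 ≤ C) (hY : 0 ≤ Y) :
    softBound C 4 (8 * Y) ≤ softBound (2048 * C) 4 Y := by
  have h1 : Real.log (2 + 8 * Y) ≤ 4 * Real.log (2 + Y) := by
    have h2 : Real.log (2 + 8 * Y) ≤ Real.log ((2 + Y) ^ 4) := by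
      apply Real.log_le_log (by linarith)
      nlinarith [pow_nonneg hY 2, pow_nonneg hY 3, pow_nonneg hY 4]
    rw [Real.log_pow] at h2
    exact_mod_cast h2
  have h0 : 0 ≤ Real.log (2 + 8 * Y) := Real.log_nonneg (by linarith)
  unfold softBound
  calc C * (8 * Y * Real.log (2 + 8 * Y) ^ 4) ≤ C * (8 * Y * (4 * Real.log (2 + Y)) ^ 4) := by gcongr
    _ = _ := by ring

theorem exists_log_sum_rpow_bound (d f : ℕ) : ∃ C : ℝ, 0 ≤ C ∧ ∀ (n : ℕ)
    (h : Fin (n - 1) → Matrix (Fin d × Fin d) (Fin d × Fin d) ℂ) (E₀ ε : ℝ), IsGapped h f E₀ ε →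
    ∀ ψ : Space n d, IsGroundState h E₀ ψ → ∀ (k : ℕ) (α : ℝ), 0 < α → α < 1 →
      Real.log (∑ a, (reducedDensity_isHermitian k ψ).eigenvalues a ^ α) ≤
        softBound C 4 (α ^ (-3 : ℝ) / ε) := by
  obtain ⟨C₀, c, hC₀, hc, happ⟩ := exists_lowRank_approx d f
  obtain ⟨C₁, hC₁, hth⟩ := exists_polylog_threshold ((64 * c) ^ 4)
  set C := max (max C₀ C₁) 64 with hC
  have hCC₀ : C₀ ≤ C := (le_max_left _ _).trans (le_max_left _ _)
  have hCC₁ : C₁ ≤ C := (le_max_right _ _).trans (le_max_left _ _)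
  have hC64 : 64 ≤ C := le_max_right _ _
  refine ⟨C * f * (2 + 4 * f) ^ 4, by positivity, ?_⟩
  intro n h E₀ ε hg ψ hψ k α hα hα1
  have hε := hg.pos
  have hf1 : (1 : ℝ) ≤ f := by exact_mod_cast hg.finrank_pos
  have hεf := hg.gap_le
  obtain ⟨x, hx⟩ : ∃ x, x = (min ε 1)⁻¹ := ⟨_, rfl⟩
  have hx1 : 1 ≤ x := by
    rw [hx]; exact (one_le_inv₀ (lt_min hε one_pos)).2 (min_le_right _ _)
  have hxf : x ≤ f / ε := by
    rw [hx, inv_le_comm₀ (lt_min hε one_pos) (by positivity), inv_div]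
    refine le_min ?_ ?_
    · exact div_le_self hε.le hf1
    · exact (div_le_one (by linarith)).2 hεf
  set β := α⁻¹ with hβ
  have hβ1 : 1 ≤ β := (one_le_inv₀ hα).2 hα1.le
  have hαβ : α * β = 1 := mul_inv_cancel₀ hα.ne'
  -- The rank exponent `c t ^ (3/4) x ^ (1/4) log t` has to stay below `α t / 64`. Its fourth power
  -- reads `t ≥ (64 c) ^ 4 x α ^ (-4) log ^ 4 t`, whence the fourth power of `β`; the final bound `α
  -- T` gives one power back (`hα_X`).
  set X := x * β ^ 4 with hX
  have hβ4 : 1 ≤ β ^ 4 := one_le_pow₀ hβ1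
  have hxX : x ≤ X := le_mul_of_one_le_right (by linarith) hβ4
  have hX1 : 1 ≤ X := hx1.trans hxX
  have hL := Real.one_le_log_two_add hX1
  have hLx := Real.one_le_log_two_add hx1
  set T := C * (X * Real.log (2 + X) ^ 4) with hT
  have hβX : β ≤ X := by
    calc β ≤ β ^ 4 := le_self_pow₀ hβ1 (by norm_num)
      _ ≤ X := le_mul_of_one_le_left (by positivity) hx1
  have hXL : X ≤ X * Real.log (2 + X) ^ 4 := le_mul_of_one_le_right (by linarith) (one_le_pow₀ hL)
  have hT64 : 64 ≤ α * T := by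
    calc (64 : ℝ) = α * (64 * β) := by rw [mul_left_comm, hαβ, mul_one]
      _ ≤ α * (C * (X * Real.log (2 + X) ^ 4)) := by gcongr; exact hβX.trans hXL
  have key := log_sum_rpow_le (eigenvalues_reducedDensity_nonneg k ψ)
    (by rw [sum_eigenvalues_reducedDensity, hψ.2]; norm_num) hα hα1 hT64 (by
      intro t ht
      have ht0 : C₀ * (x * Real.log (2 + x) ^ 4) ≤ t := by
        refine le_trans ?_ ht
        have : Real.log (2 + x) ≤ Real.log (2 + X) := Real.log_le_log (by linarith) (by linarith)
        rw [hT]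
        gcongr
      have ht1 := hth X t hX1 (le_trans (by rw [hT]; gcongr) ht)
      obtain ⟨y, hy, hψy⟩ := happ n h E₀ ε hg ψ hψ k x t hx ht0
      obtain ⟨q, h0, h1, h2, h3⟩ := exists_weights_of_schmidtRank k ψ y
      have ht_pos : 0 ≤ t := le_trans (by positivity) ht1
      refine ⟨q, h0, h1, h2.trans (hy.trans (Real.exp_le_exp.2 ?_)), h3.trans ?_⟩
      · set S := t ^ (3 / 4 : ℝ) * x ^ (1 / 4 : ℝ) with hS
        have hS4 : S ^ 4 = t ^ 3 * x := by
          rw [hS, mul_pow, ← Real.rpow_natCast, ← Real.rpow_natCast, ← Real.rpow_mul (by linarith),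
            ← Real.rpow_mul (by linarith)]
          norm_num
        have h5 : 64 * c * β * (S * Real.log (2 + t)) ≤ t := by
          refine le_of_pow_le_pow_left₀ (n := 4) (by norm_num) ht_pos ?_
          calc (64 * c * β * (S * Real.log (2 + t))) ^ 4
              = (64 * c) ^ 4 * β ^ 4 * (S ^ 4 * Real.log (2 + t) ^ 4) := by ring
            _ = t ^ 3 * ((64 * c) ^ 4 * (X * Real.log (2 + t) ^ 4)) := by rw [hS4, hX]; ring
            _ ≤ t ^ 3 * t := by gcongr
            _ = t ^ 4 := by ring
        have h6 := mul_le_mul_of_nonneg_left h5 hα.le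
        have h7 : α * (64 * c * β * (S * Real.log (2 + t))) = 64 * (c * (S * Real.log (2 + t))) := by
          calc _ = α * β * (64 * (c * (S * Real.log (2 + t)))) := by ring
            _ = _ := by rw [hαβ, one_mul]
        linarith
      · calc ‖ψ - y‖ ^ 2 ≤ Real.exp (-t / 32) ^ 2 := by gcongr
          _ = Real.exp (-t / 16) := by rw [← Real.exp_nat_mul]; congr 1; push_cast; ring)
  refine key.trans ?_
  have hα3 : α ^ (-3 : ℝ) = β ^ 3 := by
    rw [Real.rpow_neg hα.le, hβ, inv_pow]; norm_cast
  rw [hα3]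
  set Y := β ^ 3 / ε with hY
  have hY0 : 0 < Y := by positivity
  have hxY : x * β ^ 3 ≤ f * Y := by
    calc x * β ^ 3 ≤ f / ε * β ^ 3 := by gcongr
      _ = f * Y := by rw [hY]; ring
  have hβY : β ≤ f * Y := by
    calc β ≤ β ^ 3 := le_self_pow₀ hβ1 (by norm_num)
      _ = ε * Y := by rw [hY]; field_simp
      _ ≤ f * Y := by gcongr
  have hXY : X ≤ (f * Y) ^ 2 := by
    calc X = x * β ^ 3 * β := by rw [hX]; ring
      _ ≤ f * Y * (f * Y) := by gcongr
      _ = _ := by ring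
  have hlog : Real.log (2 + X) ≤ (2 + 4 * f) * Real.log (2 + Y) := by
    refine log_le_mul_log_two_add (by linarith) hY0.le (by linarith) ?_
    have h1 : (f * Y) ^ 2 ≤ ((1 + f) * (2 + Y)) ^ 2 - 2 := by
      have h2 : 2 ≤ ((1 + f) * (2 + Y) - f * Y) := by nlinarith
      have h3 : 0 ≤ f * Y := by positivity
      nlinarith
    rw [← mul_pow]
    linarith
  have hα_X : α * X = x * β ^ 3 := by
    calc α * X = α * β * (x * β ^ 3) := by rw [hX]; ring
      _ = _ := by rw [hαβ, one_mul]
  unfold softBound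
  calc α * T = C * (α * X * Real.log (2 + X) ^ 4) := by rw [hT]; ring
    _ ≤ C * (f * Y * ((2 + 4 * f) * Real.log (2 + Y)) ^ 4) := by
      rw [hα_X]
      gcongr
    _ = _ := by ring

theorem exists_two_mul_log_sum_sqrt_bound (d f : ℕ) : ∃ C : ℝ, 0 ≤ C ∧ ∀ (n : ℕ)
    (h : Fin (n - 1) → Matrix (Fin d × Fin d) (Fin d × Fin d) ℂ) (E₀ ε : ℝ), IsGapped h f E₀ ε →
    ∀ ψ : Space n d, IsGroundState h E₀ ψ → ∀ k : ℕ,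
      2 * Real.log (∑ a, (reducedDensity_isHermitian k ψ).eigenvalues a ^ (1 / 2 : ℝ)) ≤
        softBound C 4 ε⁻¹ := by
  obtain ⟨C, hC, hb⟩ := exists_log_sum_rpow_bound d f
  refine ⟨2048 * (2 * C), by positivity, fun n h E₀ ε hg ψ hψ k => ?_⟩
  have h1 := hb n h E₀ ε hg ψ hψ k (1 / 2) (by norm_num) (by norm_num)
  have h2 : ((1 : ℝ) / 2) ^ (-3 : ℝ) / ε = 8 * ε⁻¹ := by
    rw [Real.rpow_neg (by norm_num)]; norm_num; ring
  rw [h2] at h1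
  refine le_trans ?_ (softBound_mul_eight_le (by positivity) (inv_pos.2 hg.pos).le)
  unfold softBound at h1 ⊢
  linarith

/-- Area law for Rényi entropies. -/
theorem exists_renyiEntropy_bound (d f : ℕ) : ∃ (C : ℝ) (k : ℕ), ∀ (n : ℕ)
      (h : Fin (n - 1) → Matrix (Fin d × Fin d) (Fin d × Fin d) ℂ) (E₀ ε : ℝ),
      IsGapped h f E₀ ε → ∀ ψ : Space n d, IsGroundState h E₀ ψ →
      ∀ α : ℝ, 0 < α → α < 1 → ∀ cut : ℕ, 0 < cut → cut < n →
        renyiEntropy α cut ψ ≤ softBound C k (α ^ (-3 : ℝ) / ε) := by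
  obtain ⟨C₁, hC₁, hb₁⟩ := exists_log_sum_rpow_bound d f
  obtain ⟨C₂, hC₂, hb₂⟩ := exists_two_mul_log_sum_sqrt_bound d f
  refine ⟨2 * C₁ + C₂, 4, fun n h E₀ ε hg ψ hψ α hα hα1 k _ _ => ?_⟩
  have hε := hg.pos
  have hα3 : 1 ≤ α ^ (-3 : ℝ) := Real.one_le_rpow_of_pos_of_le_one_of_nonpos hα hα1.le (by norm_num)
  have hY : ε⁻¹ ≤ α ^ (-3 : ℝ) / ε := by
    rw [div_eq_mul_inv]; exact le_mul_of_one_le_left (by positivity) hα3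
  set Y := α ^ (-3 : ℝ) / ε
  have hε' : 0 < ε⁻¹ := inv_pos.2 hε
  have hY0 : 0 < Y := hε'.trans_le hY
  have hLY : 0 ≤ Real.log (2 + Y) := Real.log_nonneg (by linarith)
  have hadd : softBound (2 * C₁ + C₂) 4 Y = 2 * softBound C₁ 4 Y + softBound C₂ 4 Y := by
    unfold softBound; ring
  have h1 : 0 ≤ softBound C₁ 4 Y := by unfold softBound; positivity
  have h2 : 0 ≤ softBound C₂ 4 Y := by unfold softBound; positivity
  rw [hadd, renyiEntropy]
  -- Up to `1 / 2` the prefactor `(1 - α)⁻¹` is at most `2`; beyond it blows up, and the comparison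
  -- with index `1 / 2` takes over.
  rcases le_or_gt α (1 / 2) with h | h
  · have h3 := hb₁ n _ E₀ ε hg ψ hψ k α hα hα1
    have h4 : (1 - α)⁻¹ ≤ 2 := by
      rw [inv_le_comm₀ (by linarith) two_pos]; linarith
    have h5 : 0 < (1 - α)⁻¹ := inv_pos.2 (by linarith)
    calc _ ≤ (1 - α)⁻¹ * softBound C₁ 4 Y := by gcongr
      _ ≤ 2 * softBound C₁ 4 Y := by gcongr
      _ ≤ _ := by linarith
  · have h3 := log_sum_rpow_le_half (eigenvalues_reducedDensity_nonneg k ψ)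
      (by rw [sum_eigenvalues_reducedDensity, hψ.2]; norm_num) h hα1
    have h4 := hb₂ n _ E₀ ε hg ψ hψ k
    have h5 : softBound C₂ 4 ε⁻¹ ≤ softBound C₂ 4 Y := by
      unfold softBound
      have : 0 ≤ Real.log (2 + ε⁻¹) := Real.log_nonneg (by linarith)
      have : Real.log (2 + ε⁻¹) ≤ Real.log (2 + Y) := Real.log_le_log (by linarith) (by linarith)
      gcongr
    linarith

/-- Area law for the von Neumann entropy. -/
theorem exists_vonNeumannEntropy_bound (d f : ℕ) : ∃ (C : ℝ) (k : ℕ), ∀ (n : ℕ)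
      (h : Fin (n - 1) → Matrix (Fin d × Fin d) (Fin d × Fin d) ℂ) (E₀ ε : ℝ),
      IsGapped h f E₀ ε → ∀ ψ : Space n d, IsGroundState h E₀ ψ →
      ∀ cut : ℕ, 0 < cut → cut < n → vonNeumannEntropy cut ψ ≤ softBound C k ε⁻¹ := by
  obtain ⟨C, hC, hb⟩ := exists_two_mul_log_sum_sqrt_bound d f
  refine ⟨C, 4, fun n h E₀ ε hg ψ hψ k _ _ => ?_⟩
  exact (sum_negMulLog_le_half (eigenvalues_reducedDensity_nonneg k ψ)
    (by rw [sum_eigenvalues_reducedDensity, hψ.2]; norm_num)).trans (hb n h E₀ ε hg ψ hψ k)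

end SpinChain
end

noncomputable section

/-! ### Truncating at all cuts simultaneously. -/

namespace SpinChain
variable {n d : ℕ}

/-- The splitting of a configuration at a cut. -/
abbrev splitEquiv (n d k : ℕ) :
    Config n d ≃ ({i : Fin n // i.1 < k} → Fin d) × ({i : Fin n // ¬ i.1 < k} → Fin d) :=
  Equiv.piEquivPiSubtypeProd (fun i : Fin n => i.1 < k) fun _ => Fin d

/-- An operator on the first `k` sites, as an operator on the chain. -/
def leftOp (k : ℕ) (T : EuclideanSpace ℂ ({i : Fin n // i.1 < k} → Fin d) →L[ℂ]
    EuclideanSpace ℂ ({i : Fin n // i.1 < k} → Fin d)) : Op n d :=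
  LinearMap.toContinuousLinearMap
    { toFun := fun ψ => WithLp.toLp 2 fun σ =>
        T (cutColumn k ψ (splitEquiv n d k σ).2) (splitEquiv n d k σ).1
      map_add' := fun ψ φ => by
        ext σ
        have : ∀ b, cutColumn k (ψ + φ) b = cutColumn k ψ b + cutColumn k φ b := fun b => rfl
        simp [this]
      map_smul' := fun c ψ => by
        ext σ
        have : ∀ b, cutColumn k (c • ψ) b = c • cutColumn k ψ b := fun b => rfl
        simp [this] }

theorem leftOp_apply (k : ℕ) (T : EuclideanSpace ℂ ({i : Fin n // i.1 < k} → Fin d) →L[ℂ]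
    EuclideanSpace ℂ ({i : Fin n // i.1 < k} → Fin d)) (ψ : Space n d) (σ : Config n d) :
    leftOp k T ψ σ = T (cutColumn k ψ (splitEquiv n d k σ).2) (splitEquiv n d k σ).1 := rfl

theorem cutColumn_leftOp (k : ℕ) (T : EuclideanSpace ℂ ({i : Fin n // i.1 < k} → Fin d) →L[ℂ]
    EuclideanSpace ℂ ({i : Fin n // i.1 < k} → Fin d)) (ψ : Space n d) (b) :
    cutColumn k (leftOp k T ψ) b = T (cutColumn k ψ b) := by
  ext a
  change leftOp k T ψ ((splitEquiv n d k).symm (a, b)) = _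
  rw [leftOp_apply, Equiv.apply_symm_apply]

theorem ext_cutColumn {k : ℕ} {ψ φ : Space n d} (h : ∀ b, cutColumn k ψ b = cutColumn k φ b) :
    ψ = φ := by
  ext σ
  have := congrArg (fun v : EuclideanSpace ℂ _ => v (splitEquiv n d k σ).1) (h (splitEquiv n d k σ).2)
  simp only [cutColumn, cutMatrix, Prod.mk.eta] at this
  rwa [Equiv.symm_apply_apply] at this

theorem leftOp_mem_leftAlg (k : ℕ) (T : EuclideanSpace ℂ ({i : Fin n // i.1 < k} → Fin d) →L[ℂ]
    EuclideanSpace ℂ ({i : Fin n // i.1 < k} → Fin d)) : leftOp k T ∈ leftAlg n d k := by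
  rw [mem_leftAlg]
  intro b ψ σ
  rw [leftOp_apply, leftOp_apply]
  have h1 : (splitEquiv n d k (splice k σ b)).1 = (splitEquiv n d k σ).1 := by
    funext i; simp [splice, i.2]
  have h2 : cutColumn k (pullback (fun τ => splice k τ b) ψ) (splitEquiv n d k σ).2 =
      cutColumn k ψ (splitEquiv n d k (splice k σ b)).2 := by
    ext a
    refine congrArg ψ.ofLp (funext fun i => ?_)
    by_cases hi : i.1 < k <;> simp [splice, hi, Equiv.piEquivPiSubtypeProd_symm_apply]
  rw [h1, h2]

theorem norm_leftOp_apply_le {k : ℕ} {T : EuclideanSpace ℂ ({i : Fin n // i.1 < k} → Fin d) →L[ℂ]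
    EuclideanSpace ℂ ({i : Fin n // i.1 < k} → Fin d)} (hT : ‖T‖ ≤ 1) (ψ : Space n d) :
    ‖leftOp k T ψ‖ ≤ ‖ψ‖ := by
  refine (sq_le_sq₀ (norm_nonneg _) (norm_nonneg _)).1 ?_
  rw [← sum_norm_sq_cutColumn k, ← sum_norm_sq_cutColumn k ψ]
  refine Finset.sum_le_sum fun b _ => ?_
  rw [cutColumn_leftOp]
  have := (T.le_opNorm (cutColumn k ψ b)).trans (mul_le_of_le_one_left (norm_nonneg _) hT)
  gcongr

/-- The projection of the first `k` sites onto the support of `y` on them. -/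
theorem exists_leftProjection (k : ℕ) (y : Space n d) : ∃ Q : Op n d, Q ∈ leftAlg n d k ∧
    Q y = y ∧ (∀ ψ, ‖Q ψ‖ ≤ ‖ψ‖) ∧ ∀ ψ, schmidtRank k (Q ψ) ≤ schmidtRank k y := by
  set V := Submodule.span ℂ (Set.range (cutColumn k y)) with hV
  refine ⟨leftOp k V.starProjection, leftOp_mem_leftAlg k _, ?_,
    norm_leftOp_apply_le V.starProjection_norm_le, fun ψ => ?_⟩
  · refine ext_cutColumn (k := k) fun b => ?_
    rw [cutColumn_leftOp]
    exact Submodule.starProjection_eq_self_iff.2 (Submodule.subset_span ⟨b, rfl⟩)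
  · refine le_trans ?_ (finrank_span_cutColumn_le k y)
    rw [← hV]
    let v := stdOrthonormalBasis ℂ V
    let g : Fin (Module.finrank ℂ V) → Space n d := fun j =>
      WithLp.toLp 2 fun τ => inner ℂ (v j : EuclideanSpace ℂ _) (cutColumn k ψ (splitEquiv n d k τ).2)
    have h1 : rowSpace k (leftOp k V.starProjection ψ) ≤ Submodule.span ℂ (Set.range g) := by
      rw [rowSpace, Submodule.span_le]
      rintro _ ⟨a, rfl⟩
      have h2 : pullback (splice k a) (leftOp k V.starProjection ψ) =
          ∑ j, (v j : EuclideanSpace ℂ _) (splitEquiv n d k a).1 • g j := by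
        ext τ
        have h3 : (splitEquiv n d k (splice k a τ)).1 = (splitEquiv n d k a).1 := by
          funext i; simp [splice, i.2]
        have h4 : (splitEquiv n d k (splice k a τ)).2 = (splitEquiv n d k τ).2 := by
          funext i; simp [splice, i.2]
        rw [pullback_apply, leftOp_apply, h3, h4, Submodule.starProjection_apply]
        have h5 := v.sum_repr (V.orthogonalProjectionOnto (cutColumn k ψ (splitEquiv n d k τ).2))
        rw [← h5]
        simp only [v.repr_apply_apply, Submodule.coe_sum, Submodule.coe_smul, WithLp.ofLp_sum,
          Finset.sum_apply, PiLp.smul_apply, smul_eq_mul, g]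
        refine Finset.sum_congr rfl fun j _ => ?_
        rw [mul_comm]
        congr 1
        rw [← Submodule.inner_orthogonalProjectionOnto_eq_of_mem_left]
      change pullback (splice k a) (leftOp k V.starProjection ψ) ∈ Submodule.span ℂ (Set.range g)
      rw [h2]
      exact Submodule.sum_mem _ fun j _ => Submodule.smul_mem _ _ (Submodule.subset_span ⟨j, rfl⟩)
    exact (Submodule.finrank_mono h1).trans ((finrank_range_le_card g).trans_eq (by simp))

/-- States that are close to states of low Schmidt rank at each cut are close to a state of low
Schmidt rank at all cuts. -/
theorem exists_low_schmidtRank_all_cuts {ψ : Space n d} {D : ℕ} {δ : ℝ}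
    (h : ∀ k, ∃ y : Space n d, schmidtRank k y ≤ D ∧ ‖ψ - y‖ ≤ δ) (m : ℕ) :
    ∃ φ : Space n d, (∀ k < m, schmidtRank k φ ≤ D) ∧ ‖ψ - φ‖ ≤ 2 * m * δ ∧ ‖φ‖ ≤ ‖ψ‖ := by
  -- The projection for a new cut is applied before those for smaller cuts. The latter act left of
  -- the new cut and so preserve the rank achieved there, while `Q` truncates any input at the
  -- smaller cuts.
  have key : ∀ m, ∃ Q : Op n d, (∀ ξ, ∀ k < m, schmidtRank k (Q ξ) ≤ D) ∧
      ‖ψ - Q ψ‖ ≤ 2 * m * δ ∧ (∀ ξ, ‖Q ξ‖ ≤ ‖ξ‖) ∧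
      ∀ ξ k, m ≤ k + 1 → schmidtRank k (Q ξ) ≤ schmidtRank k ξ := by
    intro m
    induction m with
    | zero =>
      exact ⟨1, fun ξ k hk => absurd hk (Nat.not_lt_zero k), by simp, fun ξ => by simp,
        fun ξ k _ => le_rfl⟩
    | succ m ih =>
      obtain ⟨Q, hQ1, hQ2, hQ3, hQ4⟩ := ih
      obtain ⟨y, hy, hψy⟩ := h m
      obtain ⟨P, hP, hPy, hPn, hPr⟩ := exists_leftProjection m y
      refine ⟨Q * P, fun ξ k hk => ?_, ?_, fun ξ => (hQ3 _).trans (hPn ξ), fun ξ k hk => ?_⟩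
      · rcases Nat.lt_succ_iff_lt_or_eq.1 hk with hk' | rfl
        · exact hQ1 _ k hk'
        · exact (hQ4 _ _ (Nat.le_succ _)).trans ((hPr ξ).trans hy)
      -- `P` fixes `y`, so the new error only involves `ψ - y`, and the errors add up instead of
      -- multiplying.
      · have e1 : ψ - (Q * P) ψ = (ψ - Q ψ) + Q ((ψ - y) - P (ψ - y)) := by
          rw [ContinuousLinearMap.mul_apply_eq, map_sub P, hPy, sub_sub_sub_cancel_right, map_sub Q]
          abel
        have e2 : ‖(ψ - y) - P (ψ - y)‖ ≤ 2 * δ :=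
          (norm_sub_le _ _).trans (by linarith [hPn (ψ - y)])
        rw [e1]
        refine (norm_add_le _ _).trans ((add_le_add hQ2 ((hQ3 _).trans e2)).trans_eq ?_)
        push_cast; ring
      · exact (hQ4 _ k (by omega)).trans (schmidtRank_leftAlg_le (by omega) hP ξ)
  obtain ⟨Q, h1, h2, h3, -⟩ := key m
  exact ⟨Q ψ, h1 ψ, h2, h3 ψ⟩

end SpinChain
end

/-! ### Matrix product states from Schmidt ranks. -/

noncomputable section

theorem Submodule.exists_coordinates {E : Type*} [AddCommGroup E] [Module ℂ E] {V : Submodule ℂ E}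
    [FiniteDimensional ℂ V] {D : ℕ} (h : Module.finrank ℂ V ≤ D) :
    ∃ (ι : (Fin D → ℂ) →ₗ[ℂ] E) (π : E →ₗ[ℂ] (Fin D → ℂ)), ∀ g ∈ V, ι (π g) = g := by
  obtain ⟨p, hp⟩ := V.subtype.exists_leftInverse_of_injective V.ker_subtype
  let b := Module.finBasis ℂ V
  have hli : LinearIndependent ℂ fun j => (Pi.basisFun ℂ (Fin D)) (Fin.castLE h j) :=
    (Pi.basisFun ℂ (Fin D)).linearIndependent.comp _ (Fin.castLE_injective h)
  let f : V →ₗ[ℂ] (Fin D → ℂ) := b.constr ℂ fun j => (Pi.basisFun ℂ (Fin D)) (Fin.castLE h j)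
  have hf : LinearMap.ker f = ⊥ := by
    refine LinearMap.ker_eq_bot.2 (b.injective_constr_of_linearIndependent (R₂ := ℂ) hli)
  obtain ⟨f', hf'⟩ := f.exists_leftInverse_of_injective hf
  refine ⟨V.subtype ∘ₗ f', f ∘ₗ p, fun g hg => ?_⟩
  have h1 : p g = ⟨g, hg⟩ := LinearMap.congr_fun hp ⟨g, hg⟩
  have h2 : f' (f ⟨g, hg⟩) = ⟨g, hg⟩ := LinearMap.congr_fun hf' ⟨g, hg⟩
  simp [h1, h2]

namespace SpinChain
variable {n d : ℕ}

/-- Fixing one more spin maps the row space at each cut to the next one. In coordinates, padded to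
dimension `D`, these maps are the matrices; after all spins are fixed the vector is constant with
value `φ σ`, read off at an arbitrary configuration `ρ`. -/
theorem isMPS_of_schmidtRank_le {D : ℕ} {φ : Space n d} (hC : Nonempty (Config n d))
    (h : ∀ k ≤ n, schmidtRank k φ ≤ D) : IsMPS D φ := by
  obtain ⟨ρ⟩ := hC
  have hex : ∀ k : ℕ, ∃ (ι : (Fin D → ℂ) →ₗ[ℂ] Space n d) (π : Space n d →ₗ[ℂ] (Fin D → ℂ)),
      k ≤ n → ∀ g ∈ rowSpace k φ, ι (π g) = g := by
    intro k
    by_cases hk : k ≤ n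
    · obtain ⟨ι, π, hι⟩ := Submodule.exists_coordinates (V := rowSpace k φ) (h k hk)
      exact ⟨ι, π, fun _ => hι⟩
    · exact ⟨0, 0, fun hk' => absurd hk' hk⟩
  choose ι π hιπ using hex
  let step : Fin n → Fin d → (Fin D → ℂ) →ₗ[ℂ] (Fin D → ℂ) := fun i x =>
    π (i + 1) ∘ₗ (pullback fun τ => Function.update τ i x : Space n d →ₗ[ℂ] Space n d) ∘ₗ ι i
  refine ⟨fun i x => (LinearMap.toMatrix' (step i x))ᵀ, π 0 φ,
    fun j => ι n (Pi.single j 1) ρ, fun σ => ?_⟩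
  have key : ∀ (m : ℕ) (hm : m ≤ n), π 0 φ ᵥ* (List.ofFn fun i : Fin m =>
      (LinearMap.toMatrix' (step (Fin.castLE hm i) (σ (Fin.castLE hm i))))ᵀ).prod =
        π m (pullback (splice m σ) φ) := by
    intro m
    induction m with
    | zero =>
      intro _
      have : pullback (splice 0 σ) φ = φ := by
        ext τ; exact congrArg φ.ofLp (funext fun i => by simp)
      simp [this]
    | succ m ih =>
      intro hm
      have hm' : m < n := hm
      rw [List.ofFn_succ', List.concat_eq_append, List.prod_append, List.prod_singleton,
        ← Matrix.vecMul_vecMul]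
      have e1 := ih hm'.le
      have e2 : (List.ofFn fun i : Fin m => (LinearMap.toMatrix' (step (Fin.castLE hm i.castSucc)
          (σ (Fin.castLE hm i.castSucc))))ᵀ) = List.ofFn fun i : Fin m =>
          (LinearMap.toMatrix' (step (Fin.castLE hm'.le i) (σ (Fin.castLE hm'.le i))))ᵀ := rfl
      rw [e2, e1, Matrix.vecMul_transpose, LinearMap.toMatrix'_mulVec]
      have e3 : Fin.castLE hm (Fin.last m) = ⟨m, hm'⟩ := rfl
      rw [e3]
      change π (m + 1) (pullback (fun τ => Function.update τ ⟨m, hm'⟩ (σ ⟨m, hm'⟩))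
        (ι m (π m (pullback (splice m σ) φ)))) = _
      rw [hιπ m hm'.le _ (pullback_mem_rowSpace m φ σ)]
      congr 1
      ext τ
      refine congrArg φ.ofLp (funext fun i => ?_)
      by_cases hi : i.1 < m
      · have : i.1 < m + 1 := by omega
        simp [splice, hi, this]
      · by_cases hi' : i.1 = m
        · have : i = ⟨m, hm'⟩ := Fin.ext hi'
          subst this
          simp [splice]
        · have h1 : ¬ i.1 < m + 1 := by omega
          have h2 : i ≠ ⟨m, hm'⟩ := fun h => hi' (congrArg Fin.val h)
          simp [splice, hi, h1, h2]
  have hn := key n le_rfl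
  rw [Matrix.dotProduct_mulVec]
  have e1 : π 0 φ ᵥ* (List.ofFn fun i => (LinearMap.toMatrix' (step i (σ i)))ᵀ).prod =
      π n (pullback (splice n σ) φ) := hn
  rw [e1]
  set v := π n (pullback (splice n σ) φ) with hv
  have e2 : ι n v = ∑ j, v j • ι n (Pi.single j 1) := by
    conv_lhs => rw [show v = ∑ j, v j • (Pi.single j 1 : Fin D → ℂ) by
      ext i; simp [Finset.sum_apply, Pi.single_apply]]
    simp only [map_sum, map_smul]
  have e3 : ι n v = pullback (splice n σ) φ := hιπ n le_rfl _ (pullback_mem_rowSpace n φ σ)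
  have e4 : φ σ = (ι n v) ρ := by
    rw [e3]
    exact congrArg φ.ofLp (funext fun i => by simp [splice])
  rw [e4, e2]
  simp [dotProduct]

theorem IsMPS.smul {D : ℕ} {φ : Space n d} (h : IsMPS D φ) (c : ℂ) : IsMPS D (c • φ) := by
  obtain ⟨A, l, r, hA⟩ := h
  exact ⟨A, c • l, r, fun σ => by rw [PiLp.smul_apply, hA, smul_dotProduct]⟩

/-- Expanding `‖ψ - φ‖ ^ 2` leaves `(‖φ‖ - 1) ^ 2 + η ^ 2 * (2 * ‖φ‖ - 1)`, which is nonnegative for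
`‖φ‖ ≥ 1 / 2`. The loss is quadratic in `η`, even after normalising. -/
theorem one_sub_sq_le_norm_inner {ψ φ : Space n d} (hψ : ‖ψ‖ = 1) {η : ℝ} (hη : η ≤ 1 / 2)
    (h : ‖ψ - φ‖ ≤ η) : φ ≠ 0 ∧ 1 - η ^ 2 ≤ ‖inner ℂ ψ (((‖φ‖⁻¹ : ℝ) : ℂ) • φ)‖ := by
  have hN : 1 / 2 ≤ ‖φ‖ := by
    have := norm_sub_norm_le ψ φ
    rw [hψ] at this
    linarith
  have hN0 : 0 < ‖φ‖ := by linarith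
  refine ⟨norm_pos_iff.1 hN0, ?_⟩
  have h1 := norm_sub_sq (𝕜 := ℂ) ψ φ
  rw [hψ] at h1
  have h2 : ‖ψ - φ‖ ^ 2 ≤ η ^ 2 := pow_le_pow_left₀ (norm_nonneg _) h 2
  have h3 : (inner ℂ ψ φ).re ≤ ‖inner ℂ ψ φ‖ := Complex.re_le_norm _
  have h4 : RCLike.re (inner ℂ ψ φ) = (inner ℂ ψ φ).re := rfl
  rw [h4] at h1
  rw [inner_smul_right, norm_mul, Complex.norm_real, norm_inv, norm_norm, ← div_eq_inv_mul,
    le_div_iff₀ hN0]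
  nlinarith [sq_nonneg (‖φ‖ - 1), mul_nonneg (sq_nonneg η) (by linarith : 0 ≤ 2 * ‖φ‖ - 1)]

end SpinChain
end

/-! ### The bond dimension. -/

noncomputable section

namespace SpinChain
variable {n d : ℕ}

/-- As the gap is bounded, `m` is polynomially bounded in the target quantity, and logarithms of `m`
become logarithms of it. -/
theorem le_mul_sq_two_add_rpow_mul_rpow {F ε m : ℝ} (hF : 1 ≤ F) (hε : 0 < ε) (hεF : ε ≤ F)
    (hm0 : 0 < m) : m ≤ F * (2 + ε ^ (-(1 / 4) : ℝ) * m ^ (3 / 4 : ℝ)) ^ 2 := by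
  set Y := ε ^ (-(1 / 4) : ℝ) * m ^ (3 / 4 : ℝ) with hY
  have hY0 : 0 < Y := by positivity
  have hY4 : Y ^ 4 = ε⁻¹ * m ^ 3 := by
    rw [hY, mul_pow, ← Real.rpow_natCast, ← Real.rpow_mul hε.le, ← Real.rpow_natCast,
      ← Real.rpow_mul hm0.le, ← Real.rpow_neg_one, ← Real.rpow_natCast]
    norm_num
  have hm3 : m ^ 3 ≤ F * Y ^ 4 := by
    rw [hY4]
    have : 1 ≤ F * ε⁻¹ := by rw [← div_eq_mul_inv]; exact (one_le_div hε).2 hεF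
    nlinarith [pow_pos hm0 3]
  refine le_of_pow_le_pow_left₀ (n := 3) (by norm_num) (by positivity) (hm3.trans ?_)
  rw [mul_pow F, ← pow_mul (2 + Y)]
  have h1 : Y ^ 4 ≤ (2 + Y) ^ 4 := pow_le_pow_left₀ hY0.le (by linarith) 4
  have h2 : (2 + Y) ^ 4 ≤ (2 + Y) ^ 6 := pow_le_pow_right₀ (by linarith) (by norm_num)
  have h3 : F ≤ F ^ 3 := le_self_pow₀ hF (by norm_num)
  gcongr
  exact h1.trans h2

/-- Since `t` is at most of order `m log ^ 4 m`, the power `t ^ (3/4)` contributes three logarithms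
and `log t` a fourth. -/
theorem exists_exponent_bound {C c F B : ℝ} (hC : 1 ≤ C) (hc : 0 ≤ c) (hF : 1 ≤ F) (hB : 0 ≤ B) :
    ∃ K : ℝ, ∀ ε x m L t : ℝ, 0 < ε → ε ≤ F → x = (min ε 1)⁻¹ → ε⁻¹ ≤ m → L ≤ m →
      t = max (C * (x * Real.log (2 + x) ^ 4)) (B * L) →
      c * (t ^ (3 / 4 : ℝ) * x ^ (1 / 4 : ℝ) * Real.log (2 + t)) ≤
        K * ((ε ^ (-(1 / 4) : ℝ) * m ^ (3 / 4 : ℝ)) *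
          Real.log (2 + ε ^ (-(1 / 4) : ℝ) * m ^ (3 / 4 : ℝ)) ^ 4) := by
  set a := 2 + 4 * F with ha
  have ha0 : 0 < a := by positivity
  set T := C * F * a ^ 4 + 16 * B with hT
  have hT0 : 0 < T := by positivity
  refine ⟨c * (T ^ (3 / 4 : ℝ) * F ^ (1 / 4 : ℝ) * (2 * T + 5) * a ^ 4), ?_⟩
  intro ε x m L t hε hεF hx hm hL ht
  have hmin : 0 < min ε 1 := lt_min hε one_pos
  have hx0 : 0 < x := by rw [hx]; positivity
  have hεi : 0 < ε⁻¹ := inv_pos.2 hε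
  have hm0 : 0 < m := hεi.trans_le hm
  have hxε : x ≤ F * ε⁻¹ := by
    rw [hx, inv_le_comm₀ hmin (by positivity), mul_inv, inv_inv, inv_mul_eq_div]
    exact le_min (div_le_self hε.le hF) ((div_le_one (by positivity)).2 hεF)
  have hxm : x ≤ F * m := hxε.trans (by gcongr)
  set ℓ := Real.log (2 + m) with hℓ
  have hℓh : 1 / 2 ≤ ℓ := Real.half_le_log_two_add hm0.le
  have hlx : Real.log (2 + x) ≤ a * ℓ :=
    log_le_mul_log_two_add (by positivity) hm0.le (by positivity) (by
      nlinarith [mul_pos hm0 hm0, mul_pos (zero_lt_one.trans_le hF) hm0])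
  have hlx0 : 0 ≤ Real.log (2 + x) := Real.log_nonneg (by linarith)
  have hℓ4 : 1 ≤ 16 * ℓ ^ 4 := by
    have : (1 / 2 : ℝ) ^ 4 ≤ ℓ ^ 4 := pow_le_pow_left₀ (by norm_num) hℓh 4
    linarith
  have htm : t ≤ T * (m * ℓ ^ 4) := by
    rw [ht]
    have h1 : C * (x * Real.log (2 + x) ^ 4) ≤ C * (F * m * (a * ℓ) ^ 4) := by gcongr
    have h2 : B * L ≤ B * m := by gcongr
    have h3 : B * m * 1 ≤ B * m * (16 * ℓ ^ 4) := by gcongr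
    have h4 : 0 ≤ B * m * (16 * ℓ ^ 4) := by positivity
    have h5 : 0 ≤ C * (F * m * (a * ℓ) ^ 4) := by positivity
    refine max_le ?_ ?_ <;> rw [hT] <;> nlinarith
  have ht0 : 0 < t := by
    rw [ht]
    have : 0 < Real.log (2 + x) := Real.log_pos (by linarith)
    exact lt_max_of_lt_left (by positivity)
  have hℓm : ℓ ≤ 1 + m := by
    have := Real.log_le_sub_one_of_pos (show 0 < 2 + m by linarith)
    linarith
  have hlt : Real.log (2 + t) ≤ (2 * T + 5) * ℓ := by
    have h1 : 2 + t ≤ (1 + T) * (2 + m) ^ 5 := by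
      have h2 : T * (m * ℓ ^ 4) ≤ T * ((2 + m) * (2 + m) ^ 4) := by
        gcongr <;> linarith
      have h3 : (2 : ℝ) ^ 5 ≤ (2 + m) ^ 5 := pow_le_pow_left₀ (by norm_num) (by linarith) 5
      have h4 : T * ((2 + m) * (2 + m) ^ 4) = T * (2 + m) ^ 5 := by ring
      linarith
    have h2 := Real.log_le_log (by linarith) h1
    rw [Real.log_mul (by positivity) (by positivity), Real.log_pow] at h2
    have h3 := Real.log_le_sub_one_of_pos (show 0 < 1 + T by linarith)
    push_cast at h2
    nlinarith
  set Y := ε ^ (-(1 / 4) : ℝ) * m ^ (3 / 4 : ℝ) with hY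
  have hY0 : 0 < Y := by positivity
  have hmY : m ≤ F * (2 + Y) ^ 2 := le_mul_sq_two_add_rpow_mul_rpow hF hε hεF hm0
  have hℓY : ℓ ≤ a * Real.log (2 + Y) :=
    log_le_mul_log_two_add (by positivity) hY0.le (by positivity) (by
      nlinarith [sq_nonneg (F * (2 + Y)), mul_pos (zero_lt_one.trans_le hF) (pow_pos hY0 2),
        mul_pos (zero_lt_one.trans_le hF) hY0, pow_pos hY0 2])
  have ht34 : t ^ (3 / 4 : ℝ) ≤ T ^ (3 / 4 : ℝ) * (m ^ (3 / 4 : ℝ) * ℓ ^ 3) := by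
    refine (Real.rpow_le_rpow ht0.le htm (by norm_num)).trans_eq ?_
    rw [Real.mul_rpow hT0.le (by positivity), Real.mul_rpow hm0.le (by positivity),
      ← Real.rpow_natCast ℓ 4, ← Real.rpow_mul (by linarith), ← Real.rpow_natCast ℓ 3]
    norm_num
  have hx14 : x ^ (1 / 4 : ℝ) ≤ F ^ (1 / 4 : ℝ) * ε ^ (-(1 / 4) : ℝ) := by
    refine (Real.rpow_le_rpow hx0.le hxε (by norm_num)).trans_eq ?_
    rw [Real.mul_rpow (by positivity) hεi.le, Real.inv_rpow hε.le, Real.rpow_neg hε.le]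
  have hℓY4 : ℓ ^ 4 ≤ (a * Real.log (2 + Y)) ^ 4 := pow_le_pow_left₀ (by linarith) hℓY 4
  calc c * (t ^ (3 / 4 : ℝ) * x ^ (1 / 4 : ℝ) * Real.log (2 + t))
      ≤ c * ((T ^ (3 / 4 : ℝ) * (m ^ (3 / 4 : ℝ) * ℓ ^ 3)) *
          (F ^ (1 / 4 : ℝ) * ε ^ (-(1 / 4) : ℝ)) * ((2 * T + 5) * ℓ)) := by
        have : 0 ≤ Real.log (2 + t) := Real.log_nonneg (by linarith)
        gcongr
    _ = c * (T ^ (3 / 4 : ℝ) * F ^ (1 / 4 : ℝ) * (2 * T + 5) * Y) * ℓ ^ 4 := by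
        rw [hY]; ring
    _ ≤ c * (T ^ (3 / 4 : ℝ) * F ^ (1 / 4 : ℝ) * (2 * T + 5) * Y) *
          (a * Real.log (2 + Y)) ^ 4 := by gcongr
    _ = _ := by ring

/-- Of the nine spare powers of `n`, two absorb the square of the number of cuts and seven the
constants, as `n ^ 7 ≥ 128`. -/
theorem sq_truncation_error_le {n c : ℕ} (hn : 2 ≤ n) {t : ℝ} (ht : 16 * (c + 9) * Real.log n ≤ t) :
    (2 * ((n + 1 : ℕ) : ℝ) * Real.exp (-t / 32)) ^ 2 ≤ 1 / 8 * (1 / (n : ℝ) ^ c) := by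
  have hn' : (2 : ℝ) ≤ n := by exact_mod_cast hn
  have hn0 : (0 : ℝ) < n := by linarith
  have h1 : Real.exp (-t / 32) ^ 2 ≤ ((n : ℝ) ^ (c + 9))⁻¹ := by
    rw [← Real.exp_nat_mul, ← Real.exp_log (inv_pos.2 (pow_pos hn0 (c + 9))), Real.log_inv,
      Real.log_pow, Real.exp_le_exp]
    push_cast
    linarith
  have h2 : ((n + 1 : ℕ) : ℝ) ≤ 2 * n := by push_cast; linarith
  calc (2 * ((n + 1 : ℕ) : ℝ) * Real.exp (-t / 32)) ^ 2
      = 4 * ((n + 1 : ℕ) : ℝ) ^ 2 * Real.exp (-t / 32) ^ 2 := by ring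
    _ ≤ 4 * (2 * (n : ℝ)) ^ 2 * ((n : ℝ) ^ (c + 9))⁻¹ := by gcongr
    _ ≤ _ := by
      have h3 : (2 : ℝ) ^ 7 ≤ (n : ℝ) ^ 7 := pow_le_pow_left₀ (by norm_num) hn' 7
      rw [← div_eq_mul_inv, div_le_iff₀ (by positivity)]
      have h4 : 1 / 8 * (1 / (n : ℝ) ^ c) * (n : ℝ) ^ (c + 9) = 1 / 8 * (n : ℝ) ^ 9 := by
        rw [pow_add]; field_simp
      rw [h4]
      nlinarith [pow_pos hn0 2]

/-- Ground states of gapped chains are close to matrix product states of small bond dimension. -/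
theorem exists_isMPS_approx (d f c : ℕ) : ∃ (C : ℝ) (k : ℕ), ∀ (n : ℕ)
    (h : Fin (n - 1) → Matrix (Fin d × Fin d) (Fin d × Fin d) ℂ) (E₀ ε : ℝ),
    IsGapped h f E₀ ε → ∀ ψ : Space n d, IsGroundState h E₀ ψ →
    ∃ (D : ℕ) (φ : Space n d), IsMPS D φ ∧ ‖φ‖ = 1 ∧
      (D : ℝ) ≤ (2 : ℝ) ^ softBound C k
        (ε ^ (-(1 / 4) : ℝ) * (max (Real.log n) ε⁻¹) ^ (3 / 4 : ℝ)) ∧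
      1 - 1 / (n : ℝ) ^ c < ‖inner ℂ ψ φ‖ := by
  obtain ⟨C, c₁, hC, hc₁, happrox⟩ := exists_lowRank_approx d f
  obtain ⟨K, hK⟩ := exists_exponent_bound hC hc₁ (F := f + 1) (B := 16 * (c + 9))
    (by linarith [(Nat.cast_nonneg f : (0 : ℝ) ≤ f)]) (by positivity)
  refine ⟨K / Real.log 2, 4, fun n h E₀ ε hgap ψ hψ => ?_⟩
  have hn : 2 ≤ n := hgap.two_le_length
  have hd : 2 ≤ d := hgap.two_le_dim
  set t := max (C * ((min ε 1)⁻¹ * Real.log (2 + (min ε 1)⁻¹) ^ 4)) (16 * (c + 9) * Real.log n)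
    with ht
  set e := c₁ * (t ^ (3 / 4 : ℝ) * (min ε 1)⁻¹ ^ (1 / 4 : ℝ) * Real.log (2 + t)) with he
  have hcut : ∀ k, ∃ y : Space n d, schmidtRank k y ≤ ⌊Real.exp e⌋₊ ∧
      ‖ψ - y‖ ≤ Real.exp (-t / 32) := by
    intro k
    obtain ⟨y, hy, hy'⟩ := happrox n h E₀ ε hgap ψ hψ k _ t rfl (le_max_left _ _)
    exact ⟨y, Nat.le_floor hy, hy'⟩
  -- All cuts `0, …, n` are needed, including the trivial ones at both ends, since each carries a
  -- bond space of the matrix product.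
  obtain ⟨φ, hφ, hψφ, -⟩ := exists_low_schmidtRank_all_cuts hcut (n + 1)
  have herr := sq_truncation_error_le hn (c := c) (t := t) (le_max_right _ _)
  have hn1 : (1 : ℝ) ≤ (n : ℝ) ^ c := one_le_pow₀ (by exact_mod_cast (by omega : 1 ≤ n))
  have hη : 2 * ((n + 1 : ℕ) : ℝ) * Real.exp (-t / 32) ≤ 1 / 2 := by
    refine le_of_sq_le_sq (herr.trans ?_) (by norm_num)
    have : 1 / (n : ℝ) ^ c ≤ 1 := (div_le_one (by linarith)).2 hn1
    linarith
  obtain ⟨hφ0, hov⟩ := one_sub_sq_le_norm_inner hψ.2 hη hψφ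
  have hpos : 0 < 1 / (n : ℝ) ^ c := by positivity
  refine ⟨⌊Real.exp e⌋₊, ((‖φ‖⁻¹ : ℝ) : ℂ) • φ, ?_, ?_, ?_, by linarith⟩
  · exact (isMPS_of_schmidtRank_le ⟨fun _ => ⟨0, by omega⟩⟩ fun k hk => hφ k (by omega)).smul _
  · rw [norm_smul, Complex.norm_real, norm_inv, norm_norm]
    exact inv_mul_cancel₀ (norm_ne_zero_iff.2 hφ0)
  · have hb := hK ε _ (max (Real.log n) ε⁻¹) (Real.log n) t hgap.pos
      (hgap.gap_le.trans (by linarith)) rfl (le_max_right _ _) (le_max_left _ _) ht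
    refine (Nat.floor_le (Real.exp_pos _).le).trans ?_
    rw [Real.rpow_def_of_pos two_pos, softBound, Real.exp_le_exp]
    refine hb.trans_eq ?_
    have : Real.log 2 ≠ 0 := (Real.log_pos one_lt_two).ne'
    field_simp

end SpinChain
end

theorem theorem1 (d f : ℕ) :
    (∃ (C : ℝ) (k : ℕ), ∀ (n : ℕ)
      (h : Fin (n - 1) → Matrix (Fin d × Fin d) (Fin d × Fin d) ℂ) (E₀ ε : ℝ),
      SpinChain.IsGapped h f E₀ ε →
      ∀ ψ : SpinChain.Space n d, SpinChain.IsGroundState h E₀ ψ →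
      ∀ α : ℝ, 0 < α → α < 1 → ∀ cut : ℕ, 0 < cut → cut < n →
        SpinChain.renyiEntropy α cut ψ ≤ SpinChain.softBound C k (α ^ (-3 : ℝ) / ε)) ∧
    (∀ c : ℕ, ∃ (C : ℝ) (k : ℕ), ∀ (n : ℕ)
      (h : Fin (n - 1) → Matrix (Fin d × Fin d) (Fin d × Fin d) ℂ) (E₀ ε : ℝ),
      SpinChain.IsGapped h f E₀ ε →
      ∀ ψ : SpinChain.Space n d, SpinChain.IsGroundState h E₀ ψ →
      ∃ (D : ℕ) (φ : SpinChain.Space n d), SpinChain.IsMPS D φ ∧ ‖φ‖ = 1 ∧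
        (D : ℝ) ≤ (2 : ℝ) ^ SpinChain.softBound C k
          (ε ^ (-(1 / 4) : ℝ) * (max (Real.log n) ε⁻¹) ^ (3 / 4 : ℝ)) ∧
        1 - 1 / (n : ℝ) ^ c < ‖inner ℂ ψ φ‖) ∧
    (f = 1 → ∃ (C : ℝ) (k : ℕ), ∀ (n : ℕ)
      (h : Fin (n - 1) → Matrix (Fin d × Fin d) (Fin d × Fin d) ℂ) (E₀ ε : ℝ),
      SpinChain.IsGapped h f E₀ ε →
      ∀ ψ : SpinChain.Space n d, SpinChain.IsGroundState h E₀ ψ →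
      ∀ cut : ℕ, 0 < cut → cut < n →
        SpinChain.vonNeumannEntropy cut ψ ≤ SpinChain.softBound C k ε⁻¹) :=
  ⟨SpinChain.exists_renyiEntropy_bound d f, SpinChain.exists_isMPS_approx d f,
    fun _ => SpinChain.exists_vonNeumannEntropy_bound d f⟩
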